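/- Let $N\ge 1$ and let $W=\mathfrak S_N$ with simple reflections $S=\{s_1,\dots,s_{N-1}\}$, $s_i=(i\ i+1)$, so that right multiplication permutes the positions in the one-line notation $w(1)\cdots w(N)$. For $K\subseteq S$ let $W_K=\langle K\rangle$, let $w_0(K)$ be the longest element of $W_K$, and let $x^K$ be the shortest element of the coset $xW_K$. For a position interval $[a,b]$ with $a<b$ the corresponding connected subset of $S$ is $\{s_a,\dots,s_{b-1}\}$; the connected components of $K\subseteq S$ are the maximal connected subsets of $K$, identified with such intervals. **Factorizations.** For a finite sequence $J=(J_1,\dots,J_r)$ of subsets of $S$ let $w(J)=w_0(J_1)\star\cdots\star w_0(J_r)$ be the Demazure product (so $x\star w_0(K)=x^K w_0(K)$, the longest element of $xW_K$). $J$ is a factorization of $w$ if $w(J)=w$. **Monotone.** An interval $[a,b]$, $a<b$, is a right-descent interval of $w$ if $w(a)>w(a+1)>\dots>w(b)$. It is a strong right-descent interval (then automatically a connected component of the right descent set of $w$, called a strong right-descent component) if moreover $w(q)<w(a)$ for all $q<a$ and $w(b)<w(q)$ for all $q>b$. A position $p\in[a,b]$ is then left-directed if $w(q)<w(p)$ for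 all $q<a$, and right-directed if $w(p)<w(q)$ for all $q>b$; $[a,b]$ is monotone if each of its positions is left-directed or right-directed. $J$ is right-monotone if for every $k$ each connected component of $J_k$ is a monotone strong right-descent interval of $w(J_1,\dots,J_k)$, left-monotone if the reversed sequence $(J_r,\dots,J_1)$ is right-monotone, and monotone if it is both. **Minimal.** $J$ has a right-contraction if for some $k$ some connected component of $J_k$ is a right-descent interval of $w(J_1,\dots,J_{k-1})$ (so that it can be deleted from $J_k$ without changing any $w(J_1,\dots,J_l)$), and a left-contraction if the reversed sequence has a right-contraction. $J$ is minimal if it has neither. **Equivalence.** The Cartier–Foata monoid is generated by the nonempty connected subsets of $S$, subject to $CD=DC$ whenever the corresponding position intervals are disjoint. The class of $J_1,\dots,J_r$ is the product over $k=1,\dots,r$, in this order, of the (commuting) connected components of $J_k$. Two sequences are equivalent if they have the same class. **Proposition.** (1) For every $w\in W$ that avoids the patterns $4231$ and $45312$ there is a minimal monotone factorization of $w$, and every minimal monotone factorization of $w$ is equivalent to it. The following algorithm terminates on $w$ and returns such a factorization. Start with $x=w$ and the empty sequence. While $x\neq e$: let $C_1,\dots,C_m$ be the strong right-descent components of $x$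 and let $C=\bigcup_i C_i\subseteq S$; add $C$ at the beginning of the sequence; for each $C_i=[a,b]$, let $l,r\in[a,b]$ be such that the left-directed positions of $[a,b]$ for $x$ are those of $[a,l]$ and the right-directed ones those of $[r,b]$, and let $J_{*,i}$ be the set of simple reflections that exchange two adjacent positions of $[a,a+b-l)$ or two adjacent positions of $(b-r+a,b]$; let $J_*=\bigcup_i J_{*,i}$ and replace $x$ by $x^{C}w_0(J_*)$. When $x=e$, return the sequence. (2) A permutation $w\in W$ has a monotone factorization if and only if it avoids both $4231$ and $45312$. -/

import Mathlib

open Equiv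

namespace SymmFactorization

noncomputable section

/-! ## The symmetric group as a Coxeter group

`W = Perm (Fin (n + 1))`. Positions are the elements of `Fin (n + 1)`, and `i : Fin n` indexes the
simple reflection exchanging the adjacent positions `i.castSucc` and `i.succ`. A permutation `w` has
one-line notation `w 0, w 1, …, w n`, so right multiplication permutes positions. -/

/-- The simple reflection with index `i`. -/
def simple {n : ℕ} (i : Fin n) : Perm (Fin (n + 1)) := swap i.castSucc i.succ

/-- The standard parabolic subgroup `W_K` generated by the simple reflections in `K`. -/
def parabolic {n : ℕ} (K : Finset (Fin n)) : Subgroup (Perm (Fin (n + 1))) :=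
  Subgroup.closure (simple '' (K : Set (Fin n)))

/-- The Coxeter length of `w`, as its number of inversions. -/
def len {n : ℕ} (w : Perm (Fin (n + 1))) : ℕ :=
  Nat.card {p : Fin (n + 1) × Fin (n + 1) // p.1 < p.2 ∧ w p.2 < w p.1}

theorem exists_longest {n : ℕ} (K : Finset (Fin n)) :
    ∃ y ∈ parabolic K, ∀ z ∈ parabolic K, len z ≤ len y := by
  obtain ⟨y, hy⟩ := Finite.exists_max (fun z : parabolic K => len z.1)
  exact ⟨y.1, y.2, fun z hz => hy ⟨z, hz⟩⟩

/-- `w₀(K)`: the longest element of the parabolic subgroup `W_K`. -/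
def longest {n : ℕ} (K : Finset (Fin n)) : Perm (Fin (n + 1)) :=
  (exists_longest K).choose

theorem exists_minRep {n : ℕ} (K : Finset (Fin n)) (x : Perm (Fin (n + 1))) :
    ∃ y, x⁻¹ * y ∈ parabolic K ∧ ∀ z, x⁻¹ * z ∈ parabolic K → len y ≤ len z := by
  have : Nonempty {y : Perm (Fin (n + 1)) // x⁻¹ * y ∈ parabolic K} :=
    ⟨⟨x, by simp [(parabolic K).one_mem]⟩⟩
  obtain ⟨y, hy⟩ := Finite.exists_min
    (fun z : {y : Perm (Fin (n + 1)) // x⁻¹ * y ∈ parabolic K} => len z.1)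
  exact ⟨y.1, y.2, fun z hz => hy ⟨z, hz⟩⟩

/-- The minimal-length representative of the coset `x W_K`. -/
def minRep {n : ℕ} (K : Finset (Fin n)) (x : Perm (Fin (n + 1))) : Perm (Fin (n + 1)) :=
  (exists_minRep K x).choose

/-! ## Pattern avoidance -/

/-- `w` realizes the pattern with one-line notation `π`. -/
def Realizes {n k : ℕ} (w : Perm (Fin (n + 1))) (π : Fin k → ℕ) : Prop :=
  ∃ p : Fin k → Fin (n + 1), StrictMono p ∧ ∀ i j, w (p i) < w (p j) ↔ π i < π j

/-- `w` avoids both patterns `4231` and `45312`. -/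
def Avoids {n : ℕ} (w : Perm (Fin (n + 1))) : Prop :=
  ¬ Realizes w ![4, 2, 3, 1] ∧ ¬ Realizes w ![4, 5, 3, 1, 2]

/-! ## Connected components and factorizations -/

/-- Intervals of positions `[a, b]` with `a < b`. They correspond to the nonempty connected sets of
simple reflections: `[a, b]` stands for all simple reflections exchanging two adjacent positions
of `[a, b]`. -/
abbrev PosInterval (n : ℕ) := {e : Fin (n + 1) × Fin (n + 1) // e.1 < e.2}

/-- `e = [a, b]` is a connected component of `K`: all simple reflections inside `[a, b]` lie
in `K`, but the ones exchanging `a - 1, a` and `b, b + 1` (where they exist) do not. -/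
def IsComponent {n : ℕ} (K : Finset (Fin n)) (e : PosInterval n) : Prop :=
  (∀ i : Fin n, e.1.1 ≤ i.castSucc → i.succ ≤ e.1.2 → i ∈ K) ∧
  (∀ i : Fin n, i.succ = e.1.1 → i ∉ K) ∧
  (∀ i : Fin n, i.castSucc = e.1.2 → i ∉ K)

open Classical in
/-- The set of connected components of `K`. -/
def components {n : ℕ} (K : Finset (Fin n)) : Finset (PosInterval n) :=
  Finset.univ.filter (IsComponent K)

/-- The Demazure product `w₀(J₁) ⋆ ⋯ ⋆ w₀(Jᵣ)`, computed from left to right: `x ⋆ w₀(K)` is the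
longest element of the coset `x W_K`, that is, the minimal representative of `x W_K` times `w₀(K)`.
A list `J` is a factorization of `w` when `demazure J = w`. -/
def demazure {n : ℕ} (J : List (Finset (Fin n))) : Perm (Fin (n + 1)) :=
  J.foldl (fun x K => minRep K x * longest K) 1

/-! ## Right-descent intervals -/

/-- `[a, b]` is a right-descent interval of `w`: `w a > w (a + 1) > ⋯ > w b`. -/
def IsDescentInterval {n : ℕ} (w : Perm (Fin (n + 1))) (e : PosInterval n) : Prop :=
  StrictAntiOn w (Set.Icc e.1.1 e.1.2)

/-- `w p` is greater than all values of `w` at positions to the left of the interval `e`. For `p = a`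
and `e = [a, b]` this says that `a` is strong left-directed (a left-to-right maximum); for a general
`p` in a strong right-descent interval `e` it says that `p` is left-directed. -/
def LeftDirected {n : ℕ} (w : Perm (Fin (n + 1))) (e : PosInterval n) (p : Fin (n + 1)) : Prop :=
  ∀ q, q < e.1.1 → w q < w p

/-- `w p` is smaller than all values of `w` at positions to the right of the interval `e`. -/
def RightDirected {n : ℕ} (w : Perm (Fin (n + 1))) (e : PosInterval n) (p : Fin (n + 1)) : Prop :=
  ∀ q, e.1.2 < q → w p < w q

/-- `[a, b]` is a strong right-descent interval of `w`: a right-descent interval such that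
`w a` is a left-to-right maximum and `w b` is a right-to-left minimum. Such an interval is
automatically a connected component of the right descent set of `w`. -/
def IsStrongDescentInterval {n : ℕ} (w : Perm (Fin (n + 1))) (e : PosInterval n) : Prop :=
  IsDescentInterval w e ∧ LeftDirected w e e.1.1 ∧ RightDirected w e e.1.2

/-- A monotone interval: a strong right-descent interval each of whose positions is left-directed
or right-directed. -/
def IsMonotoneInterval {n : ℕ} (w : Perm (Fin (n + 1))) (e : PosInterval n) : Prop :=
  IsStrongDescentInterval w e ∧
    ∀ p, e.1.1 ≤ p → p ≤ e.1.2 → LeftDirected w e p ∨ RightDirected w e p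

/-! ## Monotone and minimal factorizations

The left-handed notions are the right-handed ones for the reversed list, whose Demazure product is
the inverse of that of the list. -/

/-- `J₁, …, Jᵣ` is right-monotone: for all `k`, every connected component of `Jₖ` is a monotone
interval of `w(J₁, …, Jₖ)`. In particular these are strong right-descent intervals. -/
def RightMonotone {n : ℕ} (J : List (Finset (Fin n))) : Prop :=
  ∀ L K R, J = L ++ K :: R → ∀ e ∈ components K, IsMonotoneInterval (demazure (L ++ [K])) e

/-- A factorization is monotone if it is right-monotone and left-monotone. -/
def Monotone {n : ℕ} (J : List (Finset (Fin n))) : Prop :=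
  RightMonotone J ∧ RightMonotone J.reverse

/-- `J₁, …, Jᵣ` admits a right-contraction: some connected component of some `Jₖ` consists of
right descents of `w(J₁, …, Jₖ₋₁)`, so that deleting this component from `Jₖ` changes none of the
products `w(J₁, …, Jₗ)`. -/
def HasRightContraction {n : ℕ} (J : List (Finset (Fin n))) : Prop :=
  ∃ L K R, J = L ++ K :: R ∧ ∃ e ∈ components K, IsDescentInterval (demazure L) e

/-- A factorization is minimal if it admits neither a right-contraction nor a left-contraction. -/
def Minimal {n : ℕ} (J : List (Finset (Fin n))) : Prop :=
  ¬ HasRightContraction J ∧ ¬ HasRightContraction J.reverse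

/-! ## The Cartier–Foata monoid -/

/-- The position intervals `e` and `f` are disjoint; equivalently, the corresponding sets of simple
reflections are disjoint and commute elementwise. -/
def Separated {n : ℕ} (e f : PosInterval n) : Prop :=
  e.1.2 < f.1.1 ∨ f.1.2 < e.1.1

/-- The defining relations `e f = f e` for separated `e` and `f`. -/
inductive CommRel (n : ℕ) : FreeMonoid (PosInterval n) → FreeMonoid (PosInterval n) → Prop
  | swap (e f : PosInterval n) (h : Separated e f) :
      CommRel n (FreeMonoid.of e * FreeMonoid.of f) (FreeMonoid.of f * FreeMonoid.of e)

/-- The Cartier–Foata (free partially commutative) monoid on the nonempty connected sets of simple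
reflections. -/
abbrev CartierFoata (n : ℕ) := PresentedMonoid (CommRel n)

theorem separated_of_mem {n : ℕ} {K : Finset (Fin n)} {e f : PosInterval n}
    (he : e ∈ components K) (hf : f ∈ components K) (hne : e ≠ f) : Separated e f := by
  obtain ⟨⟨a, b⟩, hab⟩ := e
  obtain ⟨⟨c, d⟩, hcd⟩ := f
  simp only [components, Finset.mem_filter, Finset.mem_univ, true_and, IsComponent] at he hf
  obtain ⟨e1, e2, e3⟩ := he
  obtain ⟨f1, f2, f3⟩ := hf
  by_contra hs
  simp only [Separated, not_or, not_lt] at hs hab hcd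
  obtain ⟨h1, h2⟩ := hs
  have hac : a = c := by
    rcases lt_trichotomy a c with h | h | h
    · obtain ⟨i, rfl⟩ := Fin.exists_succ_eq.2 (Fin.ne_zero_of_lt h)
      exact absurd (e1 i (by simpa [Fin.le_def, Fin.lt_def, Nat.lt_succ_iff] using h) h1)
        (f2 i rfl)
    · exact h
    · obtain ⟨i, rfl⟩ := Fin.exists_succ_eq.2 (Fin.ne_zero_of_lt h)
      exact absurd (f1 i (by simpa [Fin.le_def, Fin.lt_def, Nat.lt_succ_iff] using h) h2)
        (e2 i rfl)
  have hbd : b = d := by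
    rcases lt_trichotomy b d with h | h | h
    · obtain ⟨i, rfl⟩ := Fin.exists_castSucc_eq.2 (Fin.ne_last_of_lt h)
      exact absurd (f1 i h1 (by simpa [Fin.le_def, Fin.lt_def, Nat.succ_le_iff] using h))
        (e3 i rfl)
    · exact h
    · obtain ⟨i, rfl⟩ := Fin.exists_castSucc_eq.2 (Fin.ne_last_of_lt h)
      exact absurd (e1 i h2 (by simpa [Fin.le_def, Fin.lt_def, Nat.succ_le_iff] using h))
        (f3 i rfl)
  exact hne (by simp [hac, hbd])

theorem components_commute {n : ℕ} (K : Finset (Fin n)) :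
    (components K : Set (PosInterval n)).Pairwise
      (Function.onFun Commute (PresentedMonoid.of (CommRel n))) := fun e he f hf hne =>
  (Con.eq (conGen (CommRel n))).2 (ConGen.Rel.of _ _ (CommRel.swap e f (separated_of_mem he hf hne)))

/-- The class of `K`: the product of its (pairwise commuting) connected components. -/
def setClass {n : ℕ} (K : Finset (Fin n)) : CartierFoata n :=
  (components K).noncommProd (PresentedMonoid.of (CommRel n)) (components_commute K)

/-- The class of `J₁, …, Jᵣ` in the Cartier–Foata monoid. -/
def factorizationClass {n : ℕ} (J : List (Finset (Fin n))) : CartierFoata n :=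
  (J.map setClass).prod

/-! ## The algorithm -/

open Classical in
/-- The union of the strong right-descent components of `x`, as a set of simple reflections. -/
def strongDescents {n : ℕ} (x : Perm (Fin (n + 1))) : Finset (Fin n) :=
  Finset.univ.filter fun i => ∃ e : PosInterval n,
    IsStrongDescentInterval x e ∧ e.1.1 ≤ i.castSucc ∧ i.succ ≤ e.1.2

/-- The simple reflection `i` lies in `J_*` for the strong right-descent component `[a, b]` of `x`:
if `[a, l]` and `[r, b]` are the sets of left-directed and of right-directed positions of `[a, b]`,
then `J_*` consists of the simple reflections exchanging two adjacent positions
of `[a, a + b - l)` or two adjacent positions of `(b - r + a, b]`. -/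
def InStar {n : ℕ} (x : Perm (Fin (n + 1))) (e : PosInterval n) (i : Fin n) : Prop :=
  ∃ l ∈ Set.Icc e.1.1 e.1.2, ∃ r ∈ Set.Icc e.1.1 e.1.2,
    (∀ p ∈ Set.Icc e.1.1 e.1.2, LeftDirected x e p ↔ p ≤ l) ∧
    (∀ p ∈ Set.Icc e.1.1 e.1.2, RightDirected x e p ↔ r ≤ p) ∧
    ((e.1.1 ≤ i.castSucc ∧ (i.succ : ℕ) < e.1.1 + e.1.2 - l) ∨
      ((e.1.2 : ℕ) - r + e.1.1 < i.castSucc ∧ i.succ ≤ e.1.2))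

open Classical in
/-- The union of the sets `J_*` over all strong right-descent components of `x`. -/
def star {n : ℕ} (x : Perm (Fin (n + 1))) : Finset (Fin n) :=
  Finset.univ.filter fun i => ∃ e : PosInterval n, IsStrongDescentInterval x e ∧ InStar x e i

/-- The update of `x` in one pass through the loop. -/
def step {n : ℕ} (x : Perm (Fin (n + 1))) : Perm (Fin (n + 1)) :=
  minRep (strongDescents x) x * longest (star x)

/-- `AlgorithmReturns x J`: the loop, started at `x` with an empty sequence, terminates and
returns `J`. While `x ≠ 1`, the set `strongDescents x` is added at the beginning of the sequence and
`x` is replaced by `step x`; hence the sets found later stand to the left of it. -/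
inductive AlgorithmReturns {n : ℕ} : Perm (Fin (n + 1)) → List (Finset (Fin n)) → Prop
  | done : AlgorithmReturns 1 []
  | iterate (x : Perm (Fin (n + 1))) (J : List (Finset (Fin n))) (hx : x ≠ 1)
      (h : AlgorithmReturns (step x) J) : AlgorithmReturns x (J ++ [strongDescents x])

end

end SymmFactorization

namespace SymmFactorization

variable {n : ℕ}

/-! ## Simple reflections and parabolic subgroups -/

/-! Listing the connected components of each `J_k` turns a sequence into a word of position
intervals (`IsFlat`). Components of one set commute, so monotonicity and minimality of the sequence
become conditions on single letters of the word (`RMono`, `LMono`, `RReduced`, `LReduced`, together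
`Good`). A letter acts on the right by sorting the values at its positions into decreasing order
(`srt`). Left and right sorting commute (`lsrt_srt`), so a word can be evaluated from either end,
reversing it inverts the product, and the inversions of a suffix persist in the whole product.

The core is a local description of the last letter. If x is split at C (`Split`), every position of
C is directed, and two positions of C are inverted exactly when both fail to be right-directed or
both fail to be left-directed. Directedness depends only on the value and on the values outside C,
so a split x is determined by x ⋆ w₀(C) (`Split.eq_of_eq_off`). By `Good.snoc`, `Good.of_snoc` and
`Good.split_of_snoc`, a word I ++ [C] is minimal monotone if and only if I is and the product of I
is split at C. Both directions rest on one structural fact. Let C = [a, b], and let [l, b] be the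
positions of C that are not right-directed for the product of I, if there are any. The last letter
of I that meets [l, b] starts exactly at l and ends beyond b (`RightStructure`). The left-hand
statements follow by conjugating with the longest permutation (`flip`).

The rest is induction. Sorting at a split interval neither creates nor destroys the two patterns, so
products of minimal monotone words avoid them; a monotone word becomes minimal by deleting
contractions (`exists_good`). Conversely, let w avoid both patterns. Avoiding 4231 yields a strong
right-descent component when w ≠ 1. Avoiding 45312 makes every such component monotone. The update
`step w` is split at all of them (`split_step`), and sorting them gives back w. Hence the algorithm
loses inversions at each pass, terminates, and returns a minimal monotone word.

For uniqueness, the last letter C of any minimal monotone word for w is a strong right-descent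
component of w, so it occurs among the last letters of the algorithm's word and can be commuted to
its end. Splitness at C identifies the two products before C, and induction on the number of
inversions finishes (`Good.wordClass_eq`). -/

@[simp] theorem simple_castSucc (i : Fin n) : simple i i.castSucc = i.succ := swap_apply_left _ _

@[simp] theorem simple_succ (i : Fin n) : simple i i.succ = i.castSucc := swap_apply_right _ _

theorem simple_of_ne {i : Fin n} {p : Fin (n + 1)} (h : p ≠ i.castSucc) (h' : p ≠ i.succ) :
    simple i p = p := swap_apply_of_ne_of_ne h h'

@[simp] theorem simple_mul_self (i : Fin n) : simple i * simple i = 1 := swap_mul_self _ _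

@[simp] theorem simple_simple (i : Fin n) (p : Fin (n + 1)) : simple i (simple i p) = p :=
  swap_apply_self _ _ _

@[simp] theorem simple_inv (i : Fin n) : (simple i)⁻¹ = simple i := swap_inv _ _

theorem simple_lt_simple {i : Fin n} {p q : Fin (n + 1)} (h : p < q)
    (hne : ¬ (p = i.castSucc ∧ q = i.succ)) : simple i p < simple i q := by
  unfold simple
  simp only [swap_apply_def]
  simp only [Fin.ext_iff, Fin.lt_def, Fin.val_castSucc, Fin.val_succ] at h hne ⊢
  split_ifs <;> (try simp only [Fin.val_castSucc, Fin.val_succ]) <;> omega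

/-- Applying `simple i` to both positions of a pair injects the inversions of `x * simple i` into
those of `x`; the pair of positions exchanged by `simple i` is missed. -/
theorem len_mul_simple_lt {x : Perm (Fin (n + 1))} {i : Fin n} (h : x i.succ < x i.castSucc) :
    len (x * simple i) < len x := by
  classical
  simp only [len, Nat.card_eq_fintype_card, Fintype.card_subtype]
  have hsub : ((Finset.univ.filter fun p : Fin (n + 1) × Fin (n + 1) =>
      p.1 < p.2 ∧ (x * simple i) p.2 < (x * simple i) p.1).image
      fun p => (simple i p.1, simple i p.2)) ⊂
      Finset.univ.filter fun p : Fin (n + 1) × Fin (n + 1) => p.1 < p.2 ∧ x p.2 < x p.1 := by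
    rw [Finset.ssubset_iff_of_subset]
    · refine ⟨(i.castSucc, i.succ), by simp [h], ?_⟩
      simp only [Finset.mem_image, Finset.mem_filter, Finset.mem_univ, true_and, not_exists,
        not_and, Prod.mk.injEq, Prod.forall]
      rintro p q ⟨hpq, -⟩ h1 h2
      have e1 : p = i.succ := by rw [← simple_simple i p, h1, simple_castSucc]
      have e2 : q = i.castSucc := by rw [← simple_simple i q, h2, simple_succ]
      subst e1 e2
      exact absurd hpq (by simp [Fin.lt_def])
    · intro r hr
      simp only [Finset.mem_image, Finset.mem_filter, Finset.mem_univ, true_and,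
        Prod.exists] at hr
      obtain ⟨p, q, ⟨hpq, hx⟩, rfl⟩ := hr
      simp only [Finset.mem_filter, Finset.mem_univ, true_and]
      refine ⟨simple_lt_simple hpq ?_, hx⟩
      rintro ⟨rfl, rfl⟩
      simp only [Perm.mul_apply, simple_castSucc, simple_succ] at hx
      exact absurd hx h.not_gt
  have := Finset.card_lt_card hsub
  rwa [Finset.card_image_of_injective] at this
  rintro ⟨p, q⟩ ⟨p', q'⟩ h
  simpa using h

theorem simple_mem_parabolic {K : Finset (Fin n)} {i : Fin n} (h : i ∈ K) :
    simple i ∈ parabolic K := Subgroup.subset_closure ⟨i, h, rfl⟩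

theorem parabolic_mono {K K' : Finset (Fin n)} (h : K ⊆ K') : parabolic K ≤ parabolic K' :=
  Subgroup.closure_mono (Set.image_mono (by exact_mod_cast h))

/-- Only the generator with index `j` moves a position across the cut after `j`, so without it the
cut is preserved. -/
theorem le_castSucc_iff_of_mem_parabolic {K : Finset (Fin n)} {u : Perm (Fin (n + 1))}
    (hu : u ∈ parabolic K) {j : Fin n} (hj : j ∉ K) (p : Fin (n + 1)) :
    u p ≤ j.castSucc ↔ p ≤ j.castSucc := by
  unfold parabolic at hu
  induction hu using Subgroup.closure_induction generalizing p with
  | mem u hu =>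
    obtain ⟨i, hi, rfl⟩ := hu
    have : i ≠ j := by rintro rfl; exact hj hi
    unfold simple
    simp only [swap_apply_def]
    simp only [ne_eq, Fin.ext_iff, Fin.le_def, Fin.val_castSucc, Fin.val_succ] at this ⊢
    split_ifs <;> (try simp only [Fin.val_castSucc, Fin.val_succ]) <;> omega
  | one => simp
  | mul u v _ _ hu hv => rw [Perm.mul_apply, hu, hv]
  | inv u _ hu => rw [← hu (u⁻¹ p)]; simp

theorem lt_succ_iff_le_castSucc {p : Fin (n + 1)} {j : Fin n} : p < j.succ ↔ p ≤ j.castSucc := by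
  simp [Fin.lt_def, Fin.le_def]

/-- A reversed pair of positions in `W_K` lies in one connected component of `K`. -/
theorem mem_of_inversion {K : Finset (Fin n)} {u : Perm (Fin (n + 1))} (hu : u ∈ parabolic K)
    {p q : Fin (n + 1)} (hpq : u q < u p) (_h : p < q) {i : Fin n} (h1 : p ≤ i.castSucc)
    (h2 : i.succ ≤ q) : i ∈ K := by
  by_contra hi
  have h3 := (le_castSucc_iff_of_mem_parabolic hu hi p).2 h1
  have h4 := mt (le_castSucc_iff_of_mem_parabolic hu hi q).1
    (by rw [← lt_succ_iff_le_castSucc]; exact h2.not_gt)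
  order

theorem strictMonoOn_Icc {f : Fin (n + 1) → Fin (n + 1)} {a b : Fin (n + 1)}
    (h : ∀ i : Fin n, a ≤ i.castSucc → i.succ ≤ b → f i.castSucc < f i.succ) :
    StrictMonoOn f (Set.Icc a b) := by
  have key : ∀ q p : Fin (n + 1), a ≤ p → p < q → q ≤ b → f p < f q := by
    intro q
    induction q using Fin.induction with
    | zero => intro p _ h; exact absurd h (Fin.not_lt_zero p)
    | succ i ih =>
      intro p hp hpq hq
      have hle := lt_succ_iff_le_castSucc.1 hpq
      have hs := h i (hp.trans hle) hq
      rcases hle.lt_or_eq with hlt | rfl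
      · exact (ih p hp hlt ((Fin.castSucc_lt_succ (i := i)).le.trans hq)).trans hs
      · exact hs
  exact fun p hp q hq hpq => key q p hp.1 hpq hq.2

theorem strictAntiOn_Icc {f : Fin (n + 1) → Fin (n + 1)} {a b : Fin (n + 1)}
    (h : ∀ i : Fin n, a ≤ i.castSucc → i.succ ≤ b → f i.succ < f i.castSucc) :
    StrictAntiOn f (Set.Icc a b) := by
  have := strictMonoOn_Icc (f := fun p => Fin.rev (f p)) (a := a) (b := b)
    (fun i h1 h2 => Fin.rev_lt_rev.2 (h i h1 h2))
  exact fun p hp q hq hpq => Fin.rev_lt_rev.1 (this hp hq hpq)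

theorem eq_one_of_strictMono {u : Perm (Fin (n + 1))} (h : ∀ p q, p < q → u p < u q) : u = 1 := by
  have hm : StrictMono u := fun p q => h p q
  have := Subsingleton.elim (StrictMono.orderIsoOfSurjective u hm u.surjective) (OrderIso.refl _)
  ext p
  exact congrArg Fin.val (congrArg (fun f : Fin (n + 1) ≃o Fin (n + 1) => f p) this)

/-! ## The Demazure product with a longest element -/

theorem inv_mul_minRep_mem (K : Finset (Fin n)) (x : Perm (Fin (n + 1))) :
    x⁻¹ * minRep K x ∈ parabolic K := (exists_minRep K x).choose_spec.1

theorem longest_mem (K : Finset (Fin n)) : longest K ∈ parabolic K :=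
  (exists_longest K).choose_spec.1

theorem minRep_lt {K : Finset (Fin n)} (x : Perm (Fin (n + 1))) {i : Fin n} (hi : i ∈ K) :
    minRep K x i.castSucc < minRep K x i.succ := by
  by_contra h
  have h1 : minRep K x i.succ < minRep K x i.castSucc := by
    refine lt_of_le_of_ne (not_lt.1 h) fun h => ?_
    exact absurd ((minRep K x).injective h) (Fin.castSucc_lt_succ (i := i)).ne'
  have h2 := (exists_minRep K x).choose_spec.2 (minRep K x * simple i) (by
    rw [← mul_assoc]
    exact mul_mem (inv_mul_minRep_mem K x) (simple_mem_parabolic hi))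
  exact absurd (len_mul_simple_lt h1) (not_lt.2 h2)

theorem longest_gt {K : Finset (Fin n)} {i : Fin n} (hi : i ∈ K) :
    longest K i.succ < longest K i.castSucc := by
  by_contra h
  have h1 : longest K i.castSucc < longest K i.succ := by
    refine lt_of_le_of_ne (not_lt.1 h) fun h => ?_
    exact absurd ((longest K).injective h) (Fin.castSucc_lt_succ (i := i)).ne
  have h2 := (exists_longest K).choose_spec.2 (longest K * simple i)
    (mul_mem (longest_mem K) (simple_mem_parabolic hi))
  have h3 := len_mul_simple_lt (x := longest K * simple i) (i := i) (by simpa using h1)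
  rw [mul_assoc, simple_mul_self, mul_one] at h3
  exact absurd h3 (not_lt.2 h2)

/-- The Demazure product `x ⋆ w₀(K)`. -/
noncomputable def dem (x : Perm (Fin (n + 1))) (K : Finset (Fin n)) : Perm (Fin (n + 1)) :=
  minRep K x * longest K

theorem inv_mul_dem_mem (x : Perm (Fin (n + 1))) (K : Finset (Fin n)) :
    x⁻¹ * dem x K ∈ parabolic K := by
  rw [dem, ← mul_assoc]
  exact mul_mem (inv_mul_minRep_mem K x) (longest_mem K)

theorem strictMonoOn_minRep {K : Finset (Fin n)} (x : Perm (Fin (n + 1))) {a b : Fin (n + 1)}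
    (h : ∀ i : Fin n, a ≤ i.castSucc → i.succ ≤ b → i ∈ K) :
    StrictMonoOn (minRep K x) (Set.Icc a b) :=
  strictMonoOn_Icc fun i h1 h2 => minRep_lt x (h i h1 h2)

/-- The longest element reverses the pair, so both images lie in one component of `K`, where the
minimal representative is increasing. -/
theorem dem_gt (x : Perm (Fin (n + 1))) {K : Finset (Fin n)} {i : Fin n} (hi : i ∈ K) :
    dem x K i.succ < dem x K i.castSucc := by
  have h := longest_gt hi
  refine strictMonoOn_minRep x (a := longest K i.succ) (b := longest K i.castSucc)
    (fun j h1 h2 => ?_) ⟨le_rfl, h.le⟩ ⟨h.le, le_rfl⟩ h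
  refine mem_of_inversion (inv_mem (longest_mem K)) (p := longest K i.succ)
    (q := longest K i.castSucc) ?_ h h1 h2
  simp

/-- If the two representatives of the coset differed, their quotient would have an inversion. Its
positions, and likewise their images, lie in a single component of `K`; both permutations decrease
there, and this orders the same two values in two opposite ways. -/
theorem dem_unique {x y : Perm (Fin (n + 1))} {K : Finset (Fin n)} (h : x⁻¹ * y ∈ parabolic K)
    (hy : ∀ i ∈ K, y i.succ < y i.castSucc) : y = dem x K := by
  set z := dem x K with hz
  have hu : z⁻¹ * y ∈ parabolic K := by
    have := mul_mem (inv_mem (inv_mul_dem_mem x K)) h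
    simpa [mul_assoc] using this
  suffices z⁻¹ * y = 1 by rw [inv_mul_eq_one] at this; exact this.symm
  refine eq_one_of_strictMono fun p q hpq => ?_
  have hne : (z⁻¹ * y) p ≠ (z⁻¹ * y) q := fun h => hpq.ne ((z⁻¹ * y).injective h)
  by_contra hlt
  have hlt : (z⁻¹ * y) q < (z⁻¹ * y) p := lt_of_le_of_ne (not_lt.1 hlt) hne.symm
  have h1 : StrictAntiOn y (Set.Icc p q) := strictAntiOn_Icc fun i h1 h2 =>
    hy i (mem_of_inversion hu hlt hpq h1 h2)
  have h2 : StrictAntiOn z (Set.Icc ((z⁻¹ * y) q) ((z⁻¹ * y) p)) :=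
    strictAntiOn_Icc fun i h1 h2 => dem_gt x
      (mem_of_inversion (inv_mem hu) (by simpa using hpq) hlt h1 h2)
  have h3 := h1 ⟨le_rfl, hpq.le⟩ ⟨hpq.le, le_rfl⟩ hpq
  have h4 := h2 ⟨le_rfl, hlt.le⟩ ⟨hlt.le, le_rfl⟩ hlt
  simp only [Perm.mul_apply, Perm.inv_def, apply_symm_apply] at h4
  order

/-! ## Sorting the positions of an interval -/

/-- The positions of an interval. -/
abbrev block (e : PosInterval n) : Set (Fin (n + 1)) := Set.Icc e.1.1 e.1.2

/-- The simple reflections inside an interval. -/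
def reflections (e : PosInterval n) : Finset (Fin n) :=
  Finset.univ.filter fun i => e.1.1 ≤ i.castSucc ∧ i.succ ≤ e.1.2

@[simp] theorem mem_reflections {e : PosInterval n} {i : Fin n} :
    i ∈ reflections e ↔ e.1.1 ≤ i.castSucc ∧ i.succ ≤ e.1.2 := by simp [reflections]

/-- `x ⋆ w₀(e)`: sorts the values at the positions of `e` in decreasing order. -/
noncomputable def srt (x : Perm (Fin (n + 1))) (e : PosInterval n) : Perm (Fin (n + 1)) :=
  dem x (reflections e)

theorem apply_eq_of_mem_parabolic_reflections {e : PosInterval n} {u : Perm (Fin (n + 1))}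
    (hu : u ∈ parabolic (reflections e)) {p : Fin (n + 1)} (hp : p ∉ block e) : u p = p := by
  unfold parabolic at hu
  induction hu using Subgroup.closure_induction with
  | mem u hu =>
    obtain ⟨i, hi, rfl⟩ := hu
    simp only [Finset.mem_coe, mem_reflections] at hi
    have hlt := Fin.castSucc_lt_succ (i := i)
    refine simple_of_ne ?_ ?_ <;> rintro rfl <;> refine hp ⟨?_, ?_⟩ <;> order
  | one => simp
  | mul u v _ _ hu hv => rw [Perm.mul_apply, hv, hu]
  | inv u _ hu => rw [Perm.inv_eq_iff_eq, hu]

theorem srt_of_notMem (x : Perm (Fin (n + 1))) {e : PosInterval n} {p : Fin (n + 1)}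
    (hp : p ∉ block e) : srt x e p = x p := by
  have := apply_eq_of_mem_parabolic_reflections (inv_mul_dem_mem x (reflections e)) hp
  rw [Perm.mul_apply, Perm.inv_eq_iff_eq] at this
  exact this

theorem srt_anti (x : Perm (Fin (n + 1))) (e : PosInterval n) :
    StrictAntiOn (srt x e) (block e) :=
  strictAntiOn_Icc fun _ h1 h2 => dem_gt x (mem_reflections.2 ⟨h1, h2⟩)

theorem mem_block_of_fixed {e : PosInterval n} {u : Perm (Fin (n + 1))}
    (hu : ∀ p, p ∉ block e → u p = p) {p : Fin (n + 1)} : u p ∈ block e ↔ p ∈ block e := by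
  constructor
  · intro h
    by_contra hp
    rw [hu p hp] at h
    exact hp h
  · intro h
    by_contra hp
    exact hp (by rwa [u.injective (hu _ hp)])

theorem eq_one_of_strictMonoOn {e : PosInterval n} {u : Perm (Fin (n + 1))}
    (hu : ∀ p, p ∉ block e → u p = p) (h : StrictMonoOn u (block e)) : u = 1 := by
  have hm : ∀ p, u p ∈ block e ↔ p ∈ block e := fun p => mem_block_of_fixed hu
  refine eq_one_of_strictMono fun p q hpq => ?_
  by_cases hp : p ∈ block e <;> by_cases hq : q ∈ block e
  · exact h hp hq hpq
  · rw [hu q hq]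
    have := (hm p).2 hp
    simp only [Set.mem_Icc, not_and, not_le] at hp hq this
    have := hq (by order)
    order
  · rw [hu p hp]
    have := (hm q).2 hq
    simp only [Set.mem_Icc, not_and, not_le] at hp hq this
    by_contra hc
    have := hp (by order)
    order
  · rw [hu p hp, hu q hq]; exact hpq

/-- Characterizes sorting by the values outside the block and the order inside it; cosets and
lengths are no longer needed once this is available. -/
theorem srt_unique {x y : Perm (Fin (n + 1))} {e : PosInterval n}
    (h : ∀ p, p ∉ block e → y p = x p) (hy : StrictAntiOn y (block e)) : y = srt x e := by
  set z := srt x e with hz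
  have hu : ∀ p, p ∉ block e → (z⁻¹ * y) p = p := fun p hp => by
    rw [Perm.mul_apply, Perm.inv_eq_iff_eq, h p hp, hz, srt_of_notMem x hp]
  have hm : ∀ p, (z⁻¹ * y) p ∈ block e ↔ p ∈ block e := fun p => mem_block_of_fixed hu
  suffices z⁻¹ * y = 1 by rw [inv_mul_eq_one] at this; exact this.symm
  refine eq_one_of_strictMonoOn hu fun p hp q hq hpq => ?_
  rw [← (srt_anti x e).lt_iff_gt ((hm q).2 hq) ((hm p).2 hp), ← hz]
  simpa using hy hp hq hpq

theorem srt_eq_mul (x : Perm (Fin (n + 1))) (e : PosInterval n) :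
    ∃ u : Perm (Fin (n + 1)), srt x e = x * u ∧ ∀ p, p ∉ block e → u p = p :=
  ⟨x⁻¹ * srt x e, by simp, fun p hp => by simp [srt_of_notMem x hp]⟩

theorem srt_inv_mem_iff (x : Perm (Fin (n + 1))) (e : PosInterval n) (v : Fin (n + 1)) :
    (srt x e)⁻¹ v ∈ block e ↔ x⁻¹ v ∈ block e := by
  obtain ⟨u, hu, hf⟩ := srt_eq_mul x e
  rw [← mem_block_of_fixed hf (p := (srt x e)⁻¹ v), hu]
  simp

theorem srt_inv_of_notMem (x : Perm (Fin (n + 1))) {e : PosInterval n} {v : Fin (n + 1)}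
    (h : x⁻¹ v ∉ block e) : (srt x e)⁻¹ v = x⁻¹ v := by
  rw [Perm.inv_eq_iff_eq, srt_of_notMem x h]; simp

theorem apply_inv_apply (x : Perm (Fin (n + 1))) (p : Fin (n + 1)) : x (x⁻¹ p) = p :=
  x.apply_symm_apply p

theorem inv_apply_apply (x : Perm (Fin (n + 1))) (p : Fin (n + 1)) : x⁻¹ (x p) = p :=
  x.symm_apply_apply p

/-! ## Order of values under sorting -/

theorem lt_of_mem_block_of_notMem {e : PosInterval n} {p p' q : Fin (n + 1)} (hp : p ∈ block e)
    (hp' : p' ∈ block e) (hq : q ∉ block e) : p < q ↔ p' < q := by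
  simp only [Set.mem_Icc, not_and, not_le] at hp hp' hq
  constructor <;> intro h <;> exact lt_of_le_of_lt (by first | exact hp.2 | exact hp'.2)
    (hq (by order))

theorem lt_of_notMem_of_mem_block {e : PosInterval n} {p p' q : Fin (n + 1)} (hp : p ∈ block e)
    (hp' : p' ∈ block e) (hq : q ∉ block e) : q < p ↔ q < p' := by
  have h := lt_of_mem_block_of_notMem hp hp' hq
  have h1 : q ≠ p := by rintro rfl; exact hq hp
  have h2 : q ≠ p' := by rintro rfl; exact hq hp'
  constructor <;> intro h3 <;> by_contra hc
  · exact h3.asymm (h.2 (lt_of_le_of_ne (not_lt.1 hc) h2.symm))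
  · exact h3.asymm (h.1 (lt_of_le_of_ne (not_lt.1 hc) h1.symm))

/-- Values outside the block do not move, and values inside stay inside, hence on the same side of
every outside position. Only two values that both lie in the block can change their order. -/
theorem srt_inv_lt_iff (x : Perm (Fin (n + 1))) {e : PosInterval n} {u v : Fin (n + 1)}
    (h : ¬ (x⁻¹ u ∈ block e ∧ x⁻¹ v ∈ block e)) :
    (srt x e)⁻¹ u < (srt x e)⁻¹ v ↔ x⁻¹ u < x⁻¹ v := by
  by_cases hu : x⁻¹ u ∈ block e
  · have hv : x⁻¹ v ∉ block e := fun hv => h ⟨hu, hv⟩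
    rw [srt_inv_of_notMem x hv]
    exact lt_of_mem_block_of_notMem ((srt_inv_mem_iff x e u).2 hu) hu hv
  · rw [srt_inv_of_notMem x hu]
    by_cases hv : x⁻¹ v ∈ block e
    · exact lt_of_notMem_of_mem_block ((srt_inv_mem_iff x e v).2 hv) hv hu
    · rw [srt_inv_of_notMem x hv]

theorem srt_inv_lt_of_mem (x : Perm (Fin (n + 1))) {e : PosInterval n} {u v : Fin (n + 1)}
    (hu : x⁻¹ u ∈ block e) (hv : x⁻¹ v ∈ block e) (huv : u < v) :
    (srt x e)⁻¹ v < (srt x e)⁻¹ u := by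
  rw [← (srt_anti x e).lt_iff_gt ((srt_inv_mem_iff x e u).2 hu) ((srt_inv_mem_iff x e v).2 hv),
    apply_inv_apply, apply_inv_apply]
  exact huv

/-- Sorting preserves inversions of values. -/
theorem srt_inv_lt_of_lt (x : Perm (Fin (n + 1))) (e : PosInterval n) {u v : Fin (n + 1)}
    (huv : u < v) (h : x⁻¹ v < x⁻¹ u) : (srt x e)⁻¹ v < (srt x e)⁻¹ u := by
  by_cases hm : x⁻¹ u ∈ block e ∧ x⁻¹ v ∈ block e
  · exact srt_inv_lt_of_mem x hm.1 hm.2 huv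
  · exact (srt_inv_lt_iff x (fun h => hm h.symm)).2 h

/-! ## Left and right sorting commute -/

/-- The Demazure product `x ⋆ sᵢ`. -/
def srtSimple (x : Perm (Fin (n + 1))) (i : Fin n) : Perm (Fin (n + 1)) :=
  if x i.castSucc < x i.succ then x * simple i else x

theorem foldl_srtSimple_of_notMem {e : PosInterval n} {p : Fin (n + 1)} (hp : p ∉ block e)
    (l : List (Fin n)) (hl : ∀ i ∈ l, i ∈ reflections e) (x : Perm (Fin (n + 1))) :
    l.foldl srtSimple x p = x p := by
  induction l generalizing x with
  | nil => rfl
  | cons i l ih =>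
    rw [List.foldl_cons, ih (fun j hj => hl j (List.mem_cons_of_mem _ hj))]
    unfold srtSimple
    split_ifs
    · rw [Perm.mul_apply, apply_eq_of_mem_parabolic_reflections
        (simple_mem_parabolic (hl i List.mem_cons_self)) hp]
    · rfl

/-- Among the permutations reachable by simple sorting steps inside the block, one of maximal length
has no ascent left in the block. -/
theorem exists_foldl_srtSimple_eq_srt (x : Perm (Fin (n + 1))) (e : PosInterval n) :
    ∃ l : List (Fin n), (∀ i ∈ l, i ∈ reflections e) ∧ l.foldl srtSimple x = srt x e := by
  have : Nonempty {y : Perm (Fin (n + 1)) // ∃ l : List (Fin n), (∀ i ∈ l, i ∈ reflections e) ∧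
      l.foldl srtSimple x = y} := ⟨⟨x, [], by simp, rfl⟩⟩
  obtain ⟨⟨y, l, hl, hy⟩, hmax⟩ := Finite.exists_max
    (fun z : {y : Perm (Fin (n + 1)) // ∃ l : List (Fin n), (∀ i ∈ l, i ∈ reflections e) ∧
      l.foldl srtSimple x = y} => len z.1)
  refine ⟨l, hl, ?_⟩
  refine srt_unique (fun p hp => foldl_srtSimple_of_notMem hp l hl x)
    (strictAntiOn_Icc fun i h1 h2 => ?_)
  rw [hy]
  by_contra hc
  have hlt : y i.castSucc < y i.succ := lt_of_le_of_ne (not_lt.1 hc)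
    fun h => (Fin.castSucc_lt_succ (i := i)).ne (y.injective h)
  have h3 := hmax ⟨y * simple i, l ++ [i], fun j hj => by
    rcases List.mem_append.1 hj with hj | hj
    · exact hl j hj
    · rw [List.mem_singleton.1 hj]; exact mem_reflections.2 ⟨h1, h2⟩, by
    rw [List.foldl_append, hy, List.foldl_cons, List.foldl_nil, srtSimple, if_pos hlt]⟩
  have h4 := len_mul_simple_lt (x := y * simple i) (i := i) (by simpa using hlt)
  rw [mul_assoc, simple_mul_self, mul_one] at h4
  exact absurd h4 (not_lt.2 h3)

/-- The Demazure product `sⱼ ⋆ x`. -/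
def lsrtSimple (j : Fin n) (x : Perm (Fin (n + 1))) : Perm (Fin (n + 1)) := (srtSimple x⁻¹ j)⁻¹

theorem lsrtSimple_eq (j : Fin n) (x : Perm (Fin (n + 1))) : lsrtSimple j x =
    if x⁻¹ j.castSucc < x⁻¹ j.succ then simple j * x else x := by
  unfold lsrtSimple srtSimple
  split_ifs <;> simp

theorem lsrtSimple_lt (j : Fin n) {x : Perm (Fin (n + 1))} {p q : Fin (n + 1)} (hpq : p < q)
    (h : x q < x p) : lsrtSimple j x q < lsrtSimple j x p := by
  rw [lsrtSimple_eq]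
  split_ifs with hj
  · refine simple_lt_simple h ?_
    rintro ⟨h1, h2⟩
    rw [← h1, ← h2, inv_apply_apply, inv_apply_apply] at hj
    exact hj.asymm hpq
  · exact h

theorem srtSimple_lsrtSimple {x : Perm (Fin (n + 1))} {i j : Fin n}
    (h : ¬ (x i.castSucc = j.castSucc ∧ x i.succ = j.succ)) :
    srtSimple (lsrtSimple j x) i =
      lsrtSimple j x * if x i.castSucc < x i.succ then simple i else 1 := by
  have hi := Fin.castSucc_lt_succ (i := i)
  split_ifs with hx
  · rw [srtSimple, if_pos]
    rw [lsrtSimple_eq]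
    split_ifs with hj
    · exact simple_lt_simple hx h
    · exact hx
  · rw [srtSimple, if_neg, mul_one]
    exact (lsrtSimple_lt j hi (lt_of_le_of_ne (not_lt.1 hx)
      fun h => hi.ne' (x.injective h))).not_gt

/-- The two steps interfere only if `x` maps the pair of positions of `i`, in order, onto the pair
of values of `j`. Then `x * simple i` equals `simple j * x`, and the other step has no effect
afterwards. In all other cases neither step changes the condition under which the other one acts. -/
theorem lsrtSimple_srtSimple (x : Perm (Fin (n + 1))) (i j : Fin n) :
    lsrtSimple j (srtSimple x i) = srtSimple (lsrtSimple j x) i := by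
  have hi := Fin.castSucc_lt_succ (i := i)
  have hj := Fin.castSucc_lt_succ (i := j)
  by_cases h : x i.castSucc = j.castSucc ∧ x i.succ = j.succ
  · have h1 : x⁻¹ j.castSucc = i.castSucc := by rw [← h.1, inv_apply_apply]
    have h2 : x⁻¹ j.succ = i.succ := by rw [← h.2, inv_apply_apply]
    have e1 : srtSimple x i = x * simple i := by
      rw [srtSimple, if_pos (by rw [h.1, h.2]; exact hj)]
    have e2 : lsrtSimple j x = simple j * x := by
      rw [lsrtSimple_eq, if_pos (by rw [h1, h2]; exact hi)]
    rw [e1, e2, srtSimple, lsrtSimple_eq, if_neg, if_neg]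
    · rw [simple, simple, ← h.1, ← h.2, mul_swap_eq_swap_mul]
    · simp only [Perm.mul_apply, h.1, h.2, simple_castSucc, simple_succ]
      exact hj.not_gt
    · simp only [mul_inv_rev, Perm.mul_apply, h1, h2, simple_inv, simple_castSucc, simple_succ]
      exact hi.not_gt
  · have h' : ¬ (x⁻¹ j.castSucc = i.castSucc ∧ x⁻¹ j.succ = i.succ) := fun h' =>
      h ⟨by rw [← h'.1, apply_inv_apply], by rw [← h'.2, apply_inv_apply]⟩
    have e1 := srtSimple_lsrtSimple h
    have e2 := srtSimple_lsrtSimple h'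
    have e3 : lsrtSimple j (srtSimple x i) = (srtSimple (lsrtSimple i x⁻¹) j)⁻¹ := by
      rw [lsrtSimple, lsrtSimple, inv_inv]
    rw [e1, e3, e2, lsrtSimple_eq, lsrtSimple_eq, inv_inv]
    split_ifs <;> simp [mul_assoc]

theorem lsrtSimple_foldl (j : Fin n) (l : List (Fin n)) (x : Perm (Fin (n + 1))) :
    lsrtSimple j (l.foldl srtSimple x) = l.foldl srtSimple (lsrtSimple j x) := by
  induction l generalizing x with
  | nil => rfl
  | cons i l ih => rw [List.foldl_cons, ih, lsrtSimple_srtSimple, List.foldl_cons]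

theorem lsrtSimple_srt (j : Fin n) (x : Perm (Fin (n + 1))) (e : PosInterval n) :
    lsrtSimple j (srt x e) = srt (lsrtSimple j x) e := by
  obtain ⟨l, hl, h⟩ := exists_foldl_srtSimple_eq_srt x e
  refine srt_unique (fun p hp => ?_)
    (fun p hp q hq hpq => lsrtSimple_lt j hpq (srt_anti x e hp hq hpq))
  rw [← h, lsrtSimple_foldl, foldl_srtSimple_of_notMem hp l hl]

/-- The Demazure product `w₀(e) ⋆ x`. -/
noncomputable def lsrt (e : PosInterval n) (x : Perm (Fin (n + 1))) : Perm (Fin (n + 1)) :=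
  (srt x⁻¹ e)⁻¹

/-- Left sorting is a composite of simple left steps, each of which commutes with right sorting.
This settles the positions outside `f` for the inverses; inside `f`, right sorting keeps the
inversions made by left sorting. -/
theorem lsrt_srt (f : PosInterval n) (x : Perm (Fin (n + 1))) (e : PosInterval n) :
    lsrt f (srt x e) = srt (lsrt f x) e := by
  obtain ⟨l, hl, h⟩ := exists_foldl_srtSimple_eq_srt x⁻¹ f
  have key : ∀ (l : List (Fin n)) (y : Perm (Fin (n + 1))),
      l.foldl srtSimple (srt y⁻¹ e)⁻¹ = (srt (l.foldl srtSimple y)⁻¹ e)⁻¹ := by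
    intro l
    induction l with
    | nil => intro y; rfl
    | cons i l ih =>
      intro y
      rw [List.foldl_cons, List.foldl_cons, ← ih]
      congr 1
      have := lsrtSimple_srt i y⁻¹ e
      rw [lsrtSimple, lsrtSimple, inv_inv] at this
      rw [← this, inv_inv]
  have h1 := key l x⁻¹
  rw [inv_inv, h] at h1
  rw [eq_comm, ← inv_inj]
  refine (srt_unique (fun p hp => ?_) fun u hu v hv huv => ?_).trans (inv_inv _).symm
  · rw [lsrt, ← h1, foldl_srtSimple_of_notMem hp l hl]
  · refine srt_inv_lt_of_lt _ e huv ?_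
    rw [lsrt, inv_inv]
    exact srt_anti _ _ hu hv huv

/-! ## Words of intervals -/

/-- The Demazure product of the longest elements of a word of intervals. -/
noncomputable def wd (I : List (PosInterval n)) : Perm (Fin (n + 1)) := I.foldl srt 1

@[simp] theorem wd_nil : wd ([] : List (PosInterval n)) = 1 := rfl

theorem wd_append (A B : List (PosInterval n)) : wd (A ++ B) = B.foldl srt (wd A) := by
  rw [wd, List.foldl_append]; rfl

theorem wd_snoc (A : List (PosInterval n)) (e : PosInterval n) :
    wd (A ++ [e]) = srt (wd A) e := by
  rw [wd_append]; rfl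

theorem srt_one_inv (e : PosInterval n) : (srt 1 e)⁻¹ = srt 1 e := by
  refine srt_unique (fun p hp => ?_) fun u hu v hv huv => ?_
  · rw [Perm.one_apply, Perm.inv_eq_iff_eq, srt_of_notMem 1 hp]; rfl
  · exact srt_inv_lt_of_mem 1 (by simpa using hu) (by simpa using hv) huv

theorem wd_cons (e : PosInterval n) (I : List (PosInterval n)) :
    wd (e :: I) = lsrt e (wd I) := by
  induction I using List.reverseRecOn with
  | nil => rw [lsrt, wd_nil, inv_one, srt_one_inv]; rfl
  | append_singleton I f ih =>
    rw [← List.cons_append, wd_snoc, ih, wd_snoc, lsrt_srt]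

theorem wd_reverse (I : List (PosInterval n)) : wd I.reverse = (wd I)⁻¹ := by
  induction I with
  | nil => simp
  | cons e I ih => rw [List.reverse_cons, wd_snoc, ih, wd_cons, lsrt, inv_inv]

theorem lsrt_lt (e : PosInterval n) {x : Perm (Fin (n + 1))} {p q : Fin (n + 1)} (hpq : p < q)
    (h : x q < x p) : lsrt e x q < lsrt e x p :=
  srt_inv_lt_of_lt x⁻¹ e hpq (by rwa [inv_inv])

/-- Inversions of the product of a suffix are inversions of the product of the word. -/
theorem wd_append_lt (A B : List (PosInterval n)) {p q : Fin (n + 1)} (hpq : p < q)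
    (h : wd B q < wd B p) : wd (A ++ B) q < wd (A ++ B) p := by
  induction A with
  | nil => exact h
  | cons e A ih => rw [List.cons_append, wd_cons]; exact lsrt_lt e hpq ih

theorem lt_of_wd_append_lt (A B : List (PosInterval n)) {p q : Fin (n + 1)} (hpq : p < q)
    (h : wd (A ++ B) p < wd (A ++ B) q) : wd B p < wd B q := by
  by_contra hc
  have := wd_append_lt A B hpq (lt_of_le_of_ne (not_lt.1 hc) fun h => hpq.ne' ((wd B).injective h))
  exact h.asymm this

/-- In `w₀(D) ⋆ y` the values in `D` appear in decreasing order, at the positions where `y` has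
values in `D`. -/
theorem wd_cons_mem_iff (D : PosInterval n) (B : List (PosInterval n)) (p : Fin (n + 1)) :
    wd (D :: B) p ∈ block D ↔ wd B p ∈ block D := by
  have := srt_inv_mem_iff (wd B)⁻¹ D p
  rwa [inv_inv, ← lsrt, ← wd_cons] at this

theorem wd_cons_of_notMem {D : PosInterval n} {B : List (PosInterval n)} {p : Fin (n + 1)}
    (h : wd B p ∉ block D) : wd (D :: B) p = wd B p := by
  have := srt_inv_of_notMem (wd B)⁻¹ (e := D) (v := p) (by rwa [inv_inv])
  rwa [inv_inv, ← lsrt, ← wd_cons] at this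

theorem wd_cons_lt {D : PosInterval n} {B : List (PosInterval n)} {p q : Fin (n + 1)}
    (hp : wd (D :: B) p ∈ block D) (hq : wd (D :: B) q ∈ block D) (hpq : p < q) :
    wd (D :: B) q < wd (D :: B) p := by
  rw [wd_cons_mem_iff] at hp hq
  have := srt_inv_lt_of_mem (wd B)⁻¹ (e := D) (u := p) (v := q) (by rwa [inv_inv])
    (by rwa [inv_inv]) hpq
  rwa [← lsrt, ← wd_cons] at this

/-! ## Splitting lists -/

theorem append_eq_append_cons {α : Type*} {A B C D : List α} {c : α} (h : A ++ B = C ++ c :: D) :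
    (∃ X, A = C ++ c :: X ∧ D = X ++ B) ∨ ∃ X, C = A ++ X ∧ B = X ++ c :: D := by
  rcases List.append_eq_append_iff.1 h with ⟨X, h1, h2⟩ | ⟨X, h1, h2⟩
  · exact Or.inr ⟨X, h1, h2⟩
  · cases X with
    | nil => exact Or.inr ⟨[], by simpa using h1.symm, by simpa using h2.symm⟩
    | cons d X =>
      simp only [List.cons_append, List.cons.injEq] at h2
      obtain ⟨rfl, rfl⟩ := h2
      exact Or.inl ⟨X, h1, rfl⟩

theorem append_cons_eq_append_cons {α : Type*} {A B C D : List α} {a c : α}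
    (h : A ++ a :: B = C ++ c :: D) :
    (∃ X, A = C ++ c :: X ∧ D = X ++ a :: B) ∨ (A = C ∧ a = c ∧ B = D) ∨
      ∃ X, C = A ++ a :: X ∧ B = X ++ c :: D := by
  rcases append_eq_append_cons h with h | ⟨X, rfl, h2⟩
  · exact Or.inl h
  · cases X with
    | nil =>
      simp only [List.nil_append, List.cons.injEq] at h2
      exact Or.inr (Or.inl ⟨by simp, h2⟩)
    | cons d X =>
      simp only [List.cons_append, List.cons.injEq] at h2
      obtain ⟨rfl, rfl⟩ := h2
      exact Or.inr (Or.inr ⟨X, rfl, rfl⟩)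

theorem exists_last {α : Type*} {P : α → Prop} {I : List α} (h : ∃ F ∈ I, P F) :
    ∃ A D B, I = A ++ D :: B ∧ P D ∧ ∀ F ∈ B, ¬ P F := by
  induction I with
  | nil => simp at h
  | cons F I ih =>
    by_cases hI : ∃ G ∈ I, P G
    · obtain ⟨A, D, B, rfl, h1, h2⟩ := ih hI
      exact ⟨F :: A, D, B, rfl, h1, h2⟩
    · push Not at hI
      obtain ⟨G, hG, hP⟩ := h
      rcases List.mem_cons.1 hG with rfl | hG
      · exact ⟨[], G, I, rfl, hP, hI⟩
      · exact absurd hP (hI G hG)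

/-! ## Monotone and reduced words -/

/-- Every letter is a monotone interval of the product of the prefix ending with it. -/
def RMono (I : List (PosInterval n)) : Prop :=
  ∀ A e B, I = A ++ e :: B → IsMonotoneInterval (wd (A ++ [e])) e

/-- Every letter is a monotone interval of the inverse product of the suffix starting with it. -/
def LMono (I : List (PosInterval n)) : Prop :=
  ∀ A e B, I = A ++ e :: B → IsMonotoneInterval (wd (e :: B))⁻¹ e

/-- There is no right-contraction. -/
def RReduced (I : List (PosInterval n)) : Prop :=
  ∀ A e B, I = A ++ e :: B → ¬ IsDescentInterval (wd A) e

/-- There is no left-contraction. -/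
def LReduced (I : List (PosInterval n)) : Prop :=
  ∀ A e B, I = A ++ e :: B → ¬ IsDescentInterval (wd B)⁻¹ e

theorem reverse_eq_append_cons {α : Type*} {I A B : List α} {e : α} :
    I.reverse = A ++ e :: B ↔ I = B.reverse ++ e :: A.reverse := by
  rw [List.reverse_eq_iff]; simp

theorem RMono_reverse {I : List (PosInterval n)} : RMono I.reverse ↔ LMono I := by
  constructor
  · intro h A e B hI
    have := h B.reverse e A.reverse (by simp [hI])
    rwa [← wd_reverse, List.reverse_cons]
  · intro h A e B hI
    have := h B.reverse e A.reverse (reverse_eq_append_cons.1 hI)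
    rwa [← wd_reverse, List.reverse_cons, List.reverse_reverse] at this

theorem RReduced_reverse {I : List (PosInterval n)} : RReduced I.reverse ↔ LReduced I := by
  constructor
  · intro h A e B hI
    have := h B.reverse e A.reverse (by simp [hI])
    rwa [← wd_reverse]
  · intro h A e B hI
    have := h B.reverse e A.reverse (reverse_eq_append_cons.1 hI)
    rwa [← wd_reverse, List.reverse_reverse] at this

/-- Minimal monotone words. -/
structure Good (I : List (PosInterval n)) : Prop where
  rmono : RMono I
  lmono : LMono I
  rreduced : RReduced I
  lreduced : LReduced I

theorem Good.reverse {I : List (PosInterval n)} (h : Good I) : Good I.reverse where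
  rmono := RMono_reverse.2 h.lmono
  lmono := RMono_reverse.1 (by rw [List.reverse_reverse]; exact h.rmono)
  rreduced := RReduced_reverse.2 h.lreduced
  lreduced := RReduced_reverse.1 (by rw [List.reverse_reverse]; exact h.rreduced)

theorem RMono.of_append {A B : List (PosInterval n)} (h : RMono (A ++ B)) : RMono A :=
  fun A' e B' hA => h A' e (B' ++ B) (by simp [hA])

theorem RReduced.of_append {A B : List (PosInterval n)} (h : RReduced (A ++ B)) : RReduced A :=
  fun A' e B' hA => h A' e (B' ++ B) (by simp [hA])

/-! ## Sorting away from an interval -/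

/-- Each letter lies entirely to one side of `[a, b]`, so the two sides are permuted separately and
`[a, b]` is fixed pointwise. Values and directedness at `[a, b]` are therefore unaffected. -/
theorem exists_foldl_srt_eq_mul {a b : Fin (n + 1)} (hab : a ≤ b) {B : List (PosInterval n)}
    (hB : ∀ F ∈ B, F.1.2 < a ∨ b < F.1.1) (x : Perm (Fin (n + 1))) :
    ∃ u : Perm (Fin (n + 1)), B.foldl srt x = x * u ∧ (∀ r, u r < a ↔ r < a) ∧
      (∀ r, b < u r ↔ b < r) ∧ ∀ r, a ≤ r → r ≤ b → u r = r := by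
  induction B generalizing x with
  | nil => exact ⟨1, by simp, by simp, by simp, by simp⟩
  | cons F B ih =>
    obtain ⟨v, hv, h1, h2, h3⟩ := ih (fun G hG => hB G (List.mem_cons_of_mem _ hG)) (srt x F)
    obtain ⟨u, hu, hf⟩ := srt_eq_mul x F
    have hm : ∀ p, u p ∈ block F ↔ p ∈ block F := fun p => mem_block_of_fixed hf
    have hF := hB F List.mem_cons_self
    have key : ∀ r, (u r < a ↔ r < a) ∧ (b < u r ↔ b < r) ∧ (a ≤ r → r ≤ b → u r = r) := by
      intro r
      by_cases hr : r ∈ block F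
      · have hr' := (hm r).2 hr
        simp only [Set.mem_Icc] at hr hr'
        obtain ⟨h1, h2⟩ := hr
        obtain ⟨h3, h4⟩ := hr'
        rcases hF with hF | hF
        · exact ⟨⟨fun _ => by order, fun _ => by order⟩, ⟨fun _ => by order, fun _ => by order⟩,
            fun _ _ => by order⟩
        · exact ⟨⟨fun _ => by order, fun _ => by order⟩, ⟨fun _ => by order, fun _ => by order⟩,
            fun _ _ => by order⟩
      · rw [hf r hr]; simp
    refine ⟨u * v, by rw [List.foldl_cons, hv, hu, mul_assoc], fun r => ?_, fun r => ?_,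
      fun r hr hr' => ?_⟩
    · rw [Perm.mul_apply, (key _).1, h1]
    · rw [Perm.mul_apply, (key _).2.1, h2]
    · rw [Perm.mul_apply, h3 r hr hr', (key r).2.2 hr hr']

section

variable {x u : Perm (Fin (n + 1))} {e : PosInterval n} {p : Fin (n + 1)}

theorem leftDirected_mul_iff' (h1 : ∀ r, u r < e.1.1 ↔ r < e.1.1) :
    LeftDirected (x * u) e p ↔ LeftDirected x e (u p) := by
  simp only [LeftDirected, Perm.mul_apply]
  refine ⟨fun h q hq => ?_, fun h q hq => h _ ((h1 q).2 hq)⟩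
  have := h (u⁻¹ q) ((h1 _).1 (by rwa [apply_inv_apply]))
  rwa [apply_inv_apply] at this

theorem rightDirected_mul_iff' (h1 : ∀ r, e.1.2 < u r ↔ e.1.2 < r) :
    RightDirected (x * u) e p ↔ RightDirected x e (u p) := by
  simp only [RightDirected, Perm.mul_apply]
  refine ⟨fun h q hq => ?_, fun h q hq => h _ ((h1 q).2 hq)⟩
  have := h (u⁻¹ q) ((h1 _).1 (by rwa [apply_inv_apply]))
  rwa [apply_inv_apply] at this

theorem leftDirected_mul_iff (h1 : ∀ r, u r < e.1.1 ↔ r < e.1.1) (h3 : u p = p) :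
    LeftDirected (x * u) e p ↔ LeftDirected x e p := by
  rw [leftDirected_mul_iff' h1, h3]

theorem rightDirected_mul_iff (h1 : ∀ r, e.1.2 < u r ↔ e.1.2 < r) (h3 : u p = p) :
    RightDirected (x * u) e p ↔ RightDirected x e p := by
  rw [rightDirected_mul_iff' h1, h3]

end

theorem left_mem_block (e : PosInterval n) : e.1.1 ∈ block e := ⟨le_rfl, e.2.le⟩

theorem right_mem_block (e : PosInterval n) : e.1.2 ∈ block e := ⟨e.2.le, le_rfl⟩

section

variable {e : PosInterval n} {B : List (PosInterval n)}

theorem foldl_srt_apply (hB : ∀ F ∈ B, Separated F e)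
    (x : Perm (Fin (n + 1))) {p : Fin (n + 1)} (hp : p ∈ block e) : B.foldl srt x p = x p := by
  obtain ⟨u, hu, -, -, h3⟩ := exists_foldl_srt_eq_mul e.2.le hB x
  rw [hu, Perm.mul_apply, h3 p hp.1 hp.2]

theorem leftDirected_foldl_srt (hB : ∀ F ∈ B, Separated F e)
    (x : Perm (Fin (n + 1))) {p : Fin (n + 1)} (hp : p ∈ block e) :
    LeftDirected (B.foldl srt x) e p ↔ LeftDirected x e p := by
  obtain ⟨u, hu, h1, -, h3⟩ := exists_foldl_srt_eq_mul e.2.le hB x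
  rw [hu, leftDirected_mul_iff h1 (h3 p hp.1 hp.2)]

theorem rightDirected_foldl_srt (hB : ∀ F ∈ B, Separated F e)
    (x : Perm (Fin (n + 1))) {p : Fin (n + 1)} (hp : p ∈ block e) :
    RightDirected (B.foldl srt x) e p ↔ RightDirected x e p := by
  obtain ⟨u, hu, -, h2, h3⟩ := exists_foldl_srt_eq_mul e.2.le hB x
  rw [hu, rightDirected_mul_iff h2 (h3 p hp.1 hp.2)]

theorem isDescentInterval_foldl_srt (hB : ∀ F ∈ B, Separated F e)
    (x : Perm (Fin (n + 1))) :
    IsDescentInterval (B.foldl srt x) e ↔ IsDescentInterval x e :=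
  Set.EqOn.congr_strictAntiOn fun _ hp => foldl_srt_apply hB x hp

theorem isMonotoneInterval_foldl_srt (hB : ∀ F ∈ B, Separated F e)
    (x : Perm (Fin (n + 1))) :
    IsMonotoneInterval (B.foldl srt x) e ↔ IsMonotoneInterval x e := by
  unfold IsMonotoneInterval IsStrongDescentInterval
  rw [isDescentInterval_foldl_srt hB, leftDirected_foldl_srt hB x (left_mem_block e),
    rightDirected_foldl_srt hB x (right_mem_block e)]
  refine and_congr_right fun _ => forall_congr' fun p => forall_congr' fun h1 =>
    forall_congr' fun h2 => ?_
  rw [leftDirected_foldl_srt hB x ⟨h1, h2⟩, rightDirected_foldl_srt hB x ⟨h1, h2⟩]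

end

theorem Separated.symm {e f : PosInterval n} (h : Separated e f) : Separated f e := Or.symm h

theorem Separated.notMem {e f : PosInterval n} (h : Separated e f) {p : Fin (n + 1)}
    (hp : p ∈ block e) : p ∉ block f := by
  rintro ⟨h1, h2⟩
  obtain ⟨h3, h4⟩ := hp
  rcases h with h | h <;> order

theorem srt_comm {e f : PosInterval n} (h : Separated e f) (x : Perm (Fin (n + 1))) :
    srt (srt x e) f = srt (srt x f) e := by
  obtain ⟨u, hu, hf⟩ := srt_eq_mul x e
  have hm : ∀ p, u p ∈ block e ↔ p ∈ block e := fun p => mem_block_of_fixed hf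
  have h1 : srt x f * u = srt (srt x e) f := by
    refine srt_unique (fun p hp => ?_) fun p hp q hq hpq => ?_
    · rw [hu, Perm.mul_apply, Perm.mul_apply, srt_of_notMem]
      by_cases he : p ∈ block e
      · exact h.notMem ((hm p).2 he)
      · rwa [hf p he]
    · rw [Perm.mul_apply, Perm.mul_apply, hf _ (h.symm.notMem hp), hf _ (h.symm.notMem hq)]
      exact srt_anti x f hp hq hpq
  rw [← h1]
  refine srt_unique (fun p hp => by rw [Perm.mul_apply, hf p hp]) fun p hp q hq hpq => ?_
  rw [Perm.mul_apply, Perm.mul_apply, srt_of_notMem x (h.notMem ((hm p).2 hp)),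
    srt_of_notMem x (h.notMem ((hm q).2 hq)), ← Perm.mul_apply, ← Perm.mul_apply, ← hu]
  exact srt_anti x e hp hq hpq

theorem foldl_srt_comm {f : PosInterval n} {B : List (PosInterval n)}
    (hB : ∀ F ∈ B, Separated F f) (x : Perm (Fin (n + 1))) :
    B.foldl srt (srt x f) = srt (B.foldl srt x) f := by
  induction B generalizing x with
  | nil => rfl
  | cons F B ih =>
    rw [List.foldl_cons, List.foldl_cons, ← ih (fun G hG => hB G (List.mem_cons_of_mem _ hG)),
      srt_comm (hB F List.mem_cons_self)]

theorem srt_eq_self {x : Perm (Fin (n + 1))} {e : PosInterval n} (h : IsDescentInterval x e) :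
    srt x e = x := (srt_unique (fun _ _ => rfl) h).symm

theorem srt_srt_of_subset {e f : PosInterval n} (h : block f ⊆ block e) (x : Perm (Fin (n + 1))) :
    srt (srt x f) e = srt x e :=
  srt_unique (fun p hp => by rw [srt_of_notMem _ hp, srt_of_notMem _ fun hf => hp (h hf)])
    (srt_anti _ e)

/-! ## Deleting contractions -/

/-- Take the last letter `D` that meets `F`. Its first value is a left-to-right maximum and its last
one a right-to-left minimum, so no descent interval crosses an end of `D`; later letters do not
disturb `F`. -/
theorem exists_subset_of_isDescentInterval {A : List (PosInterval n)} {F : PosInterval n}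
    (hA : RMono A) (hd : IsDescentInterval (wd A) F) :
    ∃ A₁ D A₂, A = A₁ ++ D :: A₂ ∧ block F ⊆ block D ∧ ∀ G ∈ A₂, Separated G F := by
  have hlt := F.2
  have hex : ∃ D ∈ A, ¬ Separated D F := by
    by_contra hc
    push Not at hc
    have h1 := foldl_srt_apply hc 1 (left_mem_block F)
    have h2 := foldl_srt_apply hc 1 (right_mem_block F)
    have := hd (left_mem_block F) (right_mem_block F) hlt
    rw [wd, h1, h2] at this
    exact hlt.asymm this
  obtain ⟨A₁, D, A₂, rfl, hD, hA₂⟩ := exists_last hex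
  simp only [not_not] at hA₂
  refine ⟨A₁, D, A₂, rfl, ?_, hA₂⟩
  obtain ⟨⟨-, h2, h3⟩, -⟩ := hA A₁ D A₂ rfl
  rw [← List.singleton_append, ← List.append_assoc, wd_append,
    isDescentInterval_foldl_srt hA₂] at hd
  simp only [Separated, not_or, not_lt] at hD
  obtain ⟨hD1, hD2⟩ := hD
  have hl : D.1.1 ≤ F.1.1 := by
    by_contra hc
    have hc := not_le.1 hc
    exact (h2 _ hc).asymm (hd (left_mem_block F) ⟨hc.le, hD2⟩ hc)
  have hr : F.1.2 ≤ D.1.2 := by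
    by_contra hc
    have hc := not_le.1 hc
    exact (h3 _ hc).asymm (hd ⟨hD1, hc.le⟩ (right_mem_block F) hc)
  exact Set.Icc_subset_Icc hl hr

theorem lsrt_comm {e f : PosInterval n} (h : Separated e f) (x : Perm (Fin (n + 1))) :
    lsrt e (lsrt f x) = lsrt f (lsrt e x) := by
  rw [lsrt, lsrt, lsrt, lsrt, inv_inv, inv_inv, srt_comm h.symm]

theorem wd_append_cons_of_separated {F : PosInterval n} {A : List (PosInterval n)}
    (hA : ∀ G ∈ A, Separated G F) (B : List (PosInterval n)) :
    wd (A ++ F :: B) = lsrt F (wd (A ++ B)) := by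
  induction A with
  | nil => rw [List.nil_append, wd_cons]; rfl
  | cons G A ih =>
    rw [List.cons_append, wd_cons, ih (fun H hH => hA H (List.mem_cons_of_mem _ hH)),
      lsrt_comm (hA G List.mem_cons_self), List.cons_append, wd_cons]

/-- Prefix products do not change, so right-monotonicity survives. For left-monotonicity, let `D` be
the earlier letter that contains `F`. Suffixes starting at or before `D` absorb `F` into `D`. For
letters strictly between `D` and `F`, everything up to `F` is separated from `F`, which can then be
moved to the front and removed. -/
theorem delete_contraction {A B : List (PosInterval n)} {F : PosInterval n}
    (hR : RMono (A ++ F :: B)) (hL : LMono (A ++ F :: B)) (hd : IsDescentInterval (wd A) F) :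
    RMono (A ++ B) ∧ LMono (A ++ B) ∧ wd (A ++ B) = wd (A ++ F :: B) := by
  have hdel : ∀ X, wd (A ++ F :: X) = wd (A ++ X) := fun X => by
    rw [wd_append, List.foldl_cons, srt_eq_self hd, ← wd_append]
  refine ⟨fun A' e B' h => ?_, fun A' e B' h => ?_, (hdel B).symm⟩
  · rcases append_eq_append_cons h with ⟨X, rfl, rfl⟩ | ⟨X, rfl, rfl⟩
    · exact hR A' e (X ++ F :: B) (by simp)
    · have := hR (A ++ F :: X) e B' (by simp)
      rwa [List.append_assoc, List.cons_append, hdel, ← List.append_assoc] at this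
  · rcases append_eq_append_cons h with ⟨X, rfl, rfl⟩ | ⟨X, rfl, rfl⟩
    · obtain ⟨A₁, D, A₂, hA, hFD, hA₂⟩ :=
        exists_subset_of_isDescentInterval hR.of_append hd
      have h1 := hL A' e (X ++ F :: B) (by simp)
      have habs : ∀ Y, wd (Y ++ D :: (A₂ ++ F :: B)) = wd (Y ++ D :: (A₂ ++ B)) := by
        intro Y
        induction Y with
        | nil =>
          rw [List.nil_append, List.nil_append, wd_cons, wd_append_cons_of_separated hA₂, wd_cons,
            lsrt, lsrt, inv_inv, srt_srt_of_subset hFD, lsrt]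
        | cons G Y ih => rw [List.cons_append, wd_cons, ih, List.cons_append, wd_cons]
      rcases append_cons_eq_append_cons hA with ⟨Y, rfl, rfl⟩ | ⟨rfl, rfl, rfl⟩ | ⟨Y, rfl, rfl⟩
      · have hX : ∀ G ∈ e :: X, Separated G F := fun G hG => hA₂ G (List.mem_append_right _ hG)
        rw [← List.cons_append, wd_append_cons_of_separated hX, lsrt, inv_inv] at h1
        exact (isMonotoneInterval_foldl_srt (B := [F]) (e := e)
          (by simpa using (hX e List.mem_cons_self).symm) _).1 h1
      · have := habs []
        simp only [List.nil_append] at this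
        rwa [this] at h1
      · have := habs (e :: Y)
        simp only [List.cons_append, List.append_assoc] at this h1 ⊢
        rwa [this] at h1
    · exact hL (A ++ F :: X) e B' (by simp)

/-- Each deletion shortens the word and keeps its product and its monotonicity; left-contractions
are right-contractions of the reversed word. -/
theorem exists_good {I : List (PosInterval n)} (hR : RMono I) (hL : LMono I) :
    ∃ I', Good I' ∧ wd I' = wd I := by
  induction hk : I.length using Nat.strong_induction_on generalizing I with
  | _ k ih =>
    by_cases hR' : RReduced I
    · by_cases hL' : LReduced I
      · exact ⟨I, ⟨hR, hL, hR', hL'⟩, rfl⟩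
      · rw [← RReduced_reverse] at hL'
        unfold RReduced at hL'
        push Not at hL'
        obtain ⟨A, e, B, hI, hd⟩ := hL'
        have hR2 := RMono_reverse.2 hL
        have hL2 : LMono I.reverse := RMono_reverse.1 (by rwa [List.reverse_reverse])
        rw [hI] at hR2 hL2
        obtain ⟨h1, h2, h3⟩ := delete_contraction hR2 hL2 hd
        have hlen := congrArg List.length hI
        simp only [List.length_reverse, List.length_append, List.length_cons] at hlen
        obtain ⟨I', hg, hw⟩ := ih _ (by simp only [List.length_append]; omega) h1 h2 rfl
        refine ⟨I'.reverse, hg.reverse, ?_⟩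
        rw [wd_reverse, hw, h3, ← hI, wd_reverse, inv_inv]
    · unfold RReduced at hR'
      push Not at hR'
      obtain ⟨A, e, B, rfl, hd⟩ := hR'
      obtain ⟨h1, h2, h3⟩ := delete_contraction hR hL hd
      simp only [List.length_append, List.length_cons] at hk
      obtain ⟨I', hg, hw⟩ := ih _ (by simp only [List.length_append]; omega) h1 h2 rfl
      exact ⟨I', hg, hw.trans h3⟩

/-! ## Split intervals -/

/-- `x` is split at `e` if it is the update, at the interval `e`, of a permutation for which `e` is
a monotone interval: at the positions of `e`, the only inversions are those between two positions
that are not right-directed and those between two positions that are not left-directed. -/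
structure Split (x : Perm (Fin (n + 1))) (e : PosInterval n) : Prop where
  directed : ∀ p ∈ block e, LeftDirected x e p ∨ RightDirected x e p
  inversion : ∀ p ∈ block e, ∀ q ∈ block e, p < q → x q < x p →
    (¬ RightDirected x e p ∧ ¬ RightDirected x e q) ∨ (¬ LeftDirected x e p ∧ ¬ LeftDirected x e q)
  anti_right : ∀ p ∈ block e, ∀ q ∈ block e, p < q → ¬ RightDirected x e p →
    ¬ RightDirected x e q → x q < x p
  anti_left : ∀ p ∈ block e, ∀ q ∈ block e, p < q → ¬ LeftDirected x e p →
    ¬ LeftDirected x e q → x q < x p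
  exists_left : ∃ p ∈ block e, LeftDirected x e p
  exists_right : ∃ p ∈ block e, RightDirected x e p

theorem LeftDirected.mono {x : Perm (Fin (n + 1))} {e : PosInterval n} {p q : Fin (n + 1)}
    (h : LeftDirected x e p) (hpq : x p ≤ x q) : LeftDirected x e q :=
  fun r hr => (h r hr).trans_le hpq

theorem RightDirected.mono {x : Perm (Fin (n + 1))} {e : PosInterval n} {p q : Fin (n + 1)}
    (h : RightDirected x e p) (hpq : x q ≤ x p) : RightDirected x e q :=
  fun r hr => hpq.trans_lt (h r hr)

theorem leftDirected_congr {x y : Perm (Fin (n + 1))} {e : PosInterval n} {p q : Fin (n + 1)}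
    (h : ∀ r, r ∉ block e → y r = x r) (hpq : y q = x p) :
    LeftDirected y e q ↔ LeftDirected x e p := by
  unfold LeftDirected
  refine forall_congr' fun r => forall_congr' fun hr => ?_
  rw [hpq, h r fun hm => hm.1.not_gt hr]

theorem rightDirected_congr {x y : Perm (Fin (n + 1))} {e : PosInterval n} {p q : Fin (n + 1)}
    (h : ∀ r, r ∉ block e → y r = x r) (hpq : y q = x p) :
    RightDirected y e q ↔ RightDirected x e p := by
  unfold RightDirected
  refine forall_congr' fun r => forall_congr' fun hr => ?_
  rw [hpq, h r fun hm => hm.2.not_gt hr]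

theorem srt_inv_apply_mem {x : Perm (Fin (n + 1))} {e : PosInterval n} {p : Fin (n + 1)}
    (hp : p ∈ block e) : (srt x e)⁻¹ (x p) ∈ block e := by
  rwa [srt_inv_mem_iff, inv_apply_apply]

theorem inv_srt_apply_mem {x : Perm (Fin (n + 1))} {e : PosInterval n} {p : Fin (n + 1)}
    (hp : p ∈ block e) : x⁻¹ (srt x e p) ∈ block e := by
  rwa [← srt_inv_mem_iff, inv_apply_apply]

namespace Split

variable {x : Perm (Fin (n + 1))} {e : PosInterval n}

theorem mono_srt (h : Split x e) : IsMonotoneInterval (srt x e) e := by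
  have ha := srt_anti x e
  have hL : ∀ p q, srt x e q = x p → (LeftDirected (srt x e) e q ↔ LeftDirected x e p) :=
    fun p q => leftDirected_congr fun _ => srt_of_notMem x
  have hR : ∀ p q, srt x e q = x p → (RightDirected (srt x e) e q ↔ RightDirected x e p) :=
    fun p q => rightDirected_congr fun _ => srt_of_notMem x
  refine ⟨⟨ha, ?_, ?_⟩, fun p h1 h2 => ?_⟩
  · obtain ⟨p, hp, hpl⟩ := h.exists_left
    have hm := srt_inv_apply_mem (x := x) hp
    exact ((hL p _ (apply_inv_apply _ _)).2 hpl).mono (ha.antitoneOn (left_mem_block e) hm hm.1)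
  · obtain ⟨p, hp, hpl⟩ := h.exists_right
    have hm := srt_inv_apply_mem (x := x) hp
    exact ((hR p _ (apply_inv_apply _ _)).2 hpl).mono (ha.antitoneOn hm (right_mem_block e) hm.2)
  · have hx : srt x e p = x (x⁻¹ (srt x e p)) := (apply_inv_apply _ _).symm
    rw [hL _ p hx, hR _ p hx]
    exact h.directed _ (inv_srt_apply_mem ⟨h1, h2⟩)

/-- In a decreasing block the first position would be left-directed and the last one right-directed,
and together they would form an inversion of a type that splitness forbids. -/
theorem not_isDescentInterval (h : Split x e) : ¬ IsDescentInterval x e := by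
  intro hd
  obtain ⟨p, hp, hpl⟩ := h.exists_left
  obtain ⟨q, hq, hqr⟩ := h.exists_right
  have hl := left_mem_block e
  have hr := right_mem_block e
  have h1 := hpl.mono (hd.antitoneOn hl hp hp.1)
  have h2 := hqr.mono (hd.antitoneOn hq hr hq.2)
  rcases h.inversion _ hl _ hr e.2 (hd hl hr e.2) with ⟨-, h3⟩ | ⟨h3, -⟩
  · exact h3 h2
  · exact h3 h1

/-- Directedness of a position depends only on its value and on the values outside the block. So for
two values of the block, splitness decides from this data alone which one comes first. -/
theorem eq_of_eq_off (h : Split x e) {y : Perm (Fin (n + 1))} (hy : Split y e)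
    (hxy : ∀ p, p ∉ block e → y p = x p) : x = y := by
  have hu : ∀ p, p ∉ block e → (x⁻¹ * y) p = p := fun p hp => by
    rw [Perm.mul_apply, Perm.inv_eq_iff_eq, hxy p hp]
  have hm : ∀ p, (x⁻¹ * y) p ∈ block e ↔ p ∈ block e := fun p => mem_block_of_fixed hu
  have hv : ∀ p, y p = x ((x⁻¹ * y) p) := fun p => (apply_inv_apply _ _).symm
  rw [← inv_mul_eq_one]
  refine eq_one_of_strictMonoOn hu fun p hp q hq hpq => ?_
  by_contra hc
  have hc : (x⁻¹ * y) q < (x⁻¹ * y) p :=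
    lt_of_le_of_ne (not_lt.1 hc) fun h => hpq.ne' ((x⁻¹ * y).injective h)
  have hL : ∀ r, LeftDirected y e r ↔ LeftDirected x e ((x⁻¹ * y) r) :=
    fun r => leftDirected_congr hxy (hv r)
  have hR : ∀ r, RightDirected y e r ↔ RightDirected x e ((x⁻¹ * y) r) :=
    fun r => rightDirected_congr hxy (hv r)
  have hp' := (hm p).2 hp
  have hq' := (hm q).2 hq
  rcases lt_or_ge (y p) (y q) with hlt | hge
  · have h1 := h.inversion _ hq' _ hp' hc (by rwa [← hv, ← hv])
    rw [← hL, ← hL, ← hR, ← hR] at h1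
    rcases h1 with ⟨h1, h2⟩ | ⟨h1, h2⟩
    · exact (hy.anti_right p hp q hq hpq h2 h1).asymm hlt
    · exact (hy.anti_left p hp q hq hpq h2 h1).asymm hlt
  · have hlt : y q < y p := lt_of_le_of_ne hge fun h => hpq.ne' (y.injective h)
    have h1 := hy.inversion p hp q hq hpq hlt
    rw [hL, hL, hR, hR] at h1
    rw [hv p, hv q] at hlt
    rcases h1 with ⟨h1, h2⟩ | ⟨h1, h2⟩
    · exact (h.anti_right _ hq' _ hp' hc h2 h1).asymm hlt
    · exact (h.anti_left _ hq' _ hp' hc h2 h1).asymm hlt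

/-- Failure of right-directedness passes to larger values, and failure of left-directedness to
smaller ones; either failure would thus hold at both positions and force an inversion. -/
theorem directed_of_lt (h : Split x e) {p q : Fin (n + 1)} (hp : p ∈ block e) (hq : q ∈ block e)
    (hpq : p < q) (hlt : x p < x q) : RightDirected x e p ∧ LeftDirected x e q := by
  constructor
  · by_contra hc
    exact (h.anti_right p hp q hq hpq hc fun h' => hc (h'.mono hlt.le)).asymm hlt
  · by_contra hc
    exact (h.anti_left p hp q hq hpq (fun h' => hc (h'.mono hlt.le)) hc).asymm hlt

end Split

theorem split_foldl_srt {e : PosInterval n} {B : List (PosInterval n)}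
    (hB : ∀ F ∈ B, Separated F e) (x : Perm (Fin (n + 1))) :
    Split (B.foldl srt x) e ↔ Split x e := by
  have hv := fun p (hp : p ∈ block e) => foldl_srt_apply hB x hp
  have hL := fun p (hp : p ∈ block e) => leftDirected_foldl_srt hB x hp
  have hR := fun p (hp : p ∈ block e) => rightDirected_foldl_srt hB x hp
  constructor
  · rintro ⟨h1, h2, h3, h4, ⟨p, hp, h5⟩, ⟨q, hq, h6⟩⟩
    refine ⟨fun p hp => ?_, fun p hp q hq => ?_, fun p hp q hq => ?_, fun p hp q hq => ?_,
      ⟨p, hp, (hL p hp).1 h5⟩, ⟨q, hq, (hR q hq).1 h6⟩⟩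
    · rw [← hL p hp, ← hR p hp]; exact h1 p hp
    · rw [← hL p hp, ← hR p hp, ← hL q hq, ← hR q hq, ← hv p hp, ← hv q hq]; exact h2 p hp q hq
    · rw [← hR p hp, ← hR q hq, ← hv p hp, ← hv q hq]; exact h3 p hp q hq
    · rw [← hL p hp, ← hL q hq, ← hv p hp, ← hv q hq]; exact h4 p hp q hq
  · rintro ⟨h1, h2, h3, h4, ⟨p, hp, h5⟩, ⟨q, hq, h6⟩⟩
    refine ⟨fun p hp => ?_, fun p hp q hq => ?_, fun p hp q hq => ?_, fun p hp q hq => ?_,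
      ⟨p, hp, (hL p hp).2 h5⟩, ⟨q, hq, (hR q hq).2 h6⟩⟩
    · rw [hL p hp, hR p hp]; exact h1 p hp
    · rw [hL p hp, hR p hp, hL q hq, hR q hq, hv p hp, hv q hq]; exact h2 p hp q hq
    · rw [hR p hp, hR q hq, hv p hp, hv q hq]; exact h3 p hp q hq
    · rw [hL p hp, hL q hq, hv p hp, hv q hq]; exact h4 p hp q hq

/-! ## Pattern avoidance -/

/-- Patterns are phrased through the positions of given values because sorting is controlled by its
effect on the order in which values appear. -/
theorem realizes_4231 {w : Perm (Fin (n + 1))} : Realizes w ![4, 2, 3, 1] ↔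
    ∃ v₁ v₂ v₃ v₄, (v₁ < v₂ ∧ v₂ < v₃ ∧ v₃ < v₄) ∧
      w⁻¹ v₄ < w⁻¹ v₂ ∧ w⁻¹ v₂ < w⁻¹ v₃ ∧ w⁻¹ v₃ < w⁻¹ v₁ := by
  constructor
  · rintro ⟨p, hp, h⟩
    refine ⟨w (p 3), w (p 1), w (p 2), w (p 0), ?_, ?_⟩
    · refine ⟨(h _ _).2 ?_, (h _ _).2 ?_, (h _ _).2 ?_⟩ <;> decide
    · simp only [inv_apply_apply]
      refine ⟨hp ?_, hp ?_, hp ?_⟩ <;> decide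
  · rintro ⟨v₁, v₂, v₃, v₄, ⟨h1, h2, h3⟩, h4, h5, h6⟩
    refine ⟨![w⁻¹ v₄, w⁻¹ v₂, w⁻¹ v₃, w⁻¹ v₁], ?_, fun i j => ?_⟩
    · rw [Fin.strictMono_iff_lt_succ]
      intro i
      fin_cases i <;> assumption
    · fin_cases i <;> fin_cases j <;> simp [-Perm.coe_inv, apply_inv_apply] <;> order

theorem realizes_45312 {w : Perm (Fin (n + 1))} : Realizes w ![4, 5, 3, 1, 2] ↔
    ∃ v₁ v₂ v₃ v₄ v₅, (v₁ < v₂ ∧ v₂ < v₃ ∧ v₃ < v₄ ∧ v₄ < v₅) ∧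
      w⁻¹ v₄ < w⁻¹ v₅ ∧ w⁻¹ v₅ < w⁻¹ v₃ ∧ w⁻¹ v₃ < w⁻¹ v₁ ∧ w⁻¹ v₁ < w⁻¹ v₂ := by
  constructor
  · rintro ⟨p, hp, h⟩
    refine ⟨w (p 3), w (p 4), w (p 2), w (p 0), w (p 1), ?_, ?_⟩
    · refine ⟨(h _ _).2 ?_, (h _ _).2 ?_, (h _ _).2 ?_, (h _ _).2 ?_⟩ <;> decide
    · simp only [inv_apply_apply]
      refine ⟨hp ?_, hp ?_, hp ?_, hp ?_⟩ <;> decide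
  · rintro ⟨v₁, v₂, v₃, v₄, v₅, ⟨h1, h2, h3, h7⟩, h4, h5, h6, h8⟩
    refine ⟨![w⁻¹ v₄, w⁻¹ v₅, w⁻¹ v₃, w⁻¹ v₁, w⁻¹ v₂], ?_, fun i j => ?_⟩
    · rw [Fin.strictMono_iff_lt_succ]
      intro i
      fin_cases i <;> assumption
    · fin_cases i <;> fin_cases j <;> simp [-Perm.coe_inv, apply_inv_apply] <;> order

namespace Split

variable {x : Perm (Fin (n + 1))} {e : PosInterval n}

/-- Sorting keeps inversions, so an occurrence can only be lost at a non-inverted pair inside the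
block. Such a pair has a right-directed smaller value and a left-directed larger one. A third value
of the pattern is inverted with both: inside the block it would not be directed at all, and outside
it contradicts the directedness of one of the two. -/
theorem avoids_of_avoids_srt (h : Split x e) (hw : Avoids (srt x e)) : Avoids x := by
  have hin : ∀ {u v}, x⁻¹ u ∈ block e → x⁻¹ v ∈ block e → x⁻¹ u < x⁻¹ v → u < v →
      RightDirected x e (x⁻¹ u) ∧ LeftDirected x e (x⁻¹ v) := fun {u v} hu hv h1 h2 =>
    h.directed_of_lt hu hv h1 (by rwa [apply_inv_apply, apply_inv_apply])
  have hinv : ∀ {u v}, x⁻¹ u ∈ block e → x⁻¹ v ∈ block e → x⁻¹ v < x⁻¹ u → u < v →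
      (¬ RightDirected x e (x⁻¹ v) ∧ ¬ RightDirected x e (x⁻¹ u)) ∨
      (¬ LeftDirected x e (x⁻¹ v) ∧ ¬ LeftDirected x e (x⁻¹ u)) := fun {u v} hu hv h1 h2 =>
    h.inversion _ hv _ hu h1 (by rwa [apply_inv_apply, apply_inv_apply])
  have hL : ∀ {u v}, LeftDirected x e (x⁻¹ v) → x⁻¹ u < e.1.1 → u < v := fun {u v} h1 h2 => by
    have := h1 _ h2
    rwa [apply_inv_apply, apply_inv_apply] at this
  have hR : ∀ {u v}, RightDirected x e (x⁻¹ v) → e.1.2 < x⁻¹ u → v < u := fun {u v} h1 h2 => by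
    have := h1 _ h2
    rwa [apply_inv_apply, apply_inv_apply] at this
  refine ⟨fun hr => hw.1 ?_, fun hr => hw.2 ?_⟩
  · rw [realizes_4231] at hr ⊢
    obtain ⟨v₁, v₂, v₃, v₄, ⟨h1, h2, h3⟩, h4, h5, h6⟩ := hr
    refine ⟨v₁, v₂, v₃, v₄, ⟨h1, h2, h3⟩, srt_inv_lt_of_lt x e (h2.trans h3) h4,
      (srt_inv_lt_iff x ?_).2 h5, srt_inv_lt_of_lt x e (h1.trans h2) h6⟩
    rintro ⟨m2, m3⟩
    obtain ⟨d2, d3⟩ := hin m2 m3 h5 h2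
    by_cases m4 : x⁻¹ v₄ ∈ block e
    · have i1 := hinv m2 m4 h4 (h2.trans h3)
      have i2 := hinv m3 m4 (h4.trans h5) h3
      have := h.directed _ m4
      tauto
    · have : x⁻¹ v₄ < e.1.1 := by
        by_contra hc
        exact m4 ⟨not_lt.1 hc, h4.le.trans m2.2⟩
      exact (hL d3 this).asymm h3
  · rw [realizes_45312] at hr ⊢
    obtain ⟨v₁, v₂, v₃, v₄, v₅, ⟨h1, h2, h3, h4⟩, h5, h6, h7, h8⟩ := hr
    refine ⟨v₁, v₂, v₃, v₄, v₅, ⟨h1, h2, h3, h4⟩, (srt_inv_lt_iff x ?_).2 h5,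
      srt_inv_lt_of_lt x e (h3.trans h4) h6, srt_inv_lt_of_lt x e (h1.trans h2) h7,
      (srt_inv_lt_iff x ?_).2 h8⟩
    · rintro ⟨m4, m5⟩
      obtain ⟨d4, d5⟩ := hin m4 m5 h5 h4
      by_cases m3 : x⁻¹ v₃ ∈ block e
      · have i1 := hinv m3 m4 (h5.trans h6) h3
        have i2 := hinv m3 m5 h6 (h3.trans h4)
        have := h.directed _ m3
        tauto
      · have : e.1.2 < x⁻¹ v₃ := by
          by_contra hc
          exact m3 ⟨m5.1.trans h6.le, not_lt.1 hc⟩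
        exact (hR d4 this).asymm h3
    · rintro ⟨m1, m2⟩
      obtain ⟨d1, d2⟩ := hin m1 m2 h8 h1
      by_cases m3 : x⁻¹ v₃ ∈ block e
      · have i1 := hinv m1 m3 h7 (h1.trans h2)
        have i2 := hinv m2 m3 (h7.trans h8) h2
        have := h.directed _ m3
        tauto
      · have : x⁻¹ v₃ < e.1.1 := by
          by_contra hc
          exact m3 ⟨not_lt.1 hc, h7.le.trans m1.2⟩
        exact (hL d2 this).asymm h2

/-- Non-inversions of the sorted permutation are never inside the block, so they were present
before. An inversion created by sorting joins a right-directed value to a left-directed one. The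
values flanking it in the pattern then either violate this directedness from outside or form a
non-inversion inside the decreasing block. -/
theorem avoids_srt (h : Split x e) (hx : Avoids x) : Avoids (srt x e) := by
  set w := srt x e with hw
  have hm : ∀ v, x⁻¹ v ∈ block e ↔ w⁻¹ v ∈ block e := fun v => (srt_inv_mem_iff x e v).symm
  have hne : ∀ {u v}, w⁻¹ u ∈ block e → w⁻¹ v ∈ block e → w⁻¹ u < w⁻¹ v → ¬ u < v :=
    fun {u v} hu hv h1 h2 =>
      h1.asymm (srt_inv_lt_of_mem x ((hm u).2 hu) ((hm v).2 hv) h2)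
  have hup : ∀ {u v}, w⁻¹ u < w⁻¹ v → u < v → x⁻¹ u < x⁻¹ v := fun {u v} h1 h2 =>
    (srt_inv_lt_iff x fun hc => hne ((hm u).1 hc.1) ((hm v).1 hc.2) h1 h2).1 h1
  have hdown : ∀ {u v}, w⁻¹ v < w⁻¹ u → u < v → x⁻¹ v < x⁻¹ u ∨ (w⁻¹ u ∈ block e ∧
      w⁻¹ v ∈ block e ∧ RightDirected x e (x⁻¹ u) ∧ LeftDirected x e (x⁻¹ v)) := by
    intro u v h1 h2
    by_cases hc : x⁻¹ v ∈ block e ∧ x⁻¹ u ∈ block e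
    · rcases lt_or_ge (x⁻¹ v) (x⁻¹ u) with h3 | h3
      · exact Or.inl h3
      · have h4 : x⁻¹ u < x⁻¹ v := lt_of_le_of_ne h3 fun h => h2.ne (x⁻¹.injective h)
        exact Or.inr ⟨(hm u).1 hc.2, (hm v).1 hc.1, h.directed_of_lt hc.2 hc.1 h4
          (by rwa [apply_inv_apply, apply_inv_apply])⟩
    · exact Or.inl ((srt_inv_lt_iff x hc).1 h1)
  have hL : ∀ {u v}, LeftDirected x e (x⁻¹ v) → w⁻¹ u < e.1.1 → u < v := fun {u v} h1 h2 => by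
    have h3 := srt_inv_of_notMem x (e := e) (v := u) (by
      rw [hm]; exact fun hc => hc.1.not_gt h2)
    rw [← hw] at h3
    have := h1 _ (h3 ▸ h2)
    rwa [apply_inv_apply, apply_inv_apply] at this
  have hR : ∀ {u v}, RightDirected x e (x⁻¹ v) → e.1.2 < w⁻¹ u → v < u := fun {u v} h1 h2 => by
    have h3 := srt_inv_of_notMem x (e := e) (v := u) (by
      rw [hm]; exact fun hc => hc.2.not_gt h2)
    rw [← hw] at h3
    have := h1 _ (h3 ▸ h2)
    rwa [apply_inv_apply, apply_inv_apply] at this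
  refine ⟨fun hr => hx.1 ?_, fun hr => hx.2 ?_⟩
  · rw [realizes_4231] at hr ⊢
    obtain ⟨v₁, v₂, v₃, v₄, ⟨h1, h2, h3⟩, h4, h5, h6⟩ := hr
    refine ⟨v₁, v₂, v₃, v₄, ⟨h1, h2, h3⟩, ?_, hup h5 h2, ?_⟩
    · refine (hdown h4 (h2.trans h3)).resolve_right ?_
      rintro ⟨m2, m4, d2, -⟩
      rcases lt_or_ge e.1.2 (w⁻¹ v₁) with hc | hc
      · exact (hR d2 hc).asymm h1
      · exact hne m2 ⟨m2.1.trans h5.le, h6.le.trans hc⟩ h5 h2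
    · refine (hdown h6 (h1.trans h2)).resolve_right ?_
      rintro ⟨m1, m3, -, d3⟩
      rcases lt_or_ge (w⁻¹ v₄) e.1.1 with hc | hc
      · exact (hL d3 hc).asymm h3
      · exact hne ⟨hc.trans h4.le, h5.le.trans m3.2⟩ m3 h5 h2
  · rw [realizes_45312] at hr ⊢
    obtain ⟨v₁, v₂, v₃, v₄, v₅, ⟨h1, h2, h3, h4⟩, h5, h6, h7, h8⟩ := hr
    refine ⟨v₁, v₂, v₃, v₄, v₅, ⟨h1, h2, h3, h4⟩, hup h5 h4, ?_, ?_, hup h8 h1⟩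
    · refine (hdown h6 (h3.trans h4)).resolve_right ?_
      rintro ⟨m3, m5, d3, -⟩
      rcases lt_or_ge e.1.2 (w⁻¹ v₂) with hc | hc
      · exact (hR d3 hc).asymm h2
      · exact hne ⟨m3.1.trans h7.le, h8.le.trans hc⟩ ⟨(m3.1.trans h7.le).trans h8.le, hc⟩ h8 h1
    · refine (hdown h7 (h1.trans h2)).resolve_right ?_
      rintro ⟨m1, m3, -, d3⟩
      rcases lt_or_ge (w⁻¹ v₄) e.1.1 with hc | hc
      · exact (hL d3 hc).asymm h3
      · exact hne ⟨hc, (h5.le.trans h6.le).trans m3.2⟩ ⟨hc.trans h5.le, h6.le.trans m3.2⟩ h5 h4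

/-- In a split block the right-directed positions form an initial segment and the left-directed ones
a final segment, opposite to the order in a decreasing block. -/
theorem rightDirected_of_lt (h : Split x e) {p q : Fin (n + 1)} (hp : p ∈ block e)
    (hq : q ∈ block e) (hpq : p < q) (hr : RightDirected x e q) : RightDirected x e p := by
  by_contra hc
  have hlt : x q < x p := not_le.1 fun hle => hc (hr.mono hle)
  rcases h.inversion p hp q hq hpq hlt with h1 | h1
  · exact h1.2 hr
  · exact (h.directed p hp).elim h1.1 hc

theorem leftDirected_of_lt (h : Split x e) {p q : Fin (n + 1)} (hp : p ∈ block e)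
    (hq : q ∈ block e) (hpq : p < q) (hl : LeftDirected x e p) : LeftDirected x e q := by
  by_contra hc
  have hlt : x q < x p := not_le.1 fun hle => hc (hl.mono hle)
  rcases h.inversion p hp q hq hpq hlt with h1 | h1
  · exact (h.directed q hq).elim hc h1.2
  · exact h1.1 hl

end Split

/-! ## The symmetry of the diagram -/

/-- Conjugation with the longest permutation. -/
def flip (x : Perm (Fin (n + 1))) : Perm (Fin (n + 1)) := Fin.revPerm * x * Fin.revPerm

@[simp] theorem flip_apply (x : Perm (Fin (n + 1))) (p : Fin (n + 1)) :
    flip x p = (x p.rev).rev := rfl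

@[simp] theorem flip_flip (x : Perm (Fin (n + 1))) : flip (flip x) = x := by
  ext p; simp

theorem flip_inv (x : Perm (Fin (n + 1))) : (flip x)⁻¹ = flip x⁻¹ := by
  ext p
  have : (flip x)⁻¹ p = flip x⁻¹ p := by
    rw [Perm.inv_eq_iff_eq, flip_apply, flip_apply, Fin.rev_rev, apply_inv_apply, Fin.rev_rev]
  exact congrArg Fin.val this

@[simp] theorem flip_one : flip (1 : Perm (Fin (n + 1))) = 1 := by
  ext p; simp

/-- The image of an interval under the symmetry. -/
def flipI (e : PosInterval n) : PosInterval n := ⟨(e.1.2.rev, e.1.1.rev), Fin.rev_lt_rev.2 e.2⟩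

@[simp] theorem flipI_left (e : PosInterval n) : (flipI e).1.1 = e.1.2.rev := rfl

@[simp] theorem flipI_right (e : PosInterval n) : (flipI e).1.2 = e.1.1.rev := rfl

@[simp] theorem flipI_flipI (e : PosInterval n) : flipI (flipI e) = e := by
  ext <;> simp

theorem mem_block_flipI {e : PosInterval n} {p : Fin (n + 1)} :
    p ∈ block (flipI e) ↔ p.rev ∈ block e := by
  simp only [Set.mem_Icc, flipI_left, flipI_right, Fin.rev_le_iff, Fin.le_rev_iff, and_comm]

theorem rev_mem_block_flipI {e : PosInterval n} {p : Fin (n + 1)} :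
    p.rev ∈ block (flipI e) ↔ p ∈ block e := by
  rw [mem_block_flipI, Fin.rev_rev]

theorem srt_flip (x : Perm (Fin (n + 1))) (e : PosInterval n) :
    srt (flip x) (flipI e) = flip (srt x e) := by
  refine (srt_unique (fun p hp => ?_) fun p hp q hq hpq => ?_).symm
  · rw [flip_apply, flip_apply, srt_of_notMem x (fun h => hp (mem_block_flipI.2 h))]
  · rw [flip_apply, flip_apply, Fin.rev_lt_rev]
    exact srt_anti x e (mem_block_flipI.1 hq) (mem_block_flipI.1 hp) (Fin.rev_lt_rev.2 hpq)

theorem wd_flip (I : List (PosInterval n)) : wd (I.map flipI) = flip (wd I) := by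
  induction I using List.reverseRecOn with
  | nil => simp
  | append_singleton I e ih =>
    rw [List.map_append, List.map_singleton, wd_snoc, ih, srt_flip, wd_snoc]

theorem leftDirected_flip {x : Perm (Fin (n + 1))} {e : PosInterval n} {p : Fin (n + 1)} :
    LeftDirected (flip x) (flipI e) p ↔ RightDirected x e p.rev := by
  constructor
  · intro h q hq
    have := h q.rev (Fin.rev_lt_rev.2 hq)
    rwa [flip_apply, flip_apply, Fin.rev_rev, Fin.rev_lt_rev] at this
  · intro h q hq
    rw [flip_apply, flip_apply, Fin.rev_lt_rev]
    exact h _ (Fin.lt_rev_iff.1 hq)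

theorem rightDirected_flip {x : Perm (Fin (n + 1))} {e : PosInterval n} {p : Fin (n + 1)} :
    RightDirected (flip x) (flipI e) p ↔ LeftDirected x e p.rev := by
  have := leftDirected_flip (x := flip x) (e := flipI e) (p := p.rev)
  rw [flip_flip, flipI_flipI, Fin.rev_rev] at this
  exact this.symm

theorem isDescentInterval_flip {x : Perm (Fin (n + 1))} {e : PosInterval n}
    (h : IsDescentInterval x e) : IsDescentInterval (flip x) (flipI e) := by
  intro p hp q hq hpq
  rw [flip_apply, flip_apply, Fin.rev_lt_rev]
  exact h (mem_block_flipI.1 hq) (mem_block_flipI.1 hp) (Fin.rev_lt_rev.2 hpq)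

theorem isDescentInterval_of_flip {x : Perm (Fin (n + 1))} {e : PosInterval n}
    (h : IsDescentInterval (flip x) (flipI e)) : IsDescentInterval x e := by
  have := isDescentInterval_flip h
  rwa [flip_flip, flipI_flipI] at this

theorem isMonotoneInterval_flip {x : Perm (Fin (n + 1))} {e : PosInterval n}
    (h : IsMonotoneInterval x e) : IsMonotoneInterval (flip x) (flipI e) := by
  obtain ⟨⟨h1, h2, h3⟩, h4⟩ := h
  refine ⟨⟨isDescentInterval_flip h1, ?_, ?_⟩, fun p hp hq => ?_⟩
  · rw [leftDirected_flip]; simpa using h3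
  · rw [rightDirected_flip]; simpa using h2
  · rw [leftDirected_flip, rightDirected_flip]
    have := mem_block_flipI.1 ⟨hp, hq⟩
    exact (h4 _ this.1 this.2).symm

theorem map_flipI_eq {I A B : List (PosInterval n)} {e : PosInterval n}
    (h : I.map flipI = A ++ e :: B) : I = A.map flipI ++ flipI e :: B.map flipI := by
  have := congrArg (List.map flipI) h
  rw [List.map_map, List.map_append, List.map_cons] at this
  rw [← this]
  simp [Function.comp_def]

theorem Good.flip {I : List (PosInterval n)} (h : Good I) : Good (I.map flipI) where
  rmono A e B hI := by
    have := isMonotoneInterval_flip (h.rmono _ _ _ (map_flipI_eq hI))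
    rw [← wd_flip] at this
    simpa [Function.comp_def] using this
  lmono A e B hI := by
    have := isMonotoneInterval_flip (h.lmono _ _ _ (map_flipI_eq hI))
    rw [← flip_inv, ← wd_flip] at this
    simpa [Function.comp_def] using this
  rreduced A e B hI hd := by
    refine h.rreduced _ _ _ (map_flipI_eq hI) (isDescentInterval_of_flip ?_)
    rw [← wd_flip]
    simpa [Function.comp_def] using hd
  lreduced A e B hI hd := by
    refine h.lreduced _ _ _ (map_flipI_eq hI) (isDescentInterval_of_flip ?_)
    rw [← flip_inv, ← wd_flip]
    simpa [Function.comp_def] using hd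

theorem Split.flip {x : Perm (Fin (n + 1))} {e : PosInterval n} (h : Split x e) :
    Split (flip x) (flipI e) where
  directed p hp := by
    rw [leftDirected_flip, rightDirected_flip]
    exact (h.directed _ (mem_block_flipI.1 hp)).symm
  inversion p hp q hq hpq hlt := by
    rw [flip_apply, flip_apply, Fin.rev_lt_rev] at hlt
    simp only [leftDirected_flip, rightDirected_flip]
    have := h.inversion _ (mem_block_flipI.1 hq) _ (mem_block_flipI.1 hp) (Fin.rev_lt_rev.2 hpq) hlt
    tauto
  anti_right p hp q hq hpq h1 h2 := by
    rw [rightDirected_flip] at h1 h2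
    rw [flip_apply, flip_apply, Fin.rev_lt_rev]
    exact h.anti_left _ (mem_block_flipI.1 hq) _ (mem_block_flipI.1 hp) (Fin.rev_lt_rev.2 hpq) h2 h1
  anti_left p hp q hq hpq h1 h2 := by
    rw [leftDirected_flip] at h1 h2
    rw [flip_apply, flip_apply, Fin.rev_lt_rev]
    exact h.anti_right _ (mem_block_flipI.1 hq) _ (mem_block_flipI.1 hp) (Fin.rev_lt_rev.2 hpq) h2 h1
  exists_left := by
    obtain ⟨p, hp, h⟩ := h.exists_right
    exact ⟨p.rev, rev_mem_block_flipI.2 hp, by rwa [leftDirected_flip, Fin.rev_rev]⟩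
  exists_right := by
    obtain ⟨p, hp, h⟩ := h.exists_left
    exact ⟨p.rev, rev_mem_block_flipI.2 hp, by rwa [rightDirected_flip, Fin.rev_rev]⟩

/-! ## The letters that meet the non-directed positions -/

/-- `y` has all inversions between positions of `C` that are not right-directed for `x`, and maps
some position to the right of `C` below each of them. -/
def RTouched (x y : Perm (Fin (n + 1))) (C : PosInterval n) : Prop :=
  ∀ p ∈ block C, ¬ RightDirected x C p → (∃ q, C.1.2 < q ∧ y q < y p) ∧
    ∀ q ∈ block C, p < q → ¬ RightDirected x C q → y q < y p

/-- The mirror image of `RTouched`. -/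
def LTouched (x y : Perm (Fin (n + 1))) (C : PosInterval n) : Prop :=
  ∀ p ∈ block C, ¬ LeftDirected x C p → (∃ q, q < C.1.1 ∧ y p < y q) ∧
    ∀ q ∈ block C, q < p → ¬ LeftDirected x C q → y p < y q

theorem rTouched_flip {x y : Perm (Fin (n + 1))} {C : PosInterval n} :
    RTouched (flip x) (flip y) (flipI C) ↔ LTouched x y C := by
  constructor
  · intro h p hp hl
    obtain ⟨⟨q, h1, h2⟩, h3⟩ := h p.rev (rev_mem_block_flipI.2 hp)
      (by rwa [rightDirected_flip, Fin.rev_rev])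
    refine ⟨⟨q.rev, Fin.rev_lt_iff.1 h1, ?_⟩, fun q hq hqp hql => ?_⟩
    · rwa [flip_apply, flip_apply, Fin.rev_lt_rev, Fin.rev_rev] at h2
    · have := h3 q.rev (rev_mem_block_flipI.2 hq) (Fin.rev_lt_rev.2 hqp)
        (by rwa [rightDirected_flip, Fin.rev_rev])
      rwa [flip_apply, flip_apply, Fin.rev_lt_rev, Fin.rev_rev, Fin.rev_rev] at this
  · intro h p hp hl
    rw [rightDirected_flip] at hl
    obtain ⟨⟨q, h1, h2⟩, h3⟩ := h p.rev (mem_block_flipI.1 hp) hl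
    refine ⟨⟨q.rev, Fin.rev_lt_rev.2 h1, ?_⟩, fun q hq hqp hql => ?_⟩
    · rwa [flip_apply, flip_apply, Fin.rev_lt_rev, Fin.rev_rev]
    · rw [rightDirected_flip] at hql
      have := h3 q.rev (mem_block_flipI.1 hq) (Fin.rev_lt_rev.2 hqp) hql
      rwa [flip_apply, flip_apply, Fin.rev_lt_rev]

theorem lTouched_flip {x y : Perm (Fin (n + 1))} {C : PosInterval n} :
    LTouched (flip x) (flip y) (flipI C) ↔ RTouched x y C := by
  rw [← rTouched_flip, flip_flip, flip_flip, flipI_flipI]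

/-- The last letter of `I` that meets `[l, b]`, where `C = [a, b]`, starts at `l` and ends to the
right of `b`. -/
def RightStructure (I : List (PosInterval n)) (C : PosInterval n) (l : Fin (n + 1)) : Prop :=
  ∃ A D B, I = A ++ D :: B ∧ D.1.1 = l ∧ C.1.2 < D.1.2 ∧ ∀ F ∈ B, F.1.2 < l ∨ C.1.2 < F.1.1

section

variable {D C : PosInterval n} {B : List (PosInterval n)} {l : Fin (n + 1)}

theorem wd_apply_of_avoid {a b : Fin (n + 1)} (hab : a ≤ b) (hB : ∀ F ∈ B, F.1.2 < a ∨ b < F.1.1) :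
    (∀ r, wd B r < a ↔ r < a) ∧ (∀ r, b < wd B r ↔ b < r) ∧ ∀ r, a ≤ r → r ≤ b → wd B r = r := by
  obtain ⟨u, hu, h⟩ := exists_foldl_srt_eq_mul hab hB 1
  rw [one_mul] at hu
  rwa [wd, hu]

/-- After the letter of `RightStructure`, the positions in `[l, b]` are decreasing and lie above a
position to the right of `b`. -/
theorem touched_of_letter (A : List (PosInterval n)) (hl : l ≤ C.1.2) (hD : D.1.1 = l)
    (hC : C.1.2 < D.1.2) (hB : ∀ F ∈ B, F.1.2 < l ∨ C.1.2 < F.1.1) {p : Fin (n + 1)}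
    (h1 : l ≤ p) (h2 : p ≤ C.1.2) :
    (∃ q, C.1.2 < q ∧ wd (A ++ D :: B) q < wd (A ++ D :: B) p) ∧
      ∀ q, p < q → q ≤ C.1.2 → wd (A ++ D :: B) q < wd (A ++ D :: B) p := by
  obtain ⟨-, k2, k3⟩ := wd_apply_of_avoid hl hB
  have hm : ∀ r, l ≤ r → r ≤ C.1.2 → wd (D :: B) r ∈ block D := fun r hr hr' => by
    rw [wd_cons_mem_iff, k3 r hr hr']
    exact ⟨hD ▸ hr, hr'.trans hC.le⟩
  refine ⟨⟨(wd B)⁻¹ D.1.2, ?_, ?_⟩, fun q hpq hq => ?_⟩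
  · rw [← k2, apply_inv_apply]; exact hC
  · have hr : C.1.2 < (wd B)⁻¹ D.1.2 := by rw [← k2, apply_inv_apply]; exact hC
    have hp := h2.trans_lt hr
    refine wd_append_lt A _ hp (wd_cons_lt (hm p h1 h2) ?_ hp)
    rw [wd_cons_mem_iff, apply_inv_apply]
    exact right_mem_block D
  · exact wd_append_lt A _ hpq (wd_cons_lt (hm p h1 h2) (hm q (h1.trans hpq.le) hq) hpq)

end

/-- Some letter meets `[l, b]`, since otherwise `l` would be right-directed. After the last such
letter, values and directedness on `[l, b]` no longer change, so they can be compared with the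
strong ends of that letter. -/
theorem RightStructure.of_split {I : List (PosInterval n)} {C : PosInterval n} {l : Fin (n + 1)}
    (hI : RMono I) (hs : Split (wd I) C) (hlC : l ∈ block C)
    (hl : ∀ p ∈ block C, ¬ RightDirected (wd I) C p ↔ l ≤ p) : RightStructure I C l := by
  obtain ⟨hl1, hl2⟩ := hlC
  have hex : ∃ F ∈ I, ¬ (F.1.2 < l ∨ C.1.2 < F.1.1) := by
    by_contra hc
    push Not at hc
    obtain ⟨-, k2, k3⟩ := wd_apply_of_avoid hl2 hc
    refine (hl l ⟨hl1, hl2⟩).2 le_rfl fun q hq => ?_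
    rw [k3 l le_rfl hl2]
    exact hl2.trans_lt ((k2 q).2 hq)
  obtain ⟨A, D, B, rfl, hD, hB⟩ := exists_last hex
  simp only [not_not] at hB
  simp only [not_or, not_lt] at hD
  obtain ⟨hD1, hD2⟩ := hD
  obtain ⟨u, hu, u1, u2, u3⟩ := exists_foldl_srt_eq_mul hl2 hB (wd (A ++ [D]))
  rw [← wd_append, List.append_assoc, List.singleton_append] at hu
  obtain ⟨⟨hd, hdl, hdr⟩, -⟩ := hI A D B rfl
  set x := wd (A ++ D :: B) with hx
  set y := wd (A ++ [D]) with hy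
  have hval : ∀ p, l ≤ p → p ≤ C.1.2 → x p = y p := fun p h1 h2 => by
    rw [hu, Perm.mul_apply, u3 p h1 h2]
  have hR : ∀ p, l ≤ p → p ≤ C.1.2 → ¬ RightDirected y C p := fun p h1 h2 => by
    rw [← rightDirected_mul_iff u2 (u3 p h1 h2), ← hu]
    exact (hl p ⟨hl1.trans h1, h2⟩).2 h1
  -- Positions before `C` have smaller values because `p`, not being right-directed, is
  -- left-directed. Positions of `C` before `l` are right-directed, and right-directedness would
  -- pass from them to `p` if `p` had a smaller value.
  have hlow : ∀ q p, q < l → l ≤ p → p ≤ C.1.2 → y q < y p := by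
    intro q p hq h1 h2
    have hq' : u⁻¹ q < l := by rwa [← u1, apply_inv_apply]
    have : x (u⁻¹ q) = y q := by rw [hu, Perm.mul_apply, apply_inv_apply]
    rw [← this, ← hval p h1 h2]
    have hp : p ∈ block C := ⟨hl1.trans h1, h2⟩
    have hpR := (hl p hp).2 h1
    rcases lt_or_ge (u⁻¹ q) C.1.1 with h | h
    · exact ((hs.directed p hp).resolve_right hpR) _ h
    · have hqm : u⁻¹ q ∈ block C := ⟨h, hq'.le.trans hl2⟩
      have hqR : RightDirected x C (u⁻¹ q) := by
        by_contra hc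
        exact hq'.not_ge ((hl _ hqm).1 hc)
      exact not_le.1 fun hle => hpR (hqR.mono hle)
  -- If `D` ended inside `[l, b]`, its last position would be right-directed for `C` as well.
  have hend : C.1.2 < D.1.2 := by
    by_contra hc
    have hc := not_lt.1 hc
    refine hR _ hD1 hc fun q hq => hdr q (hc.trans_lt hq)
  refine ⟨A, D, B, rfl, ?_, hend, hB⟩
  -- Starting before `l` would put a larger value to the left of `l`; starting after `l` would make
  -- the start of `D` exceed the value at `l`, although the positions of `[l, b]` are already
  -- decreasing.
  rcases lt_trichotomy D.1.1 l with h | h | h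
  · have h1 := hd (left_mem_block D) ⟨h.le, hD1⟩ h
    exact absurd h1 (hlow _ _ h le_rfl hl2).asymm
  · exact h
  · have h1 := hdl l h
    rw [← hval _ le_rfl hl2, ← hval _ h.le hD2] at h1
    exact absurd h1 (hs.anti_right l ⟨hl1, hl2⟩ _ ⟨hl1.trans h.le, hD2⟩ h ((hl l ⟨hl1, hl2⟩).2 le_rfl)
      ((hl _ ⟨hl1.trans h.le, hD2⟩).2 h.le)).asymm

theorem exists_least_not_rightDirected {x : Perm (Fin (n + 1))} {C : PosInterval n}
    (hs : Split x C) (hex : ∃ p ∈ block C, ¬ RightDirected x C p) :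
    ∃ l ∈ block C, ∀ p ∈ block C, ¬ RightDirected x C p ↔ l ≤ p := by
  obtain ⟨l, ⟨hl, hlR⟩, hmin⟩ := WellFounded.has_min (wellFounded_lt (α := Fin (n + 1)))
    {p | p ∈ block C ∧ ¬ RightDirected x C p} hex
  refine ⟨l, hl, fun p hp => ⟨fun h => not_lt.1 (hmin p ⟨hp, h⟩), fun h hR => hlR ?_⟩⟩
  rcases h.lt_or_eq with h | rfl
  · exact hs.rightDirected_of_lt hl hp h hR
  · exact hR

/-- Every suffix of `I` has either all or none of the inversions at the positions of `C` that are
not right-directed. -/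
theorem touched_or_free {I : List (PosInterval n)} {C : PosInterval n}
    (hI : RMono I) (hs : Split (wd I) C) {A B : List (PosInterval n)} (hAB : I = A ++ B) :
    RTouched (wd I) (wd B) C ∨
      ∀ p ∈ block C, ¬ RightDirected (wd I) C p → ∀ F ∈ B, F.1.2 < p ∨ C.1.2 < F.1.1 := by
  by_cases hex : ∃ p ∈ block C, ¬ RightDirected (wd I) C p
  · obtain ⟨l, hlC, hl⟩ := exists_least_not_rightDirected hs hex
    obtain ⟨A', D, B', rfl, hD, hC, hB'⟩ := RightStructure.of_split hI hs hlC hl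
    rcases append_eq_append_cons hAB.symm with ⟨X, rfl, rfl⟩ | ⟨X, rfl, rfl⟩
    · refine Or.inr fun p hp hpR F hF => ?_
      exact (hB' F (List.mem_append_right _ hF)).imp_left fun h => h.trans_le ((hl p hp).1 hpR)
    · refine Or.inl fun p hp hpR => ?_
      obtain ⟨h1, h2⟩ := touched_of_letter X hlC.2 hD hC hB' ((hl p hp).1 hpR) hp.2
      exact ⟨h1, fun q hq hpq _ => h2 q hpq hq.2⟩
  · push Not at hex
    exact Or.inl fun p hp h => absurd (hex p hp) h

/-- A refinement for the suffix strictly after a letter `e`: if it has not touched the right part of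
`C`, it fixes that part, and `e` either misses that part too or is the special letter of
`RightStructure`. This is the form in which left-contractions are excluded. -/
theorem touched_or_free_cons {I : List (PosInterval n)} {C : PosInterval n}
    (hI : RMono I) (hs : Split (wd I) C) {A B : List (PosInterval n)} {e : PosInterval n}
    (hAB : I = A ++ e :: B) :
    RTouched (wd I) (wd B) C ∨
      (∀ p ∈ block C, ¬ RightDirected (wd I) C p → wd B p = p) ∧
        ((∀ p ∈ block C, ¬ RightDirected (wd I) C p → p ∉ block e) ∨
          (C.1.2 < e.1.2 ∧ C.1.2 ∈ block e ∧ wd B C.1.2 = C.1.2 ∧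
            C.1.2 < (wd B)⁻¹ e.1.2)) := by
  by_cases hex : ∃ p ∈ block C, ¬ RightDirected (wd I) C p
  · obtain ⟨l, hlC, hl⟩ := exists_least_not_rightDirected hs hex
    obtain ⟨A', D, B', rfl, hD, hC, hB'⟩ := RightStructure.of_split hI hs hlC hl
    have hfix : ∀ X, (∀ F ∈ X, F.1.2 < l ∨ C.1.2 < F.1.1) →
        ∀ p ∈ block C, ¬ RightDirected (wd (A' ++ D :: B')) C p → wd X p = p := fun X hX p hp hpR =>
      (wd_apply_of_avoid hlC.2 hX).2.2 p ((hl p hp).1 hpR) hp.2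
    rcases append_cons_eq_append_cons hAB with ⟨X, rfl, rfl⟩ | ⟨rfl, rfl, rfl⟩ | ⟨X, rfl, rfl⟩
    · refine Or.inl fun p hp hpR => ?_
      obtain ⟨h1, h2⟩ := touched_of_letter X hlC.2 hD hC hB' ((hl p hp).1 hpR) hp.2
      exact ⟨h1, fun q hq hpq _ => h2 q hpq hq.2⟩
    · refine Or.inr ⟨hfix _ hB', Or.inr ⟨hC, ⟨hD ▸ hlC.2, hC.le⟩,
        (wd_apply_of_avoid hlC.2 hB').2.2 _ hlC.2 le_rfl, ?_⟩⟩
      rw [← (wd_apply_of_avoid hlC.2 hB').2.1, apply_inv_apply]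
      exact hC
    · refine Or.inr ⟨hfix _ fun F hF => hB' F (by simp [hF]), Or.inl fun p hp hpR he => ?_⟩
      have h1 := (hl p hp).1 hpR
      rcases hB' e (by simp) with h | h
      · exact (h.trans_le h1).not_ge he.2
      · exact (hp.2.trans_lt h).not_ge he.1
  · push Not at hex
    exact Or.inl fun p hp h => absurd (hex p hp) h

/-- A value of a permutation is the number of values below it. -/
theorem apply_eq_of_forall_lt_iff {z z' : Perm (Fin (n + 1))} {p : Fin (n + 1)}
    (h : ∀ q, z q < z p ↔ z' q < z' p) : z p = z' p := by
  have key : ∀ y : Perm (Fin (n + 1)),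
      (Finset.univ.filter fun q => y q < y p).card = (y p : ℕ) := fun y => by
    rw [← Fin.card_Iio (y p)]
    refine Finset.card_bij (fun q _ => y q) (fun q hq => by simpa using hq)
      (fun q _ q' _ h => y.injective h) fun v hv => ⟨y⁻¹ v, ?_, apply_inv_apply _ _⟩
    simpa [-Perm.coe_inv, apply_inv_apply] using hv
  apply Fin.ext
  rw [← key z, ← key z']
  simp only [h]

/-- No letter of `I` contains a position of `C` that is left-directed and right-directed. -/
theorem notMem_of_directed {I : List (PosInterval n)} {C : PosInterval n}
    (hs : Split (wd I) C) {p : Fin (n + 1)} (hp : p ∈ block C)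
    (hL : LeftDirected (wd I) C p) (hR : RightDirected (wd I) C p) :
    ∀ A B, I = A ++ B → wd B p = p ∧ ∀ e ∈ B, p ∉ block e := by
  -- The position `p` takes part in no inversion of the whole product, hence in none of any suffix,
  -- which forces every suffix to fix `p`.
  have hlt : ∀ q, (q < p → wd I q < wd I p) ∧ (p < q → wd I p < wd I q) := by
    intro q
    constructor
    · intro hq
      by_cases hm : q ∈ block C
      · by_contra hc
        have hc : wd I p < wd I q := lt_of_le_of_ne (not_lt.1 hc)
          fun h => hq.ne' ((wd I).injective h)
        rcases hs.inversion q hm p hp hq hc with h | h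
        · exact h.2 hR
        · exact h.2 hL
      · exact hL q (by
          by_contra hc
          exact hm ⟨not_lt.1 hc, hq.le.trans hp.2⟩)
    · intro hq
      by_cases hm : q ∈ block C
      · by_contra hc
        have hc : wd I q < wd I p := lt_of_le_of_ne (not_lt.1 hc)
          fun h => hq.ne' ((wd I).injective h)
        rcases hs.inversion p hp q hm hq hc with h | h
        · exact h.1 hR
        · exact h.1 hL
      · exact hR q (by
          by_contra hc
          exact hm ⟨hp.1.trans hq.le, not_lt.1 hc⟩)
  have hlt' : ∀ A B, I = A ++ B → ∀ q, (q < p → wd B q < wd B p) ∧ (p < q → wd B p < wd B q) := by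
    rintro A B rfl q
    exact ⟨fun h => lt_of_wd_append_lt A B h ((hlt q).1 h),
      fun h => lt_of_wd_append_lt A B h ((hlt q).2 h)⟩
  have hfix : ∀ A B, I = A ++ B → wd B p = p := fun A B hAB => by
    refine apply_eq_of_forall_lt_iff (z' := 1) fun q => ?_
    rw [Perm.one_apply, Perm.one_apply]
    refine ⟨fun h => ?_, (hlt' A B hAB q).1⟩
    by_contra hc
    rcases (not_lt.1 hc).lt_or_eq with hc | rfl
    · exact h.asymm ((hlt' A B hAB q).2 hc)
    · exact h.false
  refine fun A B hAB => ⟨hfix A B hAB, fun e he hpe => ?_⟩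
  obtain ⟨A', B', rfl⟩ := List.append_of_mem he
  have h1 : I = (A ++ A') ++ e :: B' := by simp [hAB]
  have h2 := hfix _ _ h1
  -- A letter containing `p` would sort it against another position carrying one of its values, and
  -- so create an inversion at `p`.
  obtain ⟨v, hv, hvp⟩ : ∃ v ∈ block e, v ≠ p := by
    by_contra hc
    push Not at hc
    exact e.2.ne ((hc _ (left_mem_block e)).trans (hc _ (right_mem_block e)).symm)
  set y := wd (e :: B') with hy
  have hvy : y (y⁻¹ v) ∈ block e := by rwa [apply_inv_apply]
  have hpy : y p ∈ block e := by rwa [h2]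
  have hne : y⁻¹ v ≠ p := fun h => hvp (by rw [← apply_inv_apply y v, h, h2])
  rcases lt_or_gt_of_ne hne with h | h
  · exact (wd_cons_lt hvy hpy h).asymm ((hlt' _ _ h1 _).1 h)
  · exact (wd_cons_lt hpy hvy h).asymm ((hlt' _ _ h1 _).2 h)

/-! ## Appending a letter to a minimal monotone word -/

/-- What is needed about the product `y` of a suffix starting with `D` of a word with product `x`
which is split at `C`. -/
structure SuffixContext (x y : Perm (Fin (n + 1))) (C D : PosInterval n) : Prop where
  split : Split x C
  inv : ∀ p q, p < q → y q < y p → x q < x p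
  right : RTouched x y C ∨ ∀ p ∈ block C, ¬ RightDirected x C p → y p = p ∧ p ∉ block D
  left : LTouched x y C ∨ ∀ p ∈ block C, ¬ LeftDirected x C p → y p = p ∧ p ∉ block D
  mid : ∀ p ∈ block C, LeftDirected x C p → RightDirected x C p → y p = p ∧ p ∉ block D

namespace SuffixContext

variable {x y : Perm (Fin (n + 1))} {C D : PosInterval n}

theorem flip (h : SuffixContext x y C D) :
    SuffixContext (flip x) (flip y) (flipI C) (flipI D) where
  split := h.split.flip
  inv p q hpq hlt := by
    rw [flip_apply, flip_apply, Fin.rev_lt_rev] at hlt ⊢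
    exact h.inv _ _ (Fin.rev_lt_rev.2 hpq) hlt
  right := by
    rw [rTouched_flip]
    refine h.left.imp_right fun h p hp hl => ?_
    rw [rightDirected_flip] at hl
    obtain ⟨h1, h2⟩ := h _ (mem_block_flipI.1 hp) hl
    rw [mem_block_flipI, flip_apply, h1, Fin.rev_rev]
    exact ⟨rfl, h2⟩
  left := by
    rw [lTouched_flip]
    refine h.right.imp_right fun h p hp hl => ?_
    rw [leftDirected_flip] at hl
    obtain ⟨h1, h2⟩ := h _ (mem_block_flipI.1 hp) hl
    rw [mem_block_flipI, flip_apply, h1, Fin.rev_rev]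
    exact ⟨rfl, h2⟩
  mid p hp hl hr := by
    rw [leftDirected_flip] at hl
    rw [rightDirected_flip] at hr
    obtain ⟨h1, h2⟩ := h.mid _ (mem_block_flipI.1 hp) hr hl
    rw [mem_block_flipI, flip_apply, h1, Fin.rev_rev]
    exact ⟨rfl, h2⟩

/-- A position of `C` that carries a value of `D` cannot be both fixed by `y` and outside `D`, so it
belongs to a part of `C` already touched by the suffix. -/
theorem touched (h : SuffixContext x y C D) {v : Fin (n + 1)} (hv : v ∈ block D)
    (hC : y⁻¹ v ∈ block C) : (RTouched x y C ∧ ¬ RightDirected x C (y⁻¹ v)) ∨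
      (LTouched x y C ∧ ¬ LeftDirected x C (y⁻¹ v)) := by
  have hbad : ¬ (y (y⁻¹ v) = y⁻¹ v ∧ y⁻¹ v ∉ block D) := by
    rintro ⟨h1, h2⟩
    rw [apply_inv_apply] at h1
    exact h2 (h1 ▸ hv)
  by_cases hR : RightDirected x C (y⁻¹ v)
  · by_cases hL : LeftDirected x C (y⁻¹ v)
    · exact absurd (h.mid _ hC hL hR) hbad
    · exact Or.inr ⟨h.left.resolve_right fun h => hbad (h _ hC hL), hL⟩
  · exact Or.inl ⟨h.right.resolve_right fun h => hbad (h _ hC hR), hR⟩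

/-- A smaller value can be moved past the first value of `D` only if both stand in `C`. If the right
part is touched, some still smaller value stands beyond `C`, against left-directedness in `y`. If
the left part is touched, both positions belong to it and are already inverted. -/
theorem leftDirected_left (h : SuffixContext x y C D) (hm : IsMonotoneInterval y⁻¹ D) :
    LeftDirected (srt y C)⁻¹ D D.1.1 := by
  intro u hu
  have hlt := hm.1.2.1 u hu
  by_cases hC : y⁻¹ u ∈ block C ∧ y⁻¹ D.1.1 ∈ block C
  · exfalso
    obtain ⟨hCu, hC⟩ := hC
    rcases h.touched (left_mem_block D) hC with ⟨h1, h2⟩ | ⟨h1, h2⟩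
    · obtain ⟨⟨q, hq, hqy⟩, -⟩ := h1 _ hC h2
      rw [apply_inv_apply] at hqy
      have := hm.1.2.1 _ hqy
      rw [inv_apply_apply] at this
      exact (this.trans_le hC.2).asymm hq
    · obtain ⟨-, h3⟩ := h1 _ hC h2
      have := h3 _ hCu hlt fun hL => h2 (h.split.leftDirected_of_lt hCu hC hlt hL)
      rw [apply_inv_apply, apply_inv_apply] at this
      exact this.asymm hu
  · exact (srt_inv_lt_iff y hC).2 hlt

theorem rightDirected_right (h : SuffixContext x y C D) (hm : IsMonotoneInterval y⁻¹ D) :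
    RightDirected (srt y C)⁻¹ D D.1.2 := by
  have hm' := isMonotoneInterval_flip hm
  rw [← flip_inv] at hm'
  have := h.flip.leftDirected_left hm'
  rw [srt_flip, flip_inv, leftDirected_flip, flipI_left, Fin.rev_rev] at this
  exact this

theorem rightDirected_of_rTouched (h : SuffixContext x y C D) (hm : IsMonotoneInterval y⁻¹ D)
    {v : Fin (n + 1)} (hv : v ∈ block D) (hC : y⁻¹ v ∈ block C) (ht : RTouched x y C)
    (hR : ¬ RightDirected x C (y⁻¹ v)) : RightDirected (srt y C)⁻¹ D v := by
  have hL : LeftDirected x C (y⁻¹ v) := (h.split.directed _ hC).resolve_right hR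
  -- A larger value standing before `v` is an inversion of `x` too. Since the position of `v` is
  -- left-directed, that value stands in the right part of `C`, where being touched fixes the order.
  have hinv : ∀ u, v < u → y⁻¹ u < y⁻¹ v → y⁻¹ u ∈ block C ∧ ¬ RightDirected x C (y⁻¹ u) := by
    intro u hu hlt
    have hx := h.inv _ _ hlt (by rwa [apply_inv_apply, apply_inv_apply])
    have hmem : y⁻¹ u ∈ block C := by
      refine ⟨?_, hlt.le.trans hC.2⟩
      by_contra hc
      exact (hL _ (not_le.1 hc)).asymm hx
    refine ⟨hmem, ?_⟩
    rcases h.split.inversion _ hmem _ hC hlt hx with h1 | h1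
    · exact h1.1
    · exact absurd hL h1.2
  intro u hu
  have hvu : v < u := hv.2.trans_lt hu
  have hlt : y⁻¹ v < y⁻¹ u := by
    by_contra hc
    have hc : y⁻¹ u < y⁻¹ v := lt_of_le_of_ne (not_lt.1 hc) fun h => hvu.ne' (y⁻¹.injective h)
    have hd := hm.1.2.2 u hu
    rcases hv.2.lt_or_eq with hvd | hvd
    · obtain ⟨m1, m2⟩ := hinv _ hvu hc
      obtain ⟨m3, m4⟩ := hinv _ hvd (hd.trans hc)
      have := (ht _ m3 m4).2 _ m1 hd m2
      rw [apply_inv_apply, apply_inv_apply] at this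
      exact this.asymm hu
    · rw [← hvd] at hd
      exact hd.asymm hc
  refine (srt_inv_lt_iff y ?_).2 hlt
  rintro ⟨-, hCu⟩
  have := (ht _ hC hR).2 _ hCu hlt fun hc => hR (h.split.rightDirected_of_lt hC hCu hlt hc)
  rw [apply_inv_apply, apply_inv_apply] at this
  exact this.asymm hvu

theorem isMonotoneInterval_srt (h : SuffixContext x y C D) (hm : IsMonotoneInterval y⁻¹ D) :
    IsMonotoneInterval (srt y C)⁻¹ D := by
  refine ⟨⟨fun u hu v hv huv => srt_inv_lt_of_lt y C huv (hm.1.1 hu hv huv),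
    h.leftDirected_left hm, h.rightDirected_right hm⟩, fun v h1 h2 => ?_⟩
  have hv : v ∈ block D := ⟨h1, h2⟩
  by_cases hC : y⁻¹ v ∈ block C
  · rcases h.touched hv hC with ⟨h1, h2⟩ | ⟨h1, h2⟩
    · exact Or.inr (h.rightDirected_of_rTouched hm hv hC h1 h2)
    · left
      have hm' := isMonotoneInterval_flip hm
      rw [← flip_inv] at hm'
      have hv' : (SymmFactorization.flip y)⁻¹ v.rev = (y⁻¹ v).rev := by
        rw [flip_inv, flip_apply, Fin.rev_rev]
      have := h.flip.rightDirected_of_rTouched hm' (rev_mem_block_flipI.2 hv)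
        (by rw [hv']; exact rev_mem_block_flipI.2 hC) (rTouched_flip.2 h1)
        (by rwa [rightDirected_flip, hv', Fin.rev_rev])
      rwa [srt_flip, flip_inv, rightDirected_flip, Fin.rev_rev] at this
  · refine (hm.2 v h1 h2).imp (fun hL u hu => ?_) fun hR u hu => ?_
    · exact (srt_inv_lt_iff y fun hc => hC hc.2).2 (hL u hu)
    · exact (srt_inv_lt_iff y fun hc => hC hc.1).2 (hR u hu)

end SuffixContext

theorem snoc_eq_append_cons {α : Type*} {I A B : List α} {C e : α}
    (h : I ++ [C] = A ++ e :: B) :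
    (A = I ∧ e = C ∧ B = []) ∨ ∃ B', B = B' ++ [C] ∧ I = A ++ e :: B' := by
  rcases append_cons_eq_append_cons h with ⟨X, h1, h2⟩ | ⟨rfl, rfl, rfl⟩ | ⟨X, h1, h2⟩
  · exact Or.inr ⟨X, h2, h1⟩
  · exact Or.inl ⟨rfl, rfl, rfl⟩
  · simp at h2

theorem isMonotoneInterval_srt_one (C : PosInterval n) :
    IsMonotoneInterval (srt 1 C) C := by
  have hv : ∀ p ∈ block C, srt 1 C p ∈ block C := fun p hp => by
    have := inv_srt_apply_mem (x := 1) hp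
    simpa using this
  have hL : ∀ p ∈ block C, LeftDirected (srt 1 C) C p := fun p hp q hq => by
    rw [srt_of_notMem 1 fun h => h.1.not_gt hq]
    exact hq.trans_le (hv p hp).1
  have hR : ∀ p ∈ block C, RightDirected (srt 1 C) C p := fun p hp q hq => by
    rw [srt_of_notMem 1 fun h => h.2.not_gt hq]
    exact (hv p hp).2.trans_lt hq
  exact ⟨⟨srt_anti 1 C, hL _ (left_mem_block C), hR _ (right_mem_block C)⟩,
    fun p h1 h2 => Or.inl (hL p ⟨h1, h2⟩)⟩

theorem not_isDescentInterval_one (C : PosInterval n) :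
    ¬ IsDescentInterval (1 : Perm (Fin (n + 1))) C := fun h =>
  (h (left_mem_block C) (right_mem_block C) C.2).asymm C.2

theorem Good.suffixContext {I : List (PosInterval n)} {C : PosInterval n} (hI : Good I)
    (hs : Split (wd I) C) {A B : List (PosInterval n)} {D : PosInterval n}
    (hAB : I = A ++ D :: B) : SuffixContext (wd I) (wd (D :: B)) C D where
  split := hs
  inv p q hpq hlt := by rw [hAB]; exact wd_append_lt A _ hpq hlt
  right := by
    refine (touched_or_free hI.rmono hs hAB).imp_right fun h p hp hpR => ?_
    have h' : ∀ F ∈ D :: B, F.1.2 < p ∨ p < F.1.1 :=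
      fun F hF => (h p hp hpR F hF).imp_right hp.2.trans_lt
    refine ⟨(wd_apply_of_avoid le_rfl h').2.2 p le_rfl le_rfl, fun hD => ?_⟩
    rcases h' D List.mem_cons_self with h1 | h1
    · exact h1.not_ge hD.2
    · exact h1.not_ge hD.1
  left := by
    have hI' := hI.flip
    have hs' := hs.flip
    rw [← wd_flip] at hs'
    have := touched_or_free hI'.rmono hs' (A := A.map flipI) (B := (D :: B).map flipI)
      (by rw [hAB, List.map_append])
    rw [wd_flip, wd_flip, rTouched_flip] at this
    refine this.imp_right fun h p hp hpR => ?_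
    have h' : ∀ F ∈ D :: B, F.1.2 < p ∨ p < F.1.1 := fun F hF => by
      have := h p.rev (rev_mem_block_flipI.2 hp) (by rwa [rightDirected_flip, Fin.rev_rev])
        (flipI F) (List.mem_map_of_mem hF)
      simp only [flipI_right, flipI_left, Fin.rev_lt_rev] at this
      exact this.symm.imp_left fun h => h.trans_le hp.1
    refine ⟨(wd_apply_of_avoid le_rfl h').2.2 p le_rfl le_rfl, fun hD => ?_⟩
    rcases h' D List.mem_cons_self with h1 | h1
    · exact h1.not_ge hD.2
    · exact h1.not_ge hD.1
  mid p hp hL hR := by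
    obtain ⟨h1, h2⟩ := notMem_of_directed hs hp hL hR A (D :: B) hAB
    exact ⟨h1, h2 D List.mem_cons_self⟩

/-- If `u < v` in `D` lie at right positions of `C`, not inverted in `y`, then sorting the positions
of `C` does not make `D` a left descent interval. -/
theorem not_isDescentInterval_srt_right {x y : Perm (Fin (n + 1))} {C D : PosInterval n}
    (h : RTouched x y C ∨ (∀ p ∈ block C, ¬ RightDirected x C p → y p = p) ∧
        ((∀ p ∈ block C, ¬ RightDirected x C p → p ∉ block D) ∨
          (C.1.2 < D.1.2 ∧ C.1.2 ∈ block D ∧ y C.1.2 = C.1.2 ∧ C.1.2 < y⁻¹ D.1.2)))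
    {p q : Fin (n + 1)} (hp : p ∈ block C) (hq : q ∈ block C) (hpq : p < q)
    (hpR : ¬ RightDirected x C p) (hqR : ¬ RightDirected x C q) (hyp : y p ∈ block D)
    (hlt : y p < y q) : ¬ IsDescentInterval (srt y C)⁻¹ D := by
  intro hd
  rcases h with h | ⟨h1, h2 | ⟨h2, h3, h4, h5⟩⟩
  · exact ((h p hp hpR).2 q hq hpq hqR).asymm hlt
  · exact h2 p hp hpR (h1 p hp hpR ▸ hyp)
  · have h6 := hd h3 (right_mem_block D) h2
    have h7 : y⁻¹ C.1.2 = C.1.2 := by rw [Perm.inv_eq_iff_eq, h4]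
    rw [srt_inv_lt_iff y (fun hc => hc.1.2.not_gt h5), h7] at h6
    exact h6.asymm h5

/-- Right-hand conditions for the new letter are immediate from splitness. Left-hand conditions for
the old letters hold because sorting `C` affects a suffix only where `C` is not directed on both
sides, and there each suffix has either all of the relevant inversions or no contact at all. -/
theorem Good.snoc {I : List (PosInterval n)} {C : PosInterval n} (hI : Good I)
    (hs : Split (wd I) C) : Good (I ++ [C]) where
  rmono A e B h₀ := by
    rcases snoc_eq_append_cons h₀ with ⟨rfl, rfl, rfl⟩ | ⟨B', rfl, h⟩
    · rw [wd_snoc]; exact hs.mono_srt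
    · exact hI.rmono A e B' h
  rreduced A e B h₀ := by
    rcases snoc_eq_append_cons h₀ with ⟨rfl, rfl, rfl⟩ | ⟨B', rfl, h⟩
    · exact hs.not_isDescentInterval
    · exact hI.rreduced A e B' h
  lmono A e B h₀ := by
    rcases snoc_eq_append_cons h₀ with ⟨rfl, rfl, rfl⟩ | ⟨B', rfl, h⟩
    · have : wd [e] = srt 1 e := rfl
      rw [this, srt_one_inv]
      exact isMonotoneInterval_srt_one e
    · rw [← List.cons_append, wd_snoc]
      exact (hI.suffixContext hs h).isMonotoneInterval_srt (hI.lmono A e B' h)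
  lreduced A D B h₀ := by
    rcases snoc_eq_append_cons h₀ with ⟨rfl, rfl, rfl⟩ | ⟨B, rfl, h⟩
    · rw [wd_nil, inv_one]; exact not_isDescentInterval_one D
    intro hd
    rw [wd_snoc] at hd
    -- If `D` becomes a left-contraction only through `C`, sorting `C` inverts two values of `D`
    -- that stand in order in `wd B`. Prepending `D` also inverts their positions, so they form an
    -- inversion of `wd I` inside `C`, and splitness puts both in the right part or both in the left
    -- part.
    refine hI.lreduced A D B h fun u hu v hv huv => ?_
    by_contra hc
    have hlt : (wd B)⁻¹ u < (wd B)⁻¹ v :=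
      lt_of_le_of_ne (not_lt.1 hc) fun h => huv.ne ((wd B)⁻¹.injective h)
    obtain ⟨hCu, hCv⟩ : (wd B)⁻¹ u ∈ block C ∧ (wd B)⁻¹ v ∈ block C := by
      by_contra hn
      exact ((srt_inv_lt_iff (wd B) hn).2 hlt).asymm (hd hu hv huv)
    have hyu : wd (D :: B) ((wd B)⁻¹ u) ∈ block D := by rwa [wd_cons_mem_iff, apply_inv_apply]
    have hyv : wd (D :: B) ((wd B)⁻¹ v) ∈ block D := by rwa [wd_cons_mem_iff, apply_inv_apply]
    have hx : wd I ((wd B)⁻¹ v) < wd I ((wd B)⁻¹ u) := by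
      rw [h]; exact wd_append_lt A _ hlt (wd_cons_lt hyu hyv hlt)
    have hu' : wd B ((wd B)⁻¹ u) ∈ block D := by rwa [apply_inv_apply]
    have hv' : wd B ((wd B)⁻¹ v) ∈ block D := by rwa [apply_inv_apply]
    have huv' : wd B ((wd B)⁻¹ u) < wd B ((wd B)⁻¹ v) := by rwa [apply_inv_apply, apply_inv_apply]
    rcases hs.inversion _ hCu _ hCv hlt hx with ⟨h1, h2⟩ | ⟨h1, h2⟩
    · exact not_isDescentInterval_srt_right (touched_or_free_cons hI.rmono hs h) hCu hCv hlt h1 h2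
        hu' huv' hd
    · have hs' := hs.flip
      rw [← wd_flip] at hs'
      have hfree := touched_or_free_cons hI.flip.rmono hs' (A := A.map flipI) (e := flipI D)
        (B := B.map flipI) (by rw [h, List.map_append, List.map_cons])
      rw [wd_flip, wd_flip] at hfree
      refine not_isDescentInterval_srt_right hfree (rev_mem_block_flipI.2 hCv)
        (rev_mem_block_flipI.2 hCu) (Fin.rev_lt_rev.2 hlt) (by rwa [rightDirected_flip, Fin.rev_rev])
        (by rwa [rightDirected_flip, Fin.rev_rev]) ?_ ?_ (by
          rw [srt_flip, flip_inv]; exact isDescentInterval_flip hd)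
      · rw [flip_apply, rev_mem_block_flipI, Fin.rev_rev]; exact hv'
      · rw [flip_apply, flip_apply, Fin.rev_lt_rev, Fin.rev_rev, Fin.rev_rev]; exact huv'

/-! ## Removing the last letter of a minimal monotone word -/

/-- Undoing the sort only removes inversions, and directedness of values is the absence of
inversions. -/
theorem isMonotoneInterval_of_srt {y : Perm (Fin (n + 1))} {C D : PosInterval n}
    (hd : IsDescentInterval y⁻¹ D) (hm : IsMonotoneInterval (srt y C)⁻¹ D) :
    IsMonotoneInterval y⁻¹ D := by
  have hlt : ∀ u v, u < v → (srt y C)⁻¹ u < (srt y C)⁻¹ v → y⁻¹ u < y⁻¹ v := fun u v huv h => by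
    by_contra hc
    have hc : y⁻¹ v < y⁻¹ u :=
      lt_of_le_of_ne (not_lt.1 hc) fun h => huv.ne' (y⁻¹.injective h)
    exact h.asymm (srt_inv_lt_of_lt y C huv hc)
  refine ⟨⟨hd, fun u hu => hlt _ _ hu (hm.1.2.1 u hu), fun u hu => hlt _ _ hu (hm.1.2.2 u hu)⟩,
    fun v h1 h2 => (hm.2 v h1 h2).imp (fun h u hu => ?_) fun h u hu => ?_⟩
  · exact hlt _ _ (hu.trans_le h1) (h u hu)
  · exact hlt _ _ (h2.trans_lt hu) (h u hu)

theorem isDescentInterval_wd_cons_inv (D : PosInterval n) (B : List (PosInterval n)) :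
    IsDescentInterval (wd (D :: B))⁻¹ D := by
  rw [wd_cons, lsrt, inv_inv]
  exact srt_anti _ _

theorem Good.of_snoc {I : List (PosInterval n)} {C : PosInterval n} (h : Good (I ++ [C])) :
    Good I where
  rmono := h.rmono.of_append
  rreduced := h.rreduced.of_append
  lmono A D B hI := by
    have := h.lmono A D (B ++ [C]) (by rw [hI]; simp)
    rw [← List.cons_append, wd_snoc] at this
    exact isMonotoneInterval_of_srt (isDescentInterval_wd_cons_inv D B) this
  lreduced A D B hI hd := by
    refine h.lreduced A D (B ++ [C]) (by rw [hI]; simp) fun u hu v hv huv => ?_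
    rw [wd_snoc]
    exact srt_inv_lt_of_lt _ C huv (hd hu hv huv)

theorem srt_one_mem {C : PosInterval n} {p : Fin (n + 1)} (hp : p ∈ block C) :
    srt 1 C p ∈ block C := by
  simpa using inv_srt_apply_mem (x := 1) hp

theorem srt_one_srt_one (C : PosInterval n) (p : Fin (n + 1)) : srt 1 C (srt 1 C p) = p := by
  nth_rw 1 [← srt_one_inv]
  exact inv_apply_apply _ _

theorem srt_one_of_notMem {C : PosInterval n} {p : Fin (n + 1)} (hp : p ∉ block C) :
    srt 1 C p = p := srt_of_notMem 1 hp

/-- The letters before `C` act on the values of `srt 1 C`, and those avoiding `[a, b]` permute the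
values on its two sides separately. -/
theorem wd_snoc_of_avoid {a b : Fin (n + 1)} (hab : a ≤ b) {B : List (PosInterval n)}
    (hB : ∀ F ∈ B, F.1.2 < a ∨ b < F.1.1) (C : PosInterval n) :
    ∃ u : Perm (Fin (n + 1)), wd (B ++ [C]) = u * srt 1 C ∧ (∀ r, u r < a ↔ r < a) ∧
      (∀ r, b < u r ↔ b < r) ∧ ∀ r, a ≤ r → r ≤ b → u r = r := by
  obtain ⟨u, hu, h1, h2, h3⟩ := exists_foldl_srt_eq_mul hab (B := B.reverse)
    (fun F hF => hB F (List.mem_reverse.1 hF)) (srt 1 C)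
  have : wd (B ++ [C]) = u⁻¹ * srt 1 C := by
    rw [← inv_inj, ← wd_reverse, List.reverse_append, List.reverse_singleton, wd_append,
      mul_inv_rev, inv_inv, srt_one_inv, ← hu]
    rfl
  refine ⟨u⁻¹, this, fun r => ?_, fun r => ?_, fun r h4 h5 => ?_⟩
  · rw [← h1 (u⁻¹ r), apply_inv_apply]
  · rw [← h2 (u⁻¹ r), apply_inv_apply]
  · rw [Perm.inv_eq_iff_eq, h3 r h4 h5]

theorem wd_snoc_anti (B : List (PosInterval n)) (C : PosInterval n) :
    StrictAntiOn (wd (B ++ [C])) (block C) := by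
  rw [wd_snoc]; exact srt_anti _ _

theorem leftDirected_of_suffix {A B : List (PosInterval n)} {C : PosInterval n}
    {p : Fin (n + 1)} (hp : p ∈ block C) (h : LeftDirected (wd (A ++ B)) C p) :
    LeftDirected (wd B) C p :=
  fun q hq => lt_of_wd_append_lt A B (hq.trans_le hp.1) (h q hq)

theorem rightDirected_of_suffix {A B : List (PosInterval n)} {C : PosInterval n}
    {p : Fin (n + 1)} (hp : p ∈ block C) (h : RightDirected (wd (A ++ B)) C p) :
    RightDirected (wd B) C p :=
  fun q hq => lt_of_wd_append_lt A B (hp.2.trans_lt hq) (h q hq)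

/-- If `B ++ [C]` has its values in `D` at positions of `C`, then `D` is a left-contraction. -/
theorem isDescentInterval_of_mem_block {B : List (PosInterval n)} {C D : PosInterval n}
    (h : ∀ q, wd (B ++ [C]) q ∈ block D → q ∈ block C) :
    IsDescentInterval (wd (B ++ [C]))⁻¹ D := by
  have hm : ∀ u ∈ block D, (wd (B ++ [C]))⁻¹ u ∈ block C := fun u hu =>
    h _ (by rwa [apply_inv_apply])
  intro u hu v hv huv
  rw [← (wd_snoc_anti B C).lt_iff_gt (hm u hu) (hm v hv), apply_inv_apply, apply_inv_apply]
  exact huv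

/-- The counterpart of `RightStructure.of_split` without splitness: `l` is the mirror image in `C`
of the last position `t` that is not right-directed after sorting. Left-reducedness and
left-monotonicity locate the last letter containing `l`, and right-reducedness keeps the later
letters away from `[l, b]`. -/
theorem Good.rightStructure_of_snoc {I : List (PosInterval n)} {C : PosInterval n}
    (h : Good (I ++ [C])) {t : Fin (n + 1)} (ht : t ∈ block C)
    (htR : ¬ RightDirected (wd (I ++ [C])) C t)
    (hmax : ∀ p ∈ block C, t < p → RightDirected (wd (I ++ [C])) C p) :
    RightStructure I C (srt 1 C t) ∧
      StrictAntiOn (wd I) (Set.Icc (srt 1 C t) C.1.2) := by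
  have hw : IsMonotoneInterval (wd (I ++ [C])) C := h.rmono I C [] rfl
  have hwa := wd_snoc_anti I C
  have hLt : ∀ p ∈ block C, p ≤ t → LeftDirected (wd (I ++ [C])) C p := fun p hp hpt =>
    ((hw.2 t ht.1 ht.2).resolve_right htR).mono (hwa.antitoneOn hp ht hpt)
  set l := srt 1 C t with hl
  have hlC : l ∈ block C := srt_one_mem ht
  have hza := srt_anti 1 C
  have hzt : ∀ q, q ≠ t → srt 1 C q < l → q < C.1.1 ∨ (q ∈ block C ∧ t < q) := by
    intro q hqt hq
    by_cases hqC : q ∈ block C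
    · exact Or.inr ⟨hqC, (hza.lt_iff_gt hqC ht).1 hq⟩
    · left
      rw [srt_one_of_notMem hqC] at hq
      by_contra hc
      exact hqC ⟨not_lt.1 hc, hq.le.trans hlC.2⟩
  have hex : ∃ F ∈ I, ¬ (F.1.2 < l ∨ l < F.1.1) := by
    by_contra hc
    push Not at hc
    obtain ⟨u, hu, -, h2, h3⟩ := wd_snoc_of_avoid le_rfl hc C
    refine htR fun q hq => ?_
    rw [hu, Perm.mul_apply, Perm.mul_apply, ← hl, h3 l le_rfl le_rfl, h2,
      srt_one_of_notMem fun hm => hm.2.not_gt hq]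
    exact hlC.2.trans_lt hq
  obtain ⟨A, D, B, rfl, hD, hB⟩ := exists_last hex
  simp only [not_not] at hB
  simp only [not_or, not_lt] at hD
  obtain ⟨hD2, hD1⟩ := hD
  have hlD : l ∈ block D := ⟨hD1, hD2⟩
  obtain ⟨u, hu, u1, u2, u3⟩ := wd_snoc_of_avoid le_rfl hB C
  have hz't : wd (B ++ [C]) t = l := by
    rw [hu, Perm.mul_apply, ← hl, u3 l le_rfl le_rfl]
  have hsplit : ∀ X Y, B = X ++ Y → (A ++ D :: B) ++ [C] = (A ++ D :: X) ++ (Y ++ [C]) := by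
    rintro X Y rfl; simp
  have hsplitD : (A ++ D :: B) ++ [C] = A ++ (D :: B ++ [C]) := by simp
  have hzD : ∀ q, wd (D :: B ++ [C]) q ∈ block D ↔ wd (B ++ [C]) q ∈ block D := fun q => by
    rw [List.cons_append, wd_cons_mem_iff]
  have htD : wd (D :: B ++ [C]) t ∈ block D := by rw [hzD, hz't]; exact hlD
  have hsort : ∀ p q, wd (D :: B ++ [C]) p ∈ block D → wd (D :: B ++ [C]) q ∈ block D →
      p < q → wd (D :: B ++ [C]) q < wd (D :: B ++ [C]) p := fun p q hp hq hpq => wd_cons_lt hp hq hpq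
  -- the positions of the values in `D`
  have hD_left : ∀ q, wd (D :: B ++ [C]) q ∈ block D → C.1.1 ≤ q := by
    intro q hq
    by_contra hc
    have hc := not_le.1 hc
    have h1 := hLt t ht le_rfl
    rw [hsplitD] at h1
    exact (leftDirected_of_suffix ht h1 q hc).asymm (hsort q t hq htD (hc.trans_le ht.1))
  -- If all values of `D` stood at positions of `C`, the letter `C` would already sort them and `D`
  -- would be a left-contraction.
  obtain ⟨r, hrC, hrD⟩ : ∃ r, C.1.2 < r ∧ wd (D :: B ++ [C]) r ∈ block D := by
    by_contra hc
    push Not at hc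
    refine h.lreduced A D (B ++ [C]) (by simp) (isDescentInterval_of_mem_block fun q hq => ?_)
    rw [← hzD] at hq
    refine ⟨hD_left q hq, ?_⟩
    by_contra hn
    exact hc q (not_le.1 hn) hq
  -- Such a position is right-directed, whereas `D` puts a smaller value at `r`, beyond `C`.
  have hD_mid : ∀ p ∈ block C, t < p → wd (D :: B ++ [C]) p ∉ block D := by
    intro p hp htp hpD
    have h1 := hmax p hp htp
    rw [hsplitD] at h1
    exact (rightDirected_of_suffix hp h1 r hrC).asymm (hsort p r hpD hrD (hp.2.trans_lt hrC))
  -- If `D` started below `l`, its first value would stand before `C` or in `C` after `t`; no value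
  -- of `D` stands at either place.
  have hDl : D.1.1 = l := by
    refine le_antisymm hD1 (not_lt.1 fun hc => ?_)
    set q := (wd (B ++ [C]))⁻¹ D.1.1 with hq
    have hqv : wd (B ++ [C]) q = D.1.1 := apply_inv_apply _ _
    have hqD : wd (D :: B ++ [C]) q ∈ block D := by
      rw [hzD, hqv]; exact left_mem_block D
    have hqt : q ≠ t := by
      rintro h
      rw [h, hz't] at hqv
      exact hc.ne' hqv
    rw [hu, Perm.mul_apply] at hqv
    rw [← hqv, u1] at hc
    rcases hzt q hqt hc with h1 | ⟨h1, h2⟩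
    · exact (hD_left q hqD).not_gt h1
    · exact hD_mid q h1 h2 hqD
  -- the value at the first position of `C`
  set e := wd (B ++ [C]) C.1.1 with he
  have hle : l ≤ e := by
    rw [← hz't]
    exact (wd_snoc_anti B C).antitoneOn (left_mem_block C) ht ht.1
  have hmono := h.lmono A D (B ++ [C]) (by simp)
  rw [← List.cons_append] at hmono
  -- If `e` lay beyond `D`, it would stay at the first position of `C`, and left-monotonicity would
  -- put the last value of `D` before `C`.
  have hed : e ≤ D.1.2 := by
    by_contra hc
    have hc := not_le.1 hc
    have heD : e ∉ block D := fun h => h.2.not_gt hc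
    have hza' : wd (D :: B ++ [C]) C.1.1 = e := wd_cons_of_notMem heD
    set s := (wd (D :: B ++ [C]))⁻¹ D.1.2 with hs
    have hsv : wd (D :: B ++ [C]) s = D.1.2 := apply_inv_apply _ _
    have hs1 := hmono.1.2.2 e hc
    rw [← hs, ← hza', inv_apply_apply] at hs1
    exact (hD_left s (by rw [hsv]; exact right_mem_block D)).not_gt hs1
  have hanti : StrictAntiOn (wd (A ++ [D])) (Set.Icc l e) := by
    refine (h.rmono A D (B ++ [C]) (by simp)).1.1.mono ?_
    rw [hDl]
    exact Set.Icc_subset_Icc le_rfl hed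
  have hantiX : ∀ X, (∀ F ∈ X, F.1.2 < l ∨ e < F.1.1) →
      StrictAntiOn (wd (A ++ D :: X)) (Set.Icc l e) := by
    intro X hX
    obtain ⟨v, hv, -, -, hv3⟩ := exists_foldl_srt_eq_mul hle hX (wd (A ++ [D]))
    rw [← wd_append, List.append_assoc, List.singleton_append] at hv
    refine hanti.congr fun p hp => ?_
    rw [hv, Perm.mul_apply, hv3 p hp.1 hp.2]
  -- Go through `B` from the left. A letter meeting `[l, e]` would lie inside it, where the prefix
  -- product still decreases, and so be a right-contraction. Hence the value `e` at the first
  -- position of `C` survives until only `C` is left, which gives `e = b`.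
  have hwalk : ∀ X Y, B = X ++ Y →
      (∀ F ∈ X, F.1.2 < l ∨ e < F.1.1) ∧ wd (Y ++ [C]) C.1.1 = e := by
    intro X
    induction X using List.reverseRecOn with
    | nil => rintro Y rfl; exact ⟨by simp, rfl⟩
    | append_singleton X F ih =>
      intro Y hXY
      obtain ⟨h1, h2⟩ := ih (F :: Y) (by simp [hXY])
      have hF : F.1.2 < l ∨ e < F.1.1 := by
        refine or_iff_not_imp_left.2 fun hFl => not_le.1 fun hFe => ?_
        have hFl' := (hB F (by simp [hXY])).resolve_left hFl
        have hFr : F.1.2 ≤ e := by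
          by_contra hc
          have hc := not_le.1 hc
          set s := (wd (F :: Y ++ [C]))⁻¹ F.1.2 with hs
          have hsv : wd (F :: Y ++ [C]) s = F.1.2 := apply_inv_apply _ _
          have hsF : wd (F :: Y ++ [C]) s ∈ block F := hsv ▸ right_mem_block F
          have haF : wd (F :: Y ++ [C]) C.1.1 ∈ block F := by rw [h2]; exact ⟨hFe, hc.le⟩
          rcases lt_trichotomy s C.1.1 with h3 | h3 | h3
          · have h4 := hLt C.1.1 (left_mem_block C) ht.1
            rw [hsplit X (F :: Y) (by simp [hXY])] at h4
            have := leftDirected_of_suffix (left_mem_block C) h4 s h3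
            rw [hsv, h2] at this
            exact this.asymm hc
          · rw [h3, h2] at hsv
            exact hc.ne hsv
          · have := wd_cons_lt (B := Y ++ [C]) haF hsF h3
            rw [← List.cons_append, hsv, h2] at this
            exact this.asymm hc
        refine h.rreduced (A ++ D :: X) F (Y ++ [C]) (by simp [hXY]) ?_
        exact (hantiX X h1).mono (Set.Icc_subset_Icc hFl'.le hFr)
      refine ⟨fun G hG => ?_, ?_⟩
      · rcases List.mem_append.1 hG with hG | hG
        · exact h1 G hG
        · rw [List.mem_singleton.1 hG]; exact hF
      · have heF : e ∉ block F := by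
          rintro ⟨h3, h4⟩
          rcases hF with hF | hF
          · exact (hF.trans_le hle).not_ge h4
          · exact hF.not_ge h3
        have h3 : wd (Y ++ [C]) C.1.1 ∉ block F := by
          rw [← wd_cons_mem_iff, ← List.cons_append, h2]; exact heF
        rw [← wd_cons_of_notMem h3, ← List.cons_append, h2]
  obtain ⟨hBe, heC⟩ := hwalk B [] (by simp)
  have heb : e = C.1.2 := by
    rw [List.nil_append] at heC
    have h1 : srt 1 C C.1.1 = e := heC
    have h2 : srt 1 C (srt 1 C C.1.2) ≤ srt 1 C C.1.1 :=
      hza.antitoneOn (left_mem_block C) (srt_one_mem (right_mem_block C))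
        (srt_one_mem (right_mem_block C)).1
    rw [srt_one_srt_one, h1] at h2
    exact le_antisymm (h1 ▸ (srt_one_mem (left_mem_block C)).2) h2
  rw [heb] at hBe hantiX
  refine ⟨⟨A, D, B, rfl, hDl, ?_, hBe⟩, hantiX B hBe⟩
  obtain ⟨v, hv, -, hv2, -⟩ := wd_snoc_of_avoid hlC.2 hBe C
  rw [hzD] at hrD
  refine lt_of_lt_of_le ?_ hrD.2
  rw [hv, Perm.mul_apply, hv2, srt_one_of_notMem fun hm => hm.2.not_gt hrC]
  exact hrC

theorem rightDirected_srt_iff (x : Perm (Fin (n + 1))) (C : PosInterval n) (p : Fin (n + 1)) :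
    RightDirected (srt x C) C ((srt x C)⁻¹ (x p)) ↔ RightDirected x C p :=
  rightDirected_congr (fun _ => srt_of_notMem x) (apply_inv_apply _ _)

theorem leftDirected_srt_iff (x : Perm (Fin (n + 1))) (C : PosInterval n) (p : Fin (n + 1)) :
    LeftDirected (srt x C) C ((srt x C)⁻¹ (x p)) ↔ LeftDirected x C p :=
  leftDirected_congr (fun _ => srt_of_notMem x) (apply_inv_apply _ _)

section

variable {I : List (PosInterval n)} {C : PosInterval n}

/-- Positions from the mirror image of `t` onwards are not right-directed by the structure of the
word. There are no others, because sorting only rearranges the values in the block and so keeps the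
number of positions that are not right-directed. -/
theorem Good.right_of_snoc (h : Good (I ++ [C])) :
    (∀ p ∈ block C, RightDirected (wd I) C p ↔
      RightDirected (wd (I ++ [C])) C (srt 1 C p)) ∧
    ∀ p ∈ block C, ∀ q ∈ block C, p < q → ¬ RightDirected (wd I) C p →
      ¬ RightDirected (wd I) C q → wd I q < wd I p := by
  have hw : wd (I ++ [C]) = srt (wd I) C := wd_snoc I C
  by_cases hex : ∃ t ∈ block C, ¬ RightDirected (wd (I ++ [C])) C t
  · obtain ⟨t, ⟨ht, htR⟩, hmin⟩ := WellFounded.has_min (wellFounded_gt (α := Fin (n + 1)))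
      {p | p ∈ block C ∧ ¬ RightDirected (wd (I ++ [C])) C p} hex
    have hmax : ∀ p ∈ block C, t < p → RightDirected (wd (I ++ [C])) C p := fun p hp htp => by
      by_contra hc
      exact hmin p ⟨hp, hc⟩ htp
    have hle : ∀ q ∈ block C, ¬ RightDirected (wd (I ++ [C])) C q ↔ q ≤ t := fun q hq =>
      ⟨fun hR => not_lt.1 fun hc => hR (hmax q hq hc), fun hqt hR =>
        htR (hR.mono ((wd_snoc_anti I C).antitoneOn hq ht hqt))⟩
    have hlt : ∀ q ∈ block C, q ≤ t ↔ srt 1 C t ≤ srt 1 C q := fun q hq =>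
      ((srt_anti 1 C).le_iff_ge ht hq).symm
    obtain ⟨⟨A, D, B, hI, hD, hCD, hB⟩, hanti⟩ := h.rightStructure_of_snoc ht htR hmax
    have hlC := srt_one_mem ht
    have hR : ∀ p ∈ block C, srt 1 C t ≤ p → ¬ RightDirected (wd I) C p := by
      intro p hp hlp hc
      obtain ⟨⟨q, h1, h2⟩, -⟩ := touched_of_letter A hlC.2 hD hCD hB hlp hp.2
      rw [← hI] at h2
      exact (hc q h1).asymm h2
    classical
    -- One inclusion is known. For the cardinality, send a position to the place of its value after
    -- sorting and reflect that place in `C`.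
    have hset : (Finset.univ.filter fun p => p ∈ block C ∧ srt 1 C t ≤ p) =
        Finset.univ.filter fun p => p ∈ block C ∧ ¬ RightDirected (wd I) C p := by
      refine Finset.eq_of_subset_of_card_le (fun p hp => ?_)
        (Finset.card_le_card_of_injOn (fun p => srt 1 C ((srt (wd I) C)⁻¹ (wd I p)))
          (fun p hp => ?_) fun p _ q _ hpq => ?_)
      · simp only [Finset.mem_filter, Finset.mem_univ, true_and] at hp ⊢
        exact ⟨hp.1, hR p hp.1 hp.2⟩
      · simp only [Finset.coe_filter, Finset.mem_univ, true_and, Set.mem_ofPred_eq] at hp ⊢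
        have hm := srt_inv_apply_mem (x := wd I) hp.1
        refine ⟨srt_one_mem hm, ?_⟩
        rw [← hlt _ hm, ← hle _ hm, hw, rightDirected_srt_iff]
        exact hp.2
      · exact (wd I).injective ((srt (wd I) C)⁻¹.injective ((srt 1 C).injective hpq))
    have hiff : ∀ p ∈ block C, ¬ RightDirected (wd I) C p ↔ srt 1 C t ≤ p := fun p hp => by
      have := Finset.ext_iff.1 hset p
      simp only [Finset.mem_filter, Finset.mem_univ, true_and, hp] at this
      exact this.symm
    refine ⟨fun p hp => ?_, fun p hp q hq hpq h1 h2 => ?_⟩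
    · rw [← not_iff_not, hiff p hp, hle _ (srt_one_mem hp), hlt _ (srt_one_mem hp),
        srt_one_srt_one]
    · exact hanti ⟨(hiff p hp).1 h1, hp.2⟩ ⟨(hiff q hq).1 h2, hq.2⟩ hpq
  · push Not at hex
    have hR : ∀ p ∈ block C, RightDirected (wd I) C p := fun p hp => by
      rw [← rightDirected_srt_iff, ← hw]
      exact hex _ (by rw [hw]; exact srt_inv_apply_mem hp)
    exact ⟨fun p hp => ⟨fun _ => hex _ (srt_one_mem hp), fun _ => hR p hp⟩,
      fun p hp q hq hpq h => absurd (hR p hp) h⟩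

theorem Good.left_of_snoc (h : Good (I ++ [C])) :
    (∀ p ∈ block C, LeftDirected (wd I) C p ↔
      LeftDirected (wd (I ++ [C])) C (srt 1 C p)) ∧
    ∀ p ∈ block C, ∀ q ∈ block C, p < q → ¬ LeftDirected (wd I) C p →
      ¬ LeftDirected (wd I) C q → wd I q < wd I p := by
  have h' := h.flip
  rw [List.map_append, List.map_singleton] at h'
  obtain ⟨h1, h2⟩ := h'.right_of_snoc
  have hI : wd (I.map flipI ++ [flipI C]) = SymmFactorization.flip (wd (I ++ [C])) := by
    rw [← wd_flip, List.map_append, List.map_singleton]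
  have hs : ∀ p, srt 1 (flipI C) p.rev = (srt 1 C p).rev := fun p => by
    have := srt_flip 1 C
    rw [flip_one] at this
    rw [this, flip_apply, Fin.rev_rev]
  refine ⟨fun p hp => ?_, fun p hp q hq hpq hpl hql => ?_⟩
  · have := h1 p.rev (rev_mem_block_flipI.2 hp)
    rwa [hI, hs, wd_flip, rightDirected_flip, rightDirected_flip, Fin.rev_rev,
      Fin.rev_rev] at this
  · have := h2 q.rev (rev_mem_block_flipI.2 hq) p.rev (rev_mem_block_flipI.2 hp)
      (Fin.rev_lt_rev.2 hpq) (by rwa [wd_flip, rightDirected_flip, Fin.rev_rev])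
      (by rwa [wd_flip, rightDirected_flip, Fin.rev_rev])
    rwa [wd_flip, flip_apply, flip_apply, Fin.rev_rev, Fin.rev_rev, Fin.rev_lt_rev] at this

theorem Good.notMem_of_directed_snoc (h : Good (I ++ [C])) {t : Fin (n + 1)} (ht : t ∈ block C)
    (hL : LeftDirected (wd (I ++ [C])) C t) (hR : RightDirected (wd (I ++ [C])) C t) :
    ∀ D ∈ I, srt 1 C t ∉ block D := by
  intro D hD hm
  obtain ⟨A, B, rfl⟩ := List.append_of_mem hD
  have hdir : ∀ X Y, A ++ D :: B = X ++ Y → LeftDirected (wd (Y ++ [C])) C t ∧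
      RightDirected (wd (Y ++ [C])) C t := fun X Y hXY => by
    rw [hXY, List.append_assoc] at hL hR
    exact ⟨leftDirected_of_suffix ht hL, rightDirected_of_suffix ht hR⟩
  -- Both products decrease on `C`, and `t` is directed on both sides for both, so the values at `t`
  -- have the same number of smaller values. If `D` contained this common value, its values would
  -- all stand in `C`, and `D` would be a left-contraction.
  have hval : ∀ X Y, A ++ D :: B = X ++ Y → wd (Y ++ [C]) t = srt 1 C t := fun X Y hXY => by
    refine apply_eq_of_forall_lt_iff fun q => ?_
    have h1 := hdir X Y hXY
    have h2 := isMonotoneInterval_srt_one C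
    by_cases hq : q ∈ block C
    · rw [(wd_snoc_anti Y C).lt_iff_gt hq ht, (srt_anti 1 C).lt_iff_gt hq ht]
    · have h3 := srt_one_mem ht
      rcases lt_or_ge q C.1.1 with hlt | hge
      · refine iff_of_true (h1.1 q hlt) ?_
        rw [srt_one_of_notMem hq]
        exact hlt.trans_le h3.1
      · have hgt : C.1.2 < q := by
          by_contra hc
          exact hq ⟨hge, not_lt.1 hc⟩
        refine iff_of_false (h1.2 q hgt).asymm ?_
        rw [srt_one_of_notMem hq]
        exact (h3.2.trans_lt hgt).asymm
  have h1 := hval A (D :: B) rfl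
  have h2 := hdir A (D :: B) rfl
  have htD : wd (D :: B ++ [C]) t ∈ block D := h1 ▸ hm
  refine h.lreduced A D (B ++ [C]) (by simp) (isDescentInterval_of_mem_block fun q hq => ?_)
  have hqD : wd (D :: B ++ [C]) q ∈ block D := by rwa [List.cons_append, wd_cons_mem_iff]
  constructor
  · by_contra hc
    have hc := not_le.1 hc
    exact (h2.1 q hc).asymm (wd_cons_lt hqD htD (hc.trans_le ht.1))
  · by_contra hc
    have hc := not_le.1 hc
    exact (h2.2 q hc).asymm (wd_cons_lt htD hqD (ht.2.trans_lt hc))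

/-- In a minimal monotone word, the product before the last letter is split at the last letter. -/
theorem Good.split_of_snoc (h : Good (I ++ [C])) : Split (wd I) C := by
  have hw : wd (I ++ [C]) = srt (wd I) C := wd_snoc I C
  have hm : IsMonotoneInterval (srt (wd I) C) C := hw ▸ h.rmono I C [] rfl
  obtain ⟨hR, hRa⟩ := h.right_of_snoc
  obtain ⟨hL, hLa⟩ := h.left_of_snoc
  refine ⟨fun p hp => ?_, fun p hp q hq hpq hlt => ?_, hRa, hLa, ?_, ?_⟩
  · rw [← leftDirected_srt_iff, ← rightDirected_srt_iff]
    have := srt_inv_apply_mem (x := wd I) hp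
    exact hm.2 _ this.1 this.2
  · by_contra hc
    have hz := srt_anti 1 C hp hq hpq
    have hz' := (wd_snoc_anti I C).antitoneOn (srt_one_mem hq) (srt_one_mem hp) hz.le
    have hRpq : RightDirected (wd I) C q → RightDirected (wd I) C p := fun h => by
      rw [hR p hp]; rw [hR q hq] at h
      exact h.mono hz'
    have hLpq : LeftDirected (wd I) C p → LeftDirected (wd I) C q := fun h => by
      rw [hL q hq]; rw [hL p hp] at h
      exact h.mono hz'
    -- An inversion of neither allowed type forces `p` to be directed on both sides. Then no letter
    -- of `I` contains `p`, and `p` takes part in no inversion.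
    obtain ⟨h1, h2⟩ : LeftDirected (wd I) C p ∧ RightDirected (wd I) C p := by
      by_cases h3 : RightDirected (wd I) C q
      · refine ⟨?_, hRpq h3⟩
        by_contra h4
        have h5 : ¬ LeftDirected (wd I) C q := fun h5 => h4 (h5.mono hlt.le)
        exact hc (Or.inr ⟨h4, h5⟩)
      · have h4 : ¬ RightDirected (wd I) C p := fun h4 => h3 (h4.mono hlt.le)
        exact absurd (Or.inl ⟨h4, h3⟩) hc
    have hno := h.notMem_of_directed_snoc (srt_one_mem hp) ((hL p hp).1 h1) ((hR p hp).1 h2)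
    rw [srt_one_srt_one] at hno
    obtain ⟨-, k2, k3⟩ := wd_apply_of_avoid (B := I) le_rfl (fun F hF => by
      by_contra hn
      simp only [not_or, not_lt] at hn
      exact hno F hF ⟨hn.2, hn.1⟩)
    rw [k3 p le_rfl le_rfl] at hlt
    exact hlt.asymm ((k2 q).2 hpq)
  · refine ⟨_, inv_srt_apply_mem (x := wd I) (left_mem_block C), ?_⟩
    rw [← leftDirected_srt_iff, apply_inv_apply, inv_apply_apply]
    exact hm.1.2.1
  · refine ⟨_, inv_srt_apply_mem (x := wd I) (right_mem_block C), ?_⟩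
    rw [← rightDirected_srt_iff, apply_inv_apply, inv_apply_apply]
    exact hm.1.2.2

end

theorem Good.avoids {I : List (PosInterval n)} (h : Good I) : Avoids (wd I) := by
  induction I using List.reverseRecOn with
  | nil =>
    rw [wd_nil]
    constructor
    · rw [realizes_4231]
      rintro ⟨v₁, v₂, v₃, v₄, ⟨h1, h2, h3⟩, h4, h5, h6⟩
      rw [inv_one, Perm.one_apply, Perm.one_apply] at h4
      order
    · rw [realizes_45312]
      rintro ⟨v₁, v₂, v₃, v₄, v₅, ⟨h1, h2, h3, h4⟩, h5, h6, h7, h8⟩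
      rw [inv_one, Perm.one_apply, Perm.one_apply] at h6
      order
  | append_singleton I C ih =>
    rw [wd_snoc]
    exact h.split_of_snoc.avoids_srt (ih h.of_snoc)

/-! ## Strong right-descent components -/

theorem succ_le_of_castSucc_lt {i : Fin n} {q : Fin (n + 1)} (h : i.castSucc < q) : i.succ ≤ q := by
  simp only [Fin.le_def, Fin.lt_def, Fin.val_succ, Fin.val_castSucc] at h ⊢
  omega

/-- If two such intervals overlap but have different ends, one contains a descent from outside the
other into it or out of it, against the extremal value at that end. -/
theorem IsStrongDescentInterval.eq_of_not_separated {w : Perm (Fin (n + 1))} {e f : PosInterval n}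
    (he : IsStrongDescentInterval w e) (hf : IsStrongDescentInterval w f)
    (h : ¬ Separated e f) : e = f := by
  simp only [Separated, not_or, not_lt] at h
  obtain ⟨h1, h2⟩ := h
  have key : ∀ {e f : PosInterval n}, IsStrongDescentInterval w e → IsStrongDescentInterval w f →
      f.1.1 ≤ e.1.2 → e.1.1 ≤ f.1.2 → f.1.1 ≤ e.1.1 ∧ e.1.2 ≤ f.1.2 := by
    intro e f he hf h1 h2
    constructor
    · by_contra hc
      have hc := not_le.1 hc
      exact (hf.2.1 _ hc).asymm (he.1 (left_mem_block e) ⟨hc.le, h1⟩ hc)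
    · by_contra hc
      have hc := not_le.1 hc
      exact (hf.2.2 _ hc).asymm (he.1 ⟨h2, hc.le⟩ (right_mem_block e) hc)
  obtain ⟨h3, h4⟩ := key he hf h1 h2
  obtain ⟨h5, h6⟩ := key hf he h2 h1
  exact Subtype.ext (Prod.ext (le_antisymm h5 h3) (le_antisymm h4 h6))

theorem not_separated_of_mem {e f : PosInterval n} {p : Fin (n + 1)} (he : p ∈ block e)
    (hf : p ∈ block f) : ¬ Separated e f := fun h => h.notMem he hf

theorem mem_strongDescents {w : Perm (Fin (n + 1))} {i : Fin n} :
    i ∈ strongDescents w ↔ ∃ e : PosInterval n, IsStrongDescentInterval w e ∧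
      e.1.1 ≤ i.castSucc ∧ i.succ ≤ e.1.2 := by
  simp [strongDescents]

theorem mem_components {K : Finset (Fin n)} {e : PosInterval n} :
    e ∈ components K ↔ IsComponent K e := by
  simp [components]

theorem IsStrongDescentInterval.mem_components {w : Perm (Fin (n + 1))} {e : PosInterval n}
    (he : IsStrongDescentInterval w e) : e ∈ components (strongDescents w) := by
  rw [SymmFactorization.mem_components]
  refine ⟨fun i h1 h2 => mem_strongDescents.2 ⟨e, he, h1, h2⟩, fun i hi hm => ?_, fun i hi hm => ?_⟩
  · obtain ⟨f, hf, h1, h2⟩ := mem_strongDescents.1 hm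
    have hlt := Fin.castSucc_lt_succ (i := i)
    obtain rfl := he.eq_of_not_separated hf
      (not_separated_of_mem (left_mem_block e) ⟨hi ▸ h1.trans hlt.le, hi ▸ h2⟩)
    rw [← hi] at h1
    exact h1.not_gt hlt
  · obtain ⟨f, hf, h1, h2⟩ := mem_strongDescents.1 hm
    have hlt := Fin.castSucc_lt_succ (i := i)
    obtain rfl := he.eq_of_not_separated hf
      (not_separated_of_mem (right_mem_block e) ⟨hi ▸ h1, hi ▸ hlt.le.trans h2⟩)
    rw [← hi] at h2
    exact h2.not_gt hlt

theorem mem_components_strongDescents {w : Perm (Fin (n + 1))} {e : PosInterval n} :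
    e ∈ components (strongDescents w) ↔ IsStrongDescentInterval w e := by
  refine ⟨fun he => ?_, IsStrongDescentInterval.mem_components⟩
  obtain ⟨i, hi⟩ := Fin.exists_castSucc_eq.2 (Fin.ne_last_of_lt e.2)
  have hlt := Fin.castSucc_lt_succ (i := i)
  have hie : i.succ ≤ e.1.2 := by
    have := e.2
    rw [← hi] at this
    exact succ_le_of_castSucc_lt this
  have hm := (mem_components.1 he).1 i hi.ge hie
  obtain ⟨f, hf, h1, h2⟩ := mem_strongDescents.1 hm
  by_cases hef : e = f
  · exact hef ▸ hf
  · exact absurd (separated_of_mem he hf.mem_components hef)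
      (not_separated_of_mem (left_mem_block e) ⟨hi ▸ h1, hi ▸ hlt.le.trans h2⟩)

theorem le_iff_of_isComponent {K : Finset (Fin n)} {e : PosInterval n} (he : IsComponent K e)
    {u : Perm (Fin (n + 1))} (hu : u ∈ parabolic K) (p : Fin (n + 1)) :
    (u p < e.1.1 ↔ p < e.1.1) ∧ (e.1.2 < u p ↔ e.1.2 < p) := by
  constructor
  · rcases Fin.eq_zero_or_eq_succ e.1.1 with h | ⟨j, hj⟩
    · rw [h]; exact iff_of_false (Fin.not_lt_zero _) (Fin.not_lt_zero _)
    · rw [hj, lt_succ_iff_le_castSucc, lt_succ_iff_le_castSucc]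
      exact le_castSucc_iff_of_mem_parabolic hu (he.2.1 j hj.symm) p
  · by_cases h : e.1.2 = Fin.last n
    · rw [h]; exact iff_of_false (Fin.le_last _).not_gt (Fin.le_last _).not_gt
    · obtain ⟨j, hj⟩ := Fin.exists_castSucc_eq.2 h
      rw [← hj, ← not_le, ← not_le,
        le_castSucc_iff_of_mem_parabolic hu (he.2.2 j hj) p]

theorem mem_block_iff_of_isComponent {K : Finset (Fin n)} {e : PosInterval n}
    (he : IsComponent K e) {u : Perm (Fin (n + 1))} (hu : u ∈ parabolic K) (p : Fin (n + 1)) :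
    u p ∈ block e ↔ p ∈ block e := by
  obtain ⟨h1, h2⟩ := le_iff_of_isComponent he hu p
  rw [Set.mem_Icc, Set.mem_Icc, ← not_lt, h1, ← not_lt (a := e.1.2), h2, not_lt, not_lt]

/-- A strictly decreasing map drops by at least one at each step; staying in an interval of the same
length, it must be the reflection. -/
theorem add_eq_of_strictAntiOn {e : PosInterval n} {u : Fin (n + 1) → Fin (n + 1)}
    (hu : StrictAntiOn u (block e)) (hm : ∀ p ∈ block e, u p ∈ block e) {p : Fin (n + 1)}
    (hp : p ∈ block e) : (u p : ℕ) + p = e.1.1 + e.1.2 := by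
  have key : ∀ (d : ℕ) (p q : Fin (n + 1)), p ∈ block e → q ∈ block e → (p : ℕ) + d = q →
      (u q : ℕ) + d ≤ u p := by
    intro d
    induction d with
    | zero =>
      intro p q _ _ h
      have : p = q := Fin.ext (by simpa using h)
      rw [this]; simp
    | succ d ih =>
      intro p q hp hq h
      have hlt : (p : ℕ) + d < n + 1 := by have := q.2; omega
      have hr : (⟨p + d, hlt⟩ : Fin (n + 1)) ∈ block e := by
        obtain ⟨h1, h2⟩ := hp
        obtain ⟨h3, h4⟩ := hq
        simp only [Set.mem_Icc, Fin.le_def] at h1 h4 ⊢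
        omega
      have h1 := ih p _ hp hr rfl
      have h2 := hu hr hq (by rw [Fin.lt_def]; simp only; omega)
      rw [Fin.lt_def] at h2
      omega
  have h1 := key (p - e.1.1) _ p (left_mem_block e) hp (by have := Fin.le_def.1 hp.1; omega)
  have h2 := key (e.1.2 - p) p _ hp (right_mem_block e) (by have := Fin.le_def.1 hp.2; omega)
  have h3 := hm _ (left_mem_block e)
  have h4 := hm _ (right_mem_block e)
  simp only [Set.mem_Icc, Fin.le_def] at h3 h4 hp
  omega

theorem gt_of_mem_strongDescents {w : Perm (Fin (n + 1))} {i : Fin n}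
    (hi : i ∈ strongDescents w) : w i.succ < w i.castSucc := by
  obtain ⟨e, he, h1, h2⟩ := mem_strongDescents.1 hi
  have hlt := Fin.castSucc_lt_succ (i := i)
  exact he.1 ⟨h1, hlt.le.trans h2⟩ ⟨h1.trans hlt.le, h2⟩ hlt

theorem minRep_mul_longest_strongDescents (w : Perm (Fin (n + 1))) :
    minRep (strongDescents w) w * longest (strongDescents w) = w :=
  (dem_unique (x := w) (by simp [one_mem]) fun _ hi => gt_of_mem_strongDescents hi).symm

theorem mem_star {w : Perm (Fin (n + 1))} {i : Fin n} :
    i ∈ star w ↔ ∃ e : PosInterval n, IsStrongDescentInterval w e ∧ InStar w e i := by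
  simp [star]

theorem InStar.mem_reflections {w : Perm (Fin (n + 1))} {e : PosInterval n} {i : Fin n}
    (h : InStar w e i) : e.1.1 ≤ i.castSucc ∧ i.succ ≤ e.1.2 := by
  obtain ⟨l, hl, r, hr, -, -, h⟩ := h
  simp only [Set.mem_Icc, Fin.le_def, Fin.val_succ, Fin.val_castSucc] at hl hr h ⊢
  omega

theorem star_subset (w : Perm (Fin (n + 1))) : star w ⊆ strongDescents w := fun i hi => by
  obtain ⟨e, he, h⟩ := mem_star.1 hi
  exact mem_strongDescents.2 ⟨e, he, h.mem_reflections⟩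

theorem inv_mul_step_mem (w : Perm (Fin (n + 1))) :
    w⁻¹ * step w ∈ parabolic (strongDescents w) := by
  rw [step, ← mul_assoc]
  exact mul_mem (inv_mul_minRep_mem _ w) (parabolic_mono (star_subset w) (longest_mem _))

theorem exists_directed_bounds {w : Perm (Fin (n + 1))} {e : PosInterval n}
    (he : IsStrongDescentInterval w e) :
    ∃ l ∈ block e, ∃ r ∈ block e, (∀ p ∈ block e, LeftDirected w e p ↔ p ≤ l) ∧
      ∀ p ∈ block e, RightDirected w e p ↔ r ≤ p := by
  obtain ⟨l, ⟨hl, hlL⟩, hmax⟩ := WellFounded.has_min (wellFounded_gt (α := Fin (n + 1)))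
    {p | p ∈ block e ∧ LeftDirected w e p} ⟨_, left_mem_block e, he.2.1⟩
  obtain ⟨r, ⟨hr, hrR⟩, hmin⟩ := WellFounded.has_min (wellFounded_lt (α := Fin (n + 1)))
    {p | p ∈ block e ∧ RightDirected w e p} ⟨_, right_mem_block e, he.2.2⟩
  refine ⟨l, hl, r, hr, fun p hp => ⟨fun h => not_lt.1 (hmax p ⟨hp, h⟩), fun h => ?_⟩,
    fun p hp => ⟨fun h => not_lt.1 (hmin p ⟨hp, h⟩), fun h => ?_⟩⟩
  · exact hlL.mono (he.1.antitoneOn hp hl h)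
  · exact hrR.mono (he.1.antitoneOn hr hp h)

/-- The update is split at every monotone interval. -/
theorem split_step {w : Perm (Fin (n + 1))} {e : PosInterval n} (he : IsMonotoneInterval w e) :
    Split (step w) e := by
  obtain ⟨l, hl, r, hr, hL, hR⟩ := exists_directed_bounds he.1
  have hc := mem_components.1 he.1.mem_components
  set K := strongDescents w with hK
  have hρ : ∀ {p}, p ∈ block e → (longest K p : ℕ) + p = e.1.1 + e.1.2 := fun hp =>
    add_eq_of_strictAntiOn (e := e) (u := longest K)
    (strictAntiOn_Icc fun i h1 h2 => longest_gt (hc.1 i h1 h2))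
    (fun p hp => (mem_block_iff_of_isComponent hc (longest_mem K) p).2 hp) hp
  set s := longest (star w) with hs
  have hsK : s ∈ parabolic K := parabolic_mono (star_subset w) (longest_mem _)
  have hsm := mem_block_iff_of_isComponent hc hsK
  have hm : StrictMonoOn (minRep K w) (block e) := strictMonoOn_minRep w fun i h1 h2 => hc.1 i h1 h2
  have hstep : ∀ p, step w p = minRep K w (s p) := fun p => rfl
  -- Strong intervals are separated and the bounds `l`, `r` are unique, so inside `e` only the two
  -- ranges coming from `e` matter.
  have hstar : ∀ i : Fin n, e.1.1 ≤ i.castSucc → i.succ ≤ e.1.2 → (i ∈ star w ↔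
      ((i.succ : ℕ) < e.1.1 + e.1.2 - l ∨ (e.1.2 : ℕ) - r + e.1.1 < i.castSucc)) := by
    intro i h1 h2
    have hlt := Fin.castSucc_lt_succ (i := i)
    constructor
    · intro hi
      obtain ⟨f, hf, hfi⟩ := mem_star.1 hi
      obtain ⟨h3, h4⟩ := hfi.mem_reflections
      obtain rfl := he.1.eq_of_not_separated hf
        (not_separated_of_mem (p := i.castSucc) ⟨h1, hlt.le.trans h2⟩ ⟨h3, hlt.le.trans h4⟩)
      obtain ⟨l', hl', r', hr', hL', hR', h⟩ := hfi
      obtain rfl : l = l' := le_antisymm ((hL' l hl).1 ((hL l hl).2 le_rfl))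
        ((hL l' hl').1 ((hL' l' hl').2 le_rfl))
      obtain rfl : r = r' := le_antisymm ((hR r' hr').1 ((hR' r' hr').2 le_rfl))
        ((hR' r hr).1 ((hR r hr).2 le_rfl))
      exact h.imp And.right And.left
    · intro h
      exact mem_star.2 ⟨e, he.1, l, hl, r, hr, hL, hR, h.imp (fun h => ⟨h1, h⟩) fun h => ⟨h, h2⟩⟩
  -- consecutive positions are directed
  have hrl : l < e.1.2 → (r : ℕ) ≤ l + 1 := by
    intro h
    have hlt : (l : ℕ) + 1 < n + 1 := by have := e.1.2.2; rw [Fin.lt_def] at h; omega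
    have hp : (⟨l + 1, hlt⟩ : Fin (n + 1)) ∈ block e := by
      simp only [Set.mem_Icc, Fin.le_def, Fin.lt_def] at hl h ⊢
      omega
    rcases he.2 _ hp.1 hp.2 with h1 | h1
    · rw [hL _ hp, Fin.le_def] at h1
      simp at h1
    · rw [hR _ hp, Fin.le_def] at h1
      exact h1
  set u := w⁻¹ * step w with hu
  have huK : u ∈ parabolic K := inv_mul_step_mem w
  have hwu : w * u = step w := by simp [hu]
  have hum := mem_block_iff_of_isComponent hc huK
  -- The position `u p` in `w` holds the value that the update places at `p`; inside the block it is
  -- the reflection of `s p`.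
  have hval : ∀ p, longest K (u p) = s p := fun p => by
    apply (minRep K w).injective
    rw [← hstep, ← Perm.mul_apply, minRep_mul_longest_strongDescents, ← Perm.mul_apply, hwu]
  have hup : ∀ p ∈ block e, (s p : ℕ) + u p = e.1.1 + e.1.2 := fun p hp => by
    rw [← hval]; exact hρ ((hum p).2 hp)
  have hcut : ∀ j : Fin n, e.1.1 ≤ j.castSucc → j.succ ≤ e.1.2 → j ∉ star w → ∀ p,
      (s p : ℕ) ≤ j ↔ (p : ℕ) ≤ j := fun j h1 h2 h3 p => by
    have := le_castSucc_iff_of_mem_parabolic (longest_mem (star w)) h3 p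
    rwa [Fin.le_def, Fin.le_def] at this
  have hl' := hl; have hr' := hr
  simp only [Set.mem_Icc, Fin.le_def] at hl' hr'
  have hbn := e.1.2.2
  have hrl' : (l : ℕ) < e.1.2 → (r : ℕ) ≤ l + 1 := hrl
  -- Reflection turns `[a, l]` into `[a + b - l, b]`. The generator just before this segment is not
  -- in `star w` since `r ≤ l + 1`, so `s` preserves the segment; for `l = b` the segment is the
  -- whole block and there is no cut.
  have hLD : ∀ p ∈ block e, LeftDirected (step w) e p ↔ (e.1.1 : ℕ) + e.1.2 - l ≤ p := by
    intro p hp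
    have h1 := hup p hp
    have h2 := (hsm p).2 hp
    rw [← hwu, leftDirected_mul_iff' fun q => (le_iff_of_isComponent hc huK q).1,
      hL _ ((hum p).2 hp), Fin.le_def]
    simp only [Set.mem_Icc, Fin.le_def] at hp h2
    by_cases hlb : (l : ℕ) = e.1.2
    · omega
    · have hj : (e.1.1 : ℕ) + e.1.2 - l - 1 < n := by omega
      have := hcut ⟨_, hj⟩ (by rw [Fin.le_def]; simp; omega) (by rw [Fin.le_def]; simp; omega) (by
        rw [hstar _ (by rw [Fin.le_def]; simp; omega) (by rw [Fin.le_def]; simp; omega)]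
        simp
        omega) p
      simp only at this
      omega
  have hRD : ∀ p ∈ block e, RightDirected (step w) e p ↔ (p : ℕ) ≤ (e.1.2 : ℕ) - r + e.1.1 := by
    intro p hp
    have h1 := hup p hp
    have h2 := (hsm p).2 hp
    rw [← hwu, rightDirected_mul_iff' fun q => (le_iff_of_isComponent hc huK q).2,
      hR _ ((hum p).2 hp), Fin.le_def]
    simp only [Set.mem_Icc, Fin.le_def] at hp h2
    by_cases hra : (r : ℕ) = e.1.1
    · omega
    · have hj : (e.1.2 : ℕ) - r + e.1.1 < n := by omega
      have := hcut ⟨_, hj⟩ (by rw [Fin.le_def]; simp) (by rw [Fin.le_def]; simp; omega) (by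
        rw [hstar _ (by rw [Fin.le_def]; simp) (by rw [Fin.le_def]; simp; omega)]
        simp
        omega) p
      simp only at this
      omega
  have hanti : ∀ p ∈ block e, ∀ q ∈ block e, p < q →
      (∀ i : Fin n, p ≤ i.castSucc → i.succ ≤ q → i ∈ star w) → step w q < step w p := by
    intro p hp q hq hpq h
    have h1 : StrictAntiOn s (Set.Icc p q) := strictAntiOn_Icc fun i h1 h2 => longest_gt (h i h1 h2)
    rw [hstep, hstep]
    exact hm ((hsm q).2 hq) ((hsm p).2 hp) (h1 ⟨le_rfl, hpq.le⟩ ⟨hpq.le, le_rfl⟩ hpq)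
  refine ⟨fun p hp => ?_, fun p hp q hq hpq hlt => ?_, fun p hp q hq hpq h1 h2 => ?_,
    fun p hp q hq hpq h1 h2 => ?_, ⟨u⁻¹ e.1.1, ?_, ?_⟩, ⟨u⁻¹ e.1.2, ?_, ?_⟩⟩
  · have := (hum p).2 hp
    rw [← hwu, leftDirected_mul_iff' fun q => (le_iff_of_isComponent hc huK q).1,
      rightDirected_mul_iff' fun q => (le_iff_of_isComponent hc huK q).2]
    exact he.2 _ this.1 this.2
  · rw [hstep, hstep] at hlt
    have hslt := (hm.lt_iff_lt ((hsm q).2 hq) ((hsm p).2 hp)).1 hlt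
    rw [← hstep, ← hstep] at hlt
    by_cases h1 : RightDirected (step w) e q
    · by_cases h2 : LeftDirected (step w) e p
      · exfalso
        -- The generator just after `p` would lie in `star w`. But `a + b - l ≤ p` rules out the
        -- first range, and `p < q ≤ b - r + a` rules out the second.
        obtain ⟨i, rfl⟩ := Fin.exists_castSucc_eq.2 (Fin.ne_last_of_lt hpq)
        have hi : i.succ ≤ q := succ_le_of_castSucc_lt hpq
        have hmem := mem_of_inversion (longest_mem (star w)) hslt hpq le_rfl hi
        rw [hstar i hp.1 (hi.trans hq.2)] at hmem
        rw [hRD _ hq] at h1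
        rw [hLD _ hp] at h2
        simp only [Fin.lt_def, Fin.le_def, Fin.val_castSucc, Fin.val_succ] at hpq hi hmem h1 h2
        omega
      · exact Or.inr ⟨h2, fun h3 => h2 (h3.mono hlt.le)⟩
    · exact Or.inl ⟨fun h3 => h1 (h3.mono hlt.le), h1⟩
  · refine hanti p hp q hq hpq fun i hi1 hi2 => ?_
    rw [hstar i (hp.1.trans hi1) (hi2.trans hq.2)]
    rw [hRD p hp] at h1
    rw [Fin.le_def] at hi1
    right; omega
  · refine hanti p hp q hq hpq fun i hi1 hi2 => ?_
    rw [hstar i (hp.1.trans hi1) (hi2.trans hq.2)]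
    rw [hLD q hq] at h2
    rw [Fin.le_def] at hi2
    left; omega
  · rw [← hum, apply_inv_apply]; exact left_mem_block e
  · rw [← hwu, leftDirected_mul_iff' fun q => (le_iff_of_isComponent hc huK q).1, apply_inv_apply]
    exact he.1.2.1
  · rw [← hum, apply_inv_apply]; exact right_mem_block e
  · rw [← hwu, rightDirected_mul_iff' fun q => (le_iff_of_isComponent hc huK q).2, apply_inv_apply]
    exact he.1.2.2

theorem isMonotoneInterval_of_avoids {w : Perm (Fin (n + 1))} (hw : Avoids w) {e : PosInterval n}
    (he : IsStrongDescentInterval w e) : IsMonotoneInterval w e := by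
  refine ⟨he, fun p h1 h2 => ?_⟩
  by_contra hc
  obtain ⟨hL, hR⟩ := not_or.1 hc
  have hL' := hL; have hR' := hR
  unfold LeftDirected at hL'
  unfold RightDirected at hR'
  push Not at hL' hR'
  obtain ⟨q, hq, hqp⟩ := hL'
  obtain ⟨r, hr, hrp⟩ := hR'
  have hpa : e.1.1 < p := lt_of_le_of_ne h1 fun h => hL (h ▸ he.2.1)
  have hpb : p < e.1.2 := lt_of_le_of_ne h2 fun h => hR (h ▸ he.2.2)
  -- With `q < a < p < b < r`, the values at these positions form 4, 5, 3, 1, 2.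
  refine hw.2 (realizes_45312.2 ⟨w e.1.2, w r, w p, w q, w e.1.1, ⟨he.2.2 r hr, ?_, ?_, he.2.1 q hq⟩,
    ?_⟩)
  · exact lt_of_le_of_ne hrp fun h => (hpb.trans hr).ne' (w.injective h)
  · exact lt_of_le_of_ne hqp fun h => (hq.trans hpa).ne' (w.injective h)
  · simp only [inv_apply_apply]
    exact ⟨hq, hpa, hpb, hr⟩

/-- Take an inversion between a left-to-right maximum and a right-to-left minimum at the smallest
possible distance. By minimality, all values in between lie between the two extreme ones, so an
ascent in the interior would complete a 4231. -/
theorem exists_isStrongDescentInterval {w : Perm (Fin (n + 1))} (hw : Avoids w) (h1 : w ≠ 1) :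
    ∃ e : PosInterval n, IsStrongDescentInterval w e := by
  have hmax : ∀ t, ∃ p ≤ t, w t ≤ w p ∧ ∀ q < p, w q < w p := fun t => by
    obtain ⟨p, hp, hpm⟩ := Finset.exists_max_image (Finset.Iic t) w ⟨t, by simp⟩
    rw [Finset.mem_Iic] at hp
    refine ⟨p, hp, hpm t (by simp), fun q hq => ?_⟩
    exact lt_of_le_of_ne (hpm q (by rw [Finset.mem_Iic]; order)) fun h => hq.ne (w.injective h)
  have hmin : ∀ t, ∃ p, t ≤ p ∧ w p ≤ w t ∧ ∀ q, p < q → w p < w q := fun t => by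
    obtain ⟨p, hp, hpm⟩ := Finset.exists_min_image (Finset.Ici t) w ⟨t, by simp⟩
    rw [Finset.mem_Ici] at hp
    refine ⟨p, hp, hpm t (by simp), fun q hq => ?_⟩
    exact lt_of_le_of_ne (hpm q (by rw [Finset.mem_Ici]; order)) fun h => hq.ne (w.injective h)
  let S : Set (Fin (n + 1) × Fin (n + 1)) := {r | r.1 < r.2 ∧ w r.2 < w r.1 ∧
    (∀ q < r.1, w q < w r.1) ∧ ∀ q, r.2 < q → w r.2 < w q}
  have hS : S.Nonempty := by
    obtain ⟨p, q, hpq, hlt⟩ : ∃ p q, p < q ∧ w q < w p := by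
      by_contra hc
      push Not at hc
      exact h1 (eq_one_of_strictMono fun p q hpq =>
        lt_of_le_of_ne (hc p q hpq) fun h => hpq.ne (w.injective h))
    obtain ⟨p', h2, h3, h4⟩ := hmax p
    obtain ⟨q', h5, h6, h7⟩ := hmin q
    exact ⟨(p', q'), (h2.trans_lt hpq).trans_le h5, (h6.trans_lt hlt).trans_le h3, h4, h7⟩
  obtain ⟨⟨p, q⟩, ⟨hpq, hlt, hp, hq⟩, hS⟩ := WellFounded.has_min
    (measure fun r : Fin (n + 1) × Fin (n + 1) => (r.2 : ℕ) - r.1).wf S hS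
  simp only at hpq hlt hp hq
  have hleft : ∀ t, p < t → t ≤ q → w t < w p := fun t hpt htq => by
    by_contra hc
    have hc : w p < w t := lt_of_le_of_ne (not_lt.1 hc) fun h => hpt.ne (w.injective h)
    have htq : t < q := lt_of_le_of_ne htq fun h => hc.asymm (h ▸ hlt)
    obtain ⟨p', h2, h3, h4⟩ := hmax t
    have hp' : p < p' := by
      by_contra hn
      rcases (not_lt.1 hn).lt_or_eq with hn | rfl
      · exact (hp _ hn).asymm (hc.trans_le h3)
      · exact hc.not_ge h3
    refine hS (p', q) ⟨h2.trans_lt htq, hlt.trans (hc.trans_le h3), h4, hq⟩ ?_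
    change (q : ℕ) - p' < q - p
    rw [Fin.lt_def] at hp' hpq
    omega
  have hright : ∀ t, p ≤ t → t < q → w q < w t := fun t hpt htq => by
    by_contra hc
    have hc : w t < w q := lt_of_le_of_ne (not_lt.1 hc) fun h => htq.ne (w.injective h)
    have hpt : p < t := lt_of_le_of_ne hpt fun h => hc.asymm (h ▸ hlt)
    obtain ⟨q', h2, h3, h4⟩ := hmin t
    have hq' : q' < q := by
      by_contra hn
      rcases (not_lt.1 hn).lt_or_eq with hn | rfl
      · exact (hq _ hn).asymm (h3.trans_lt hc)
      · exact hc.not_ge h3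
    refine hS (p, q') ⟨hpt.trans_le h2, (h3.trans_lt hc).trans hlt, hp, h4⟩ ?_
    change (q' : ℕ) - p < q - p
    rw [Fin.lt_def] at hq' hpq
    have := Fin.lt_def.1 (hpt.trans_le h2)
    omega
  refine ⟨⟨(p, q), hpq⟩, fun s hs t ht hst => ?_, hp, hq⟩
  rcases hs.1.eq_or_lt with h2 | h2
  · simp only at h2
    subst h2
    exact hleft t hst ht.2
  rcases ht.2.eq_or_lt with h3 | h3
  · simp only at h3
    subst h3
    exact hright s hs.1 hst
  by_contra hc
  have hc : w s < w t := lt_of_le_of_ne (not_lt.1 hc) fun h => hst.ne (w.injective h)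
  refine hw.1 (realizes_4231.2 ⟨w q, w s, w t, w p, ⟨hright s hs.1 (hst.trans h3), hc,
    hleft t (h2.trans hst) ht.2⟩, ?_⟩)
  simp only [inv_apply_apply]
  exact ⟨h2, hst, h3⟩

/-! ## Sorting increases the number of inversions -/

/-- The inversions of `w`, as pairs of values. -/
def valueInversions (w : Perm (Fin (n + 1))) : Finset (Fin (n + 1) × Fin (n + 1)) :=
  Finset.univ.filter fun p => p.1 < p.2 ∧ w⁻¹ p.2 < w⁻¹ p.1

theorem mem_valueInversions {w : Perm (Fin (n + 1))} {p : Fin (n + 1) × Fin (n + 1)} :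
    p ∈ valueInversions w ↔ p.1 < p.2 ∧ w⁻¹ p.2 < w⁻¹ p.1 := by
  simp [valueInversions]

theorem valueInversions_subset_srt (x : Perm (Fin (n + 1))) (e : PosInterval n) :
    valueInversions x ⊆ valueInversions (srt x e) := fun p hp => by
  rw [mem_valueInversions] at hp ⊢
  exact ⟨hp.1, srt_inv_lt_of_lt x e hp.1 hp.2⟩

theorem valueInversions_ssubset_srt {x : Perm (Fin (n + 1))} {e : PosInterval n}
    (h : ¬ IsDescentInterval x e) : valueInversions x ⊂ valueInversions (srt x e) := by
  refine (Finset.ssubset_iff_of_subset (valueInversions_subset_srt x e)).2 ?_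
  unfold IsDescentInterval StrictAntiOn at h
  push Not at h
  obtain ⟨p, hp, q, hq, hpq, hle⟩ := h
  have hlt : x p < x q := lt_of_le_of_ne hle fun h => hpq.ne (x.injective h)
  refine ⟨(x p, x q), mem_valueInversions.2 ⟨hlt, srt_inv_lt_of_mem x ?_ ?_ hlt⟩, fun hm => ?_⟩
  · rwa [inv_apply_apply]
  · rwa [inv_apply_apply]
  · have := (mem_valueInversions.1 hm).2
    simp only [inv_apply_apply] at this
    exact this.asymm hpq

theorem valueInversions_subset_foldl_srt (l : List (PosInterval n)) (x : Perm (Fin (n + 1))) :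
    valueInversions x ⊆ valueInversions (l.foldl srt x) := by
  induction l generalizing x with
  | nil => exact subset_rfl
  | cons e l ih => exact (valueInversions_subset_srt x e).trans (ih _)

/-! ## Lists of components -/

/-- `l` enumerates the connected components of `K`. -/
def IsComponentList (K : Finset (Fin n)) (l : List (PosInterval n)) : Prop :=
  l.Nodup ∧ ∀ e, e ∈ l ↔ e ∈ components K

theorem isComponentList_toList (K : Finset (Fin n)) :
    IsComponentList K (components K).toList :=
  ⟨Finset.nodup_toList _, fun _ => Finset.mem_toList⟩

theorem IsComponentList.reverse {K : Finset (Fin n)} {l : List (PosInterval n)}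
    (h : IsComponentList K l) : IsComponentList K l.reverse :=
  ⟨List.nodup_reverse.2 h.1, fun e => by rw [List.mem_reverse, h.2]⟩

theorem IsComponentList.separated {K : Finset (Fin n)} {A B : List (PosInterval n)}
    {e : PosInterval n} (h : IsComponentList K (A ++ e :: B)) :
    (∀ F ∈ A, Separated F e) ∧ ∀ F ∈ B, Separated F e := by
  have he : e ∈ components K := (h.2 e).1 (by simp)
  have hnd := h.1
  rw [List.nodup_append, List.nodup_cons] at hnd
  exact ⟨fun F hF => separated_of_mem ((h.2 F).1 (by simp [hF])) he
      (hnd.2.2 F hF e List.mem_cons_self),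
    fun F hF => separated_of_mem ((h.2 F).1 (by simp [hF])) he
      fun hFe => hnd.2.1.1 (hFe ▸ hF)⟩

/-- A longest interval containing `i` whose generators all lie in `K` cannot be extended at either
end. -/
theorem exists_component {K : Finset (Fin n)} {i : Fin n} (hi : i ∈ K) :
    ∃ e ∈ components K, i ∈ reflections e := by
  classical
  let S : Finset (PosInterval n) :=
    Finset.univ.filter fun f => reflections f ⊆ K ∧ i ∈ reflections f
  have hS : S.Nonempty := by
    refine ⟨⟨(i.castSucc, i.succ), Fin.castSucc_lt_succ⟩, ?_⟩
    simp only [S, Finset.mem_filter, Finset.mem_univ, true_and, mem_reflections, le_refl, and_self,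
      and_true]
    intro j hj
    rw [mem_reflections] at hj
    simp only [Fin.le_def, Fin.val_castSucc, Fin.val_succ] at hj
    have : j = i := Fin.ext (by omega)
    exact this ▸ hi
  obtain ⟨e, he, hmax⟩ := Finset.exists_max_image S
    (fun f => (f.1.2 : ℕ) - (f.1.1 : ℕ)) hS
  simp only [S, Finset.mem_filter, Finset.mem_univ, true_and] at he hmax
  refine ⟨e, mem_components.2 ⟨fun j h1 h2 => he.1 (mem_reflections.2 ⟨h1, h2⟩),
    fun j hj hjK => ?_, fun j hj hjK => ?_⟩, he.2⟩
  · have hlt : j.castSucc < e.1.2 := Fin.castSucc_lt_succ.trans (hj ▸ e.2)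
    have := hmax ⟨(j.castSucc, e.1.2), hlt⟩ ⟨fun k hk => ?_, ?_⟩
    · have h1 := e.2
      rw [← hj, Fin.lt_def] at h1
      rw [← hj] at this
      simp only [Fin.val_castSucc, Fin.val_succ] at this h1
      omega
    · by_cases hkj : k = j
      · exact hkj ▸ hjK
      · refine he.1 (mem_reflections.2 ⟨?_, (mem_reflections.1 hk).2⟩)
        have h1 := (mem_reflections.1 hk).1
        rw [← hj, Fin.le_def]
        have h2 : (k : ℕ) ≠ j := fun h => hkj (Fin.ext h)
        simp only [Fin.le_def, Fin.val_castSucc, Fin.val_succ] at h1 ⊢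
        omega
    · have h1 := mem_reflections.1 he.2
      refine mem_reflections.2 ⟨le_trans ?_ h1.1, h1.2⟩
      rw [← hj]
      exact Fin.castSucc_lt_succ.le
  · have hlt : e.1.1 < j.succ := (hj ▸ e.2 : e.1.1 < j.castSucc).trans Fin.castSucc_lt_succ
    have := hmax ⟨(e.1.1, j.succ), hlt⟩ ⟨fun k hk => ?_, ?_⟩
    · have h1 := e.2
      rw [← hj, Fin.lt_def] at h1
      rw [← hj] at this
      simp only [Fin.val_castSucc, Fin.val_succ] at this h1
      omega
    · by_cases hkj : k = j
      · exact hkj ▸ hjK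
      · refine he.1 (mem_reflections.2 ⟨(mem_reflections.1 hk).1, ?_⟩)
        have h1 := (mem_reflections.1 hk).2
        rw [← hj, Fin.le_def]
        have h2 : (k : ℕ) ≠ j := fun h => hkj (Fin.ext h)
        simp only [Fin.le_def, Fin.val_castSucc, Fin.val_succ] at h1 ⊢
        omega
    · have h1 := mem_reflections.1 he.2
      refine mem_reflections.2 ⟨h1.1, h1.2.trans ?_⟩
      rw [← hj]
      exact Fin.castSucc_lt_succ.le

theorem inv_mul_foldl_srt_mem {K : Finset (Fin n)} {l : List (PosInterval n)}
    (hl : ∀ e ∈ l, e ∈ components K) (x : Perm (Fin (n + 1))) :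
    x⁻¹ * l.foldl srt x ∈ parabolic K := by
  induction l generalizing x with
  | nil => simp [one_mem]
  | cons e l ih =>
    have he := mem_components.1 (hl e List.mem_cons_self)
    have h1 : x⁻¹ * srt x e ∈ parabolic K := parabolic_mono (fun i hi => by
      rw [mem_reflections] at hi
      exact he.1 i hi.1 hi.2) (inv_mul_dem_mem x (reflections e))
    have h2 := mul_mem h1 (ih (fun f hf => hl f (List.mem_cons_of_mem _ hf)) (srt x e))
    rwa [mul_assoc, mul_inv_cancel_left] at h2

/-- Sorting the components one after another stays in the coset and, the components being separated,
leaves a descent at every generator of `K`. -/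
theorem dem_eq_foldl_srt {K : Finset (Fin n)} {l : List (PosInterval n)}
    (hl : IsComponentList K l) (x : Perm (Fin (n + 1))) : dem x K = l.foldl srt x := by
  refine (dem_unique (inv_mul_foldl_srt_mem (fun e he => (hl.2 e).1 he) x) fun i hi => ?_).symm
  obtain ⟨e, he, hie⟩ := exists_component hi
  obtain ⟨A, B, rfl⟩ := List.append_of_mem ((hl.2 e).2 he)
  have hd : IsDescentInterval ((A ++ e :: B).foldl srt x) e := by
    rw [List.foldl_append, List.foldl_cons, isDescentInterval_foldl_srt hl.separated.2]
    exact srt_anti _ e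
  rw [mem_reflections] at hie
  have hlt := Fin.castSucc_lt_succ (i := i)
  exact hd ⟨hie.1, hlt.le.trans hie.2⟩ ⟨hie.1.trans hlt.le, hie.2⟩ hlt

theorem foldl_srt_step {w : Perm (Fin (n + 1))} {l : List (PosInterval n)}
    (hl : IsComponentList (strongDescents w) l) : l.foldl srt (step w) = w := by
  rw [← dem_eq_foldl_srt hl]
  refine (dem_unique ?_ fun i hi => gt_of_mem_strongDescents hi).symm
  have := inv_mem (inv_mul_step_mem w)
  rwa [mul_inv_rev, inv_inv] at this

/-! ## Flattening a sequence of sets to a word in connected sets -/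

/-- `IsFlat J I`: the word `I` is obtained from the sequence `J` by listing the connected
components of each of its members. -/
inductive IsFlat : List (Finset (Fin n)) → List (PosInterval n) → Prop
  | nil : IsFlat [] []
  | cons {K : Finset (Fin n)} {l : List (PosInterval n)} {J : List (Finset (Fin n))}
      {I : List (PosInterval n)} (hl : IsComponentList K l) (h : IsFlat J I) :
      IsFlat (K :: J) (l ++ I)

theorem exists_isFlat (J : List (Finset (Fin n))) : ∃ I, IsFlat J I := by
  induction J with
  | nil => exact ⟨_, .nil⟩
  | cons K J ih =>
    obtain ⟨I, hI⟩ := ih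
    exact ⟨_, .cons (isComponentList_toList K) hI⟩

theorem IsFlat.append {J J' : List (Finset (Fin n))} {I I' : List (PosInterval n)}
    (h : IsFlat J I) (h' : IsFlat J' I') : IsFlat (J ++ J') (I ++ I') := by
  induction h with
  | nil => exact h'
  | cons hl _ ih => rw [List.cons_append, List.append_assoc]; exact .cons hl ih

theorem IsComponentList.isFlat {K : Finset (Fin n)} {l : List (PosInterval n)}
    (h : IsComponentList K l) : IsFlat [K] l := by
  simpa using IsFlat.cons h IsFlat.nil

theorem IsFlat.reverse {J : List (Finset (Fin n))} {I : List (PosInterval n)}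
    (h : IsFlat J I) : IsFlat J.reverse I.reverse := by
  induction h with
  | nil => exact .nil
  | cons hl _ ih =>
    rw [List.reverse_cons, List.reverse_append]
    exact ih.append hl.reverse.isFlat

theorem IsFlat.demazure_eq {J : List (Finset (Fin n))} {I : List (PosInterval n)}
    (h : IsFlat J I) : demazure J = wd I := by
  have key : ∀ x, J.foldl dem x = I.foldl srt x := by
    induction h with
    | nil => exact fun x => rfl
    | cons hl _ ih =>
      intro x
      rw [List.foldl_cons, List.foldl_append, ih, dem_eq_foldl_srt hl]
  exact key 1

theorem IsFlat.exists_of_append {L R : List (Finset (Fin n))} {I : List (PosInterval n)}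
    (h : IsFlat (L ++ R) I) : ∃ A B, I = A ++ B ∧ IsFlat L A ∧ IsFlat R B := by
  induction L generalizing I with
  | nil => exact ⟨[], I, rfl, .nil, h⟩
  | cons K L ih =>
    rw [List.cons_append] at h
    cases h with
    | cons hl h =>
      obtain ⟨A, B, rfl, hA, hB⟩ := ih h
      exact ⟨_, B, (List.append_assoc _ _ _).symm, .cons hl hA, hB⟩

theorem IsFlat.exists_of_append_cons {J : List (Finset (Fin n))} {I A B : List (PosInterval n)}
    {e : PosInterval n} (h : IsFlat J I) (hI : I = A ++ e :: B) :
    ∃ L K R A' l l' B', J = L ++ K :: R ∧ IsFlat L A' ∧ IsComponentList K (l ++ e :: l') ∧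
      A = A' ++ l ∧ B = l' ++ B' := by
  induction h generalizing A with
  | nil => simp at hI
  | @cons K l J I hl h ih =>
    rcases append_eq_append_cons hI with ⟨X, rfl, rfl⟩ | ⟨X, rfl, rfl⟩
    · exact ⟨[], K, J, [], A, X, I, rfl, .nil, hl, rfl, rfl⟩
    · obtain ⟨L, K', R, A', m, m', B', rfl, hA', hm, rfl, rfl⟩ := ih rfl
      exact ⟨K :: L, K', R, l ++ A', m, m', B', rfl, .cons hl hA', hm, by simp, rfl⟩

theorem IsFlat.exists_of_mem {L R : List (Finset (Fin n))} {K : Finset (Fin n)}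
    {I : List (PosInterval n)} {e : PosInterval n} (h : IsFlat (L ++ K :: R) I)
    (he : e ∈ components K) : ∃ A l l' B, I = (A ++ l) ++ e :: (l' ++ B) ∧ IsFlat L A ∧
      IsComponentList K (l ++ e :: l') := by
  obtain ⟨A, B, rfl, hA, hB⟩ := h.exists_of_append
  cases hB with
  | @cons _ _ _ B hl hB =>
    obtain ⟨l, l', rfl⟩ := List.append_of_mem ((hl.2 e).2 he)
    exact ⟨A, l, l', B, by simp, hA, hl⟩

/-- The components of `K` listed after `e` are separated from `e`, so it does not matter whether
they have been sorted yet. -/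
theorem IsFlat.isMonotoneInterval_iff {L : List (Finset (Fin n))} {K : Finset (Fin n)}
    {A l l' : List (PosInterval n)} {e : PosInterval n} (hL : IsFlat L A)
    (hl : IsComponentList K (l ++ e :: l')) :
    IsMonotoneInterval (demazure (L ++ [K])) e ↔
      IsMonotoneInterval (wd ((A ++ l) ++ [e])) e := by
  rw [(hL.append hl.isFlat).demazure_eq, show A ++ (l ++ e :: l') = (A ++ l ++ [e]) ++ l' by simp,
    wd_append _ l', isMonotoneInterval_foldl_srt hl.separated.2]

theorem IsFlat.isDescentInterval_iff {L : List (Finset (Fin n))} {K : Finset (Fin n)}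
    {A l l' : List (PosInterval n)} {e : PosInterval n} (hL : IsFlat L A)
    (hl : IsComponentList K (l ++ e :: l')) :
    IsDescentInterval (demazure L) e ↔ IsDescentInterval (wd (A ++ l)) e := by
  rw [hL.demazure_eq, wd_append, isDescentInterval_foldl_srt hl.separated.1]

theorem IsFlat.rightMonotone_iff {J : List (Finset (Fin n))} {I : List (PosInterval n)}
    (h : IsFlat J I) : RightMonotone J ↔ RMono I := by
  constructor
  · intro hJ A e B hI
    obtain ⟨L, K, R, A', l, l', B', rfl, hA', hl, rfl, rfl⟩ := h.exists_of_append_cons hI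
    exact (hA'.isMonotoneInterval_iff hl).1 (hJ L K R rfl e ((hl.2 e).1 (by simp)))
  · rintro hI L K R rfl e he
    obtain ⟨A, l, l', B, rfl, hA, hl⟩ := h.exists_of_mem he
    exact (hA.isMonotoneInterval_iff hl).2 (hI _ _ _ rfl)

theorem IsFlat.not_hasRightContraction_iff {J : List (Finset (Fin n))} {I : List (PosInterval n)}
    (h : IsFlat J I) : ¬ HasRightContraction J ↔ RReduced I := by
  constructor
  · intro hJ A e B hI hd
    obtain ⟨L, K, R, A', l, l', B', rfl, hA', hl, rfl, rfl⟩ := h.exists_of_append_cons hI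
    exact hJ ⟨L, K, R, rfl, e, (hl.2 e).1 (by simp), (hA'.isDescentInterval_iff hl).2 hd⟩
  · rintro hI ⟨L, K, R, rfl, e, he, hd⟩
    obtain ⟨A, l, l', B, rfl, hA, hl⟩ := h.exists_of_mem he
    exact hI _ _ _ rfl ((hA.isDescentInterval_iff hl).1 hd)

theorem IsFlat.monotone_iff {J : List (Finset (Fin n))} {I : List (PosInterval n)}
    (h : IsFlat J I) : Monotone J ↔ RMono I ∧ LMono I := by
  rw [Monotone, h.rightMonotone_iff, h.reverse.rightMonotone_iff, RMono_reverse]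

theorem IsFlat.minimal_iff {J : List (Finset (Fin n))} {I : List (PosInterval n)}
    (h : IsFlat J I) : Minimal J ↔ RReduced I ∧ LReduced I := by
  rw [Minimal, h.not_hasRightContraction_iff, h.reverse.not_hasRightContraction_iff,
    RReduced_reverse]

/-! ## Classes of words -/

/-- The class of a word in the Cartier–Foata monoid. -/
noncomputable def wordClass (I : List (PosInterval n)) : CartierFoata n :=
  (I.map (PresentedMonoid.of (CommRel n))).prod

theorem wordClass_append (A B : List (PosInterval n)) :
    wordClass (A ++ B) = wordClass A * wordClass B := by
  simp [wordClass]

theorem wordClass_singleton (e : PosInterval n) :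
    wordClass [e] = PresentedMonoid.of (CommRel n) e := by
  simp [wordClass]

theorem commute_of_separated {e f : PosInterval n} (h : Separated e f) :
    Commute (PresentedMonoid.of (CommRel n) e) (PresentedMonoid.of (CommRel n) f) :=
  (Con.eq (conGen (CommRel n))).2 (ConGen.Rel.of _ _ (CommRel.swap e f h))

theorem wordClass_move {A B : List (PosInterval n)} {e : PosInterval n}
    (hB : ∀ F ∈ B, Separated F e) : wordClass (A ++ e :: B) = wordClass (A ++ B ++ [e]) := by
  have h : Commute (wordClass [e]) (wordClass B) := by
    rw [wordClass_singleton]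
    refine Commute.list_prod_right _ _ fun y hy => ?_
    obtain ⟨F, hF, rfl⟩ := List.mem_map.1 hy
    exact (commute_of_separated (hB F hF)).symm
  rw [← List.singleton_append, wordClass_append, wordClass_append, h.eq, wordClass_append,
    wordClass_append, mul_assoc]

theorem setClass_eq {K : Finset (Fin n)} {l : List (PosInterval n)} (hl : IsComponentList K l) :
    setClass K = wordClass l := by
  classical
  -- Generalizing the set along with its commutation proof allows substituting the underlying set of
  -- the list.
  have key : ∀ (s : Finset (PosInterval n)) (hs : (s : Set (PosInterval n)).Pairwise
      (Function.onFun Commute (PresentedMonoid.of (CommRel n)))), s = l.toFinset →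
      s.noncommProd _ hs = wordClass l := by
    rintro s hs rfl
    exact Finset.noncommProd_toFinset l _ hs hl.1
  exact key _ _ (Finset.ext fun e => by rw [List.mem_toFinset, hl.2])

theorem IsFlat.factorizationClass_eq {J : List (Finset (Fin n))} {I : List (PosInterval n)}
    (h : IsFlat J I) : factorizationClass J = wordClass I := by
  induction h with
  | nil => rfl
  | cons hl _ ih =>
    rw [wordClass_append, ← ih, ← setClass_eq hl]
    simp [factorizationClass]

/-! ## Minimal monotone words -/

/-- Sorting one letter does not affect splitness at a letter separated from it, so the letters can
be appended one at a time. -/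
theorem Good.append {Q l : List (PosInterval n)} (hQ : Good Q)
    (hl : l.Pairwise Separated) (hs : ∀ e ∈ l, Split (wd Q) e) : Good (Q ++ l) := by
  induction l using List.reverseRecOn with
  | nil => simpa using hQ
  | append_singleton l e ih =>
    rw [List.pairwise_append] at hl
    rw [← List.append_assoc]
    refine (ih hl.1 fun f hf => hs f (by simp [hf])).snoc ?_
    rw [wd_append, split_foldl_srt fun F hF => hl.2.2 F hF e (by simp)]
    exact hs e (by simp)

theorem IsComponentList.pairwise {K : Finset (Fin n)} {l : List (PosInterval n)}
    (hl : IsComponentList K l) : l.Pairwise Separated :=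
  hl.1.pairwise_of_forall_ne fun _ he _ hf hne =>
    separated_of_mem ((hl.2 _).1 he) ((hl.2 _).1 hf) hne

theorem split_step_of_mem {w : Perm (Fin (n + 1))} (hw : Avoids w) {l : List (PosInterval n)}
    (hl : IsComponentList (strongDescents w) l) : ∀ e ∈ l, Split (step w) e := fun e he =>
  split_step (isMonotoneInterval_of_avoids hw
    (mem_components_strongDescents.1 ((hl.2 e).1 he)))

theorem avoids_of_avoids_foldl_srt {x : Perm (Fin (n + 1))} {l : List (PosInterval n)}
    (hl : l.Pairwise Separated) (hs : ∀ e ∈ l, Split x e) (h : Avoids (l.foldl srt x)) :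
    Avoids x := by
  induction l using List.reverseRecOn with
  | nil => exact h
  | append_singleton l e ih =>
    rw [List.pairwise_append] at hl
    rw [List.foldl_append, List.foldl_cons, List.foldl_nil] at h
    refine ih hl.1 (fun f hf => hs f (by simp [hf])) (Split.avoids_of_avoids_srt ?_ h)
    rw [split_foldl_srt fun F hF => hl.2.2 F hF e (by simp)]
    exact hs e (by simp)

/-- The permutation `w` is recovered from its update by sorting at split intervals, and this sorting
preserves any occurrence of the patterns. -/
theorem avoids_step {w : Perm (Fin (n + 1))} (hw : Avoids w) : Avoids (step w) := by
  have hl := isComponentList_toList (strongDescents w)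
  refine avoids_of_avoids_foldl_srt hl.pairwise (split_step_of_mem hw hl) ?_
  rwa [foldl_srt_step hl]

/-- A strong component exists, the update is not decreasing on it, and sorting it on the way back to
`w` adds an inversion. This is the termination of the algorithm. -/
theorem card_valueInversions_step_lt {w : Perm (Fin (n + 1))} (hw : Avoids w) (h1 : w ≠ 1) :
    (valueInversions (step w)).card < (valueInversions w).card := by
  obtain ⟨l, hl⟩ : ∃ l, IsComponentList (strongDescents w) l := ⟨_, isComponentList_toList _⟩
  have hs := split_step_of_mem hw hl
  have hw' := foldl_srt_step hl
  obtain ⟨e, he⟩ := exists_isStrongDescentInterval hw h1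
  obtain ⟨A, B, rfl⟩ := List.append_of_mem ((hl.2 e).2 he.mem_components)
  rw [List.foldl_append, List.foldl_cons] at hw'
  have hd : ¬ IsDescentInterval (A.foldl srt (step w)) e := by
    rw [isDescentInterval_foldl_srt hl.separated.1]
    exact (hs e (by simp)).not_isDescentInterval
  have h2 := valueInversions_subset_foldl_srt B (srt (A.foldl srt (step w)) e)
  rw [hw'] at h2
  exact Finset.card_lt_card (((valueInversions_subset_foldl_srt A _).trans_ssubset
    (valueInversions_ssubset_srt hd)).trans_subset h2)

theorem exists_algorithmReturns {w : Perm (Fin (n + 1))} (hw : Avoids w) :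
    ∃ J I, AlgorithmReturns w J ∧ IsFlat J I ∧ Good I ∧ wd I = w := by
  induction hk : (valueInversions w).card using Nat.strong_induction_on generalizing w with
  | _ k ih =>
    by_cases h1 : w = 1
    · refine ⟨[], [], h1 ▸ .done, .nil, ?_, h1.symm⟩
      constructor <;> intro A e B h <;> simp at h
    · obtain ⟨J, I, hJ, hI, hg, hwI⟩ := ih _ (hk ▸ card_valueInversions_step_lt hw h1)
        (avoids_step hw) rfl
      have hl := isComponentList_toList (strongDescents w)
      refine ⟨_, _, .iterate w J h1 hJ, hI.append hl.isFlat, hg.append hl.pairwise ?_, ?_⟩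
      · rw [hwI]; exact split_step_of_mem hw hl
      · rw [wd_append, hwI, foldl_srt_step hl]

theorem wd_append_singleton_ne_one (I : List (PosInterval n)) (e : PosInterval n) :
    wd (I ++ [e]) ≠ 1 := fun h => by
  have := srt_anti (wd I) e (left_mem_block e) (right_mem_block e) e.2
  rw [← wd_snoc, h] at this
  exact this.asymm e.2

/-- Both words are compared with a fixed one: a minimal monotone word `Q` for `step w` followed by
the strong right-descent components of `w`. -/
theorem Good.wordClass_eq {I I' : List (PosInterval n)} (h : Good I) (h' : Good I')
    (hII' : wd I = wd I') : wordClass I = wordClass I' := by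
  induction hk : (valueInversions (wd I)).card using Nat.strong_induction_on
    generalizing I I' with
  | _ k ih =>
    by_cases h1 : wd I = 1
    · have key : ∀ I : List (PosInterval n), wd I = 1 → I = [] := by
        intro I hI
        rcases List.eq_nil_or_concat' I with rfl | ⟨J, C, rfl⟩
        · rfl
        · exact absurd hI (wd_append_singleton_ne_one J C)
      rw [key I h1, key I' (hII' ▸ h1)]
    set w := wd I with hw
    have hav : Avoids w := h.avoids
    obtain ⟨-, Q, -, -, hQ, hwQ⟩ := exists_algorithmReturns (avoids_step hav)
    have hl := isComponentList_toList (strongDescents w)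
    set l := (components (strongDescents w)).toList
    have key : ∀ {I : List (PosInterval n)}, Good I → wd I = w →
        wordClass I = wordClass (Q ++ l) := by
      intro I hI hwI
      rcases List.eq_nil_or_concat' I with rfl | ⟨J, C, rfl⟩
      · exact absurd hwI.symm h1
      have hCs : Split (wd J) C := hI.split_of_snoc
      have hwJ : srt (wd J) C = w := by rw [← wd_snoc]; exact hwI
      have hC : IsStrongDescentInterval w C := hwI ▸ (hI.rmono J C [] rfl).1
      obtain ⟨A, B, hAB⟩ := List.append_of_mem ((hl.2 C).2 hC.mem_components)
      have hs := split_step_of_mem hav hl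
      have hfold := foldl_srt_step hl
      rw [hAB] at hl hs hfold
      obtain ⟨hA, hB⟩ := hl.separated
      have hsub : (A ++ B).Sublist (A ++ C :: B) :=
        List.Sublist.append_left (List.sublist_cons_self C B) A
      -- The comparison word with `C` omitted is again minimal monotone and split at `C`; appending
      -- `C` to it gives the product `w`.
      have hgood : Good (Q ++ (A ++ B)) := hQ.append (hl.pairwise.sublist hsub)
        fun e he => hwQ ▸ hs e (hsub.subset he)
      have hsep : ∀ F ∈ A ++ B, Separated F C := fun F hF =>
        (List.mem_append.1 hF).elim (hA F) (hB F)
      have hsplit : Split (wd (Q ++ (A ++ B))) C := by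
        rw [wd_append, split_foldl_srt hsep, hwQ]
        exact hs C (by simp)
      have hsrt : srt (wd (Q ++ (A ++ B))) C = w := by
        rw [wd_append, hwQ, ← foldl_srt_comm hsep, List.foldl_append, foldl_srt_comm hA,
          ← List.foldl_cons, ← List.foldl_append]
        exact hfold
      -- Both products are split at `C` and agree with `w` outside `C`, so they coincide; they have
      -- fewer inversions than `w`, and the induction hypothesis applies.
      have heq : wd J = wd (Q ++ (A ++ B)) := hCs.eq_of_eq_off hsplit fun p hp => by
        rw [← srt_of_notMem (wd J) hp, hwJ, ← hsrt, srt_of_notMem _ hp]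
      have hcls := ih _ (hk ▸ Finset.card_lt_card
        (hwJ ▸ valueInversions_ssubset_srt hCs.not_isDescentInterval)) hI.of_snoc hgood heq rfl
      rw [hAB, wordClass_append, hcls, ← List.append_assoc Q A (C :: B), wordClass_move hB,
        ← wordClass_append]
      simp
    rw [key h rfl, key h' hII'.symm]

end SymmFactorization

/-! ### The main theorem: transfer from words back to sequences of sets -/

theorem mainTheorem2 (n : ℕ) (w : Equiv.Perm (Fin (n + 1))) :
    (SymmFactorization.Avoids w →
      ∃ J : List (Finset (Fin n)),
        SymmFactorization.AlgorithmReturns w J ∧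
        SymmFactorization.demazure J = w ∧
        SymmFactorization.Monotone J ∧
        SymmFactorization.Minimal J ∧
        ∀ J' : List (Finset (Fin n)),
          SymmFactorization.demazure J' = w →
          SymmFactorization.Monotone J' →
          SymmFactorization.Minimal J' →
          SymmFactorization.factorizationClass J' = SymmFactorization.factorizationClass J) ∧
    ((∃ J : List (Finset (Fin n)),
        SymmFactorization.demazure J = w ∧ SymmFactorization.Monotone J) ↔
      SymmFactorization.Avoids w) := by
  have main : ∀ hw : SymmFactorization.Avoids w,
      ∃ J I, SymmFactorization.AlgorithmReturns w J ∧ SymmFactorization.IsFlat J I ∧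
        SymmFactorization.Good I ∧ SymmFactorization.wd I = w := fun hw =>
    SymmFactorization.exists_algorithmReturns hw
  refine ⟨fun hw => ?_, fun ⟨J, hJ, hm⟩ => ?_, fun hw => ?_⟩
  · obtain ⟨J, I, hJ, hI, hg, hwI⟩ := main hw
    refine ⟨J, hJ, hI.demazure_eq.trans hwI, hI.monotone_iff.2 ⟨hg.rmono, hg.lmono⟩,
      hI.minimal_iff.2 ⟨hg.rreduced, hg.lreduced⟩, fun J' hw' hmon hmin => ?_⟩
    obtain ⟨I', hI'⟩ := SymmFactorization.exists_isFlat J'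
    obtain ⟨h1, h2⟩ := hI'.monotone_iff.1 hmon
    obtain ⟨h3, h4⟩ := hI'.minimal_iff.1 hmin
    rw [hI'.factorizationClass_eq, hI.factorizationClass_eq]
    exact SymmFactorization.Good.wordClass_eq ⟨h1, h2, h3, h4⟩ hg
      (by rw [← hI'.demazure_eq, hw', hwI])
  · obtain ⟨I, hI⟩ := SymmFactorization.exists_isFlat J
    obtain ⟨h1, h2⟩ := hI.monotone_iff.1 hm
    -- A monotone factorization need not be minimal; contracting it keeps the product, and pattern
    -- avoidance is known for minimal monotone words.
    obtain ⟨I', hg, hI'⟩ := SymmFactorization.exists_good h1 h2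
    rw [← hJ, hI.demazure_eq, ← hI']
    exact hg.avoids
  · obtain ⟨J, I, -, hI, hg, hwI⟩ := main hw
    exact ⟨J, hI.demazure_eq.trans hwI, hI.monotone_iff.2 ⟨hg.rmono, hg.lmono⟩⟩
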